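/- Let $n\in\{2,3\}$, $\mathbb T^n=(\mathbb R/\mathbb Z)^n$ and $r\in(n,2n)$. Consider the electron-MHD system $$\partial_t b+\nabla\times((\nabla\times b)\times b)=\mu\Delta b,\qquad \nabla\cdot b=0\qquad\text{on }\mathbb T^n\times[0,\infty),$$ where $\mu>0$ and $b$ takes values in $\mathbb R^3$ (for $n=2$, $b$ depends on $x_1,x_2,t$ only). A weak solution is a field $b\in C_w([0,\infty);L^2)\cap L^\infty(0,\infty;L^2)\cap L^2(0,T;H^1)$ for every $T>0$ that satisfies the system in the sense of distributions. Let $\lambda_q=2^q$, fix a radial $\chi\in C_0^\infty(\mathbb R^n)$ with $\chi(\xi)=1$ for $|\xi|\le\frac34$ and $\chi(\xi)=0$ for $|\xi|\ge1$, and put $\varphi_{-1}=\chi$, $\varphi_q(\xi)=\chi(\lambda_q^{-1}\xi/2)-\chi(\lambda_q^{-1}\xi)$ for $q\ge0$. Write $f_q=\sum_{k\in\mathbb Z^n}\varphi_q(k)\hat f(k)e^{2\pi i k\cdot x}$, $f_{\le Q}=\sum_{q=-1}^{Q}f_q$, and $\|f\|_{H^s}=\big(\sum_{q\ge-1}\lambda_q^{2s}\|f_q\|_{L^2}^2\big)^{1/2}$.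 For $\delta\ge0$ and $c_r>0$ define the determining wavenumber of $b$ at time $t$ by $$\Lambda_{b,r}(t)=\min\Big\{\lambda_q:\ q\in\mathbb N_0,\ \ \lambda_{p-q}^{\delta}\,\lambda_p^{n/r}\|b_p(t)\|_{L^r}<c_r\mu\ \ \forall p>q,\ \ \lambda_q^{-1}\|\nabla b_{\le q}(t)\|_{L^\infty}<c_r\mu\Big\},$$ with $\Lambda_{b,r}(t)=\infty$ if there is no such $q$. Theorem. There is a constant $c_0>0$, depending only on $n$, $r$ and $\chi$, such that the following holds whenever $0<c_r\le c_0$, $\mu>0$ and $\delta\ge0$. Let $b^{(1)},b^{(2)}$ be two weak solutions and let $\Lambda(t)=\max\{\Lambda_{b^{(1)},r}(t),\Lambda_{b^{(2)},r}(t)\}$. If for almost every $t>0$ we have $(b^{(1)}(t)-b^{(2)}(t))_q=0$ for all $q\ge-1$ with $\lambda_q\le\Lambda(t)$, then $$\lim_{t\to\infty}\|b^{(1)}(t)-b^{(2)}(t)\|_{H^s}=0\qquad\text{for every } -\frac nr<s<\frac nr-1 .$$ -/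

import Mathlib

open MeasureTheory Filter Set Topology
open scoped ENNReal Matrix

noncomputable section

namespace EMHD

/-! ### Fields on the unit torus

Everything lives on `𝕋ⁿ = (ℝ/ℤ)ⁿ`.  The magnetic field always has three real components; for
`n = 2` it depends on the first two space variables only. -/

/-- The torus `𝕋ⁿ = (ℝ/ℤ)ⁿ`. -/
abbrev Torus (n : ℕ) : Type := UnitAddTorus (Fin n)

/-- Values of real vector fields, with the Euclidean norm. -/
abbrev V3 : Type := EuclideanSpace ℝ (Fin 3)

/-- Values of complexified vector fields, with the Hermitian norm. -/
abbrev C3 : Type := EuclideanSpace ℂ (Fin 3)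

/-- Lebesgue (normalized Haar) measure on the torus. -/
abbrev torusMeasure (n : ℕ) : Measure (Torus n) :=
  Measure.pi fun _ => AddCircle.haarAddCircle

/-! ### Classical derivatives of functions on the torus -/

/-- The function on `ℝⁿ` obtained by periodic extension is `C^∞`. -/
def IsSmooth {n : ℕ} {E : Type*} [NormedAddCommGroup E] [NormedSpace ℝ E]
    (f : Torus n → E) : Prop :=
  ContDiff ℝ (⊤ : ℕ∞) fun y : Fin n → ℝ => f fun i => (y i : UnitAddCircle)

/-- The classical partial derivative `∂ⱼ f` on the torus. -/
def partialD {n : ℕ} {E : Type*} [NormedAddCommGroup E] [NormedSpace ℝ E]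
    (j : Fin n) (f : Torus n → E) (x : Torus n) : E :=
  deriv (fun h : ℝ => f (x + Pi.single j (h : UnitAddCircle))) 0

/-- The classical Laplacian on the torus. -/
def laplacian {n : ℕ} {E : Type*} [NormedAddCommGroup E] [NormedSpace ℝ E]
    (f : Torus n → E) (x : Torus n) : E :=
  ∑ j : Fin n, partialD j (partialD j f) x

/-- The full gradient of a complex vector field; its values carry the Frobenius norm. -/
def fieldGradient {n : ℕ} (f : Torus n → C3) (x : Torus n) : PiLp 2 fun _ : Fin n => C3 :=
  WithLp.toLp 2 fun j => partialD j f x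

/-- Classical derivative in one of the three directions of `ℝ³`; nothing depends on the
directions with index `≥ n`. -/
def partial3 {n : ℕ} (a : Fin 3) (f : Torus n → ℝ) (x : Torus n) : ℝ :=
  if h : (a : ℕ) < n then partialD ⟨a, h⟩ f x else 0

/-! ### Weak derivatives -/

/-- `g` is the weak derivative `∂ⱼ f` on the torus. -/
def HasWeakPartial {n : ℕ} (j : Fin n) (f g : Torus n → ℝ) : Prop :=
  ∀ φ : Torus n → ℝ, IsSmooth φ →
    ∫ x, f x * partialD j φ x ∂(torusMeasure n) = -∫ x, g x * φ x ∂(torusMeasure n)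

/-- The scalar Sobolev space `H¹(𝕋ⁿ)`. -/
def MemH1 {n : ℕ} (f : Torus n → ℝ) : Prop :=
  MemLp f 2 (torusMeasure n) ∧
    ∀ j : Fin n, ∃ g : Torus n → ℝ, MemLp g 2 (torusMeasure n) ∧ HasWeakPartial j f g

open Classical in
/-- The weak derivative `∂ⱼ f ∈ L²` (unique up to null sets); it is `0` by convention if there is
none. -/
def weakPartial {n : ℕ} (j : Fin n) (f : Torus n → ℝ) : Torus n → ℝ :=
  if h : ∃ g : Torus n → ℝ, MemLp g 2 (torusMeasure n) ∧ HasWeakPartial j f g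
  then h.choose else 0

/-- Weak derivative in one of the three directions of `ℝ³`. -/
def weakPartial3 {n : ℕ} (a : Fin 3) (f : Torus n → ℝ) (x : Torus n) : ℝ :=
  if h : (a : ℕ) < n then weakPartial ⟨a, h⟩ f x else 0

/-- `∇ × f`, for the differentiation operators `D 0, D 1, D 2`. -/
def curlWith {n : ℕ} (D : Fin 3 → (Torus n → ℝ) → Torus n → ℝ)
    (f : Torus n → V3) (x : Torus n) : Fin 3 → ℝ :=
  ![D 1 (fun y => f y 2) x - D 2 (fun y => f y 1) x,
    D 2 (fun y => f y 0) x - D 0 (fun y => f y 2) x,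
    D 0 (fun y => f y 1) x - D 1 (fun y => f y 0) x]

/-- The classical curl. -/
def curl {n : ℕ} (f : Torus n → V3) : Torus n → Fin 3 → ℝ := curlWith partial3 f

/-- The weak curl. -/
def weakCurl {n : ℕ} (f : Torus n → V3) : Torus n → Fin 3 → ℝ := curlWith weakPartial3 f

/-- `∫ |∇f|² dx`, through weak derivatives. -/
def gradEnergy {n : ℕ} (f : Torus n → V3) : ℝ≥0∞ :=
  ∑ j : Fin n, ∑ a : Fin 3, eLpNorm (weakPartial j fun x => f x a) 2 (torusMeasure n) ^ 2

/-- Divergence-free in the sense of distributions. -/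
def DivFree {n : ℕ} (f : Torus n → V3) : Prop :=
  ∀ φ : Torus n → ℝ, IsSmooth φ →
    ∫ x, ∑ a : Fin 3, f x a * partial3 a φ x ∂(torusMeasure n) = 0

/-! ### Weak solutions of electron-MHD -/

/-- Global finite-energy weak solutions of
`∂ₜ b + ∇ × ((∇ × b) × b) = μ Δ b`, `∇ · b = 0` on `𝕋ⁿ × [0, ∞)`:
`b ∈ C_w([0,∞); L²) ∩ L^∞(0,∞; L²) ∩ L²(0,T; H¹)` for every `T`, and the equation holds in the
sense of distributions, in its time-integrated form. -/
structure IsWeakSolution {n : ℕ} (μ : ℝ) (b : ℝ → Torus n → V3) : Prop where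
  memL2 : ∀ t, 0 ≤ t → MemLp (b t) 2 (torusMeasure n)
  weakCont : ∀ φ : Torus n → V3, MemLp φ 2 (torusMeasure n) →
    ContinuousOn (fun t => ∫ x, (b t x).ofLp ⬝ᵥ (φ x).ofLp ∂(torusMeasure n)) (Ici 0)
  bounded : ∃ M : NNReal, ∀ t, 0 ≤ t → eLpNorm (b t) 2 (torusMeasure n) ≤ M
  memH1 : ∀ᵐ t ∂(volume.restrict (Ioi (0 : ℝ))), ∀ a : Fin 3, MemH1 fun x => b t x a
  dissipation : ∀ T : ℝ, 0 < T → ∫⁻ t in Ioo 0 T, gradEnergy (b t) < ∞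
  divFree : ∀ t, 0 ≤ t → DivFree (b t)
  weakForm : ∀ φ : Torus n → V3, IsSmooth φ → ∀ t, 0 ≤ t →
    ∫ x, (b t x).ofLp ⬝ᵥ (φ x).ofLp ∂(torusMeasure n)
      - ∫ x, (b 0 x).ofLp ⬝ᵥ (φ x).ofLp ∂(torusMeasure n)
      + ∫ τ in (0 : ℝ)..t,
          ∫ x, (weakCurl (b τ) x ⨯₃ (b τ x).ofLp) ⬝ᵥ curl φ x ∂(torusMeasure n)
    = μ * ∫ τ in (0 : ℝ)..t,
          ∫ x, (b τ x).ofLp ⬝ᵥ (laplacian φ x).ofLp ∂(torusMeasure n)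

/-! ### Littlewood-Paley decomposition -/

/-- `λ_q = 2^q`. -/
def lam (q : ℤ) : ℝ := (2 : ℝ) ^ q

/-- Admissible cutoffs: smooth, radial, equal to `1` for `|ξ| ≤ 3/4` and to `0` for `|ξ| ≥ 1`. -/
structure IsCutoff {n : ℕ} (χ : EuclideanSpace ℝ (Fin n) → ℝ) : Prop where
  smooth : ContDiff ℝ (⊤ : ℕ∞) χ
  radial : ∀ ξ η, ‖ξ‖ = ‖η‖ → χ ξ = χ η
  eq_one : ∀ ξ, ‖ξ‖ ≤ 3 / 4 → χ ξ = 1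
  eq_zero : ∀ ξ, 1 ≤ ‖ξ‖ → χ ξ = 0

/-- The dyadic symbols `φ_q`: `φ_{-1} = χ` and
`φ_q(ξ) = χ(λ_q⁻¹ ξ / 2) - χ(λ_q⁻¹ ξ)` for `q ≥ 0`. -/
def symbol {n : ℕ} (χ : EuclideanSpace ℝ (Fin n) → ℝ) (q : ℤ)
    (ξ : EuclideanSpace ℝ (Fin n)) : ℝ :=
  if 0 ≤ q then χ ((1 / 2 : ℝ) • (lam q)⁻¹ • ξ) - χ ((lam q)⁻¹ • ξ)
  else if q = -1 then χ ξ else 0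

/-- A lattice point as a vector of `ℝⁿ`. -/
def freq {n : ℕ} (k : Fin n → ℤ) : EuclideanSpace ℝ (Fin n) :=
  WithLp.toLp 2 fun i => (k i : ℝ)

/-- A real vector as a complex vector. -/
def complexify (v : V3) : C3 := WithLp.toLp 2 fun a => (v a : ℂ)

/-- The Fourier coefficient `f̂(k) = ∫ f(x) e^{-2πi k·x} dx`. -/
def coeff {n : ℕ} (f : Torus n → V3) (k : Fin n → ℤ) : C3 :=
  UnitAddTorus.mFourierCoeff (fun x => complexify (f x)) k

/-- The dyadic block `f_q = Δ_q f = ∑ₖ φ_q(k) f̂(k) e^{2πi k·x}` (a finite sum). -/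
def block {n : ℕ} (χ : EuclideanSpace ℝ (Fin n) → ℝ) (q : ℤ) (f : Torus n → V3)
    (x : Torus n) : C3 :=
  ∑' k : Fin n → ℤ, ((symbol χ q (freq k) : ℂ) * UnitAddTorus.mFourier k x) • coeff f k

/-- The low-frequency part `f_{≤ Q} = ∑_{q=-1}^{Q} f_q`. -/
def lowPass {n : ℕ} (χ : EuclideanSpace ℝ (Fin n) → ℝ) (Q : ℤ) (f : Torus n → V3)
    (x : Torus n) : C3 :=
  ∑ q ∈ Finset.Icc (-1) Q, block χ q f x

/-- The Sobolev norm `‖f‖_{H^s} = (∑_{q ≥ -1} λ_q^{2s} ‖f_q‖_2²)^{1/2} ∈ [0, ∞]`. The summation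
index is `m = q + 1`. -/
def sobolevNorm {n : ℕ} (χ : EuclideanSpace ℝ (Fin n) → ℝ) (s : ℝ) (f : Torus n → V3) : ℝ≥0∞ :=
  (∑' m : ℕ, ENNReal.ofReal (lam ((m : ℤ) - 1) ^ (2 * s)) *
    eLpNorm (block χ ((m : ℤ) - 1) f) 2 (torusMeasure n) ^ 2) ^ (1 / 2 : ℝ)

/-! ### The determining wavenumber -/

/-- The two conditions on `q` in the definition of the determining wavenumber; the torus has side
length `1`, so that the dimensionless dyadic ratio in the first one is `λ_{p-q} = λ_p / λ_q`. -/
def Admissible {n : ℕ} (χ : EuclideanSpace ℝ (Fin n) → ℝ) (r δ c μ : ℝ) (f : Torus n → V3)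
    (q : ℕ) : Prop :=
  (∀ p : ℕ, q < p →
    ENNReal.ofReal (lam ((p : ℤ) - q) ^ δ * lam p ^ ((n : ℝ) / r)) *
      eLpNorm (block χ p f) (ENNReal.ofReal r) (torusMeasure n) < ENNReal.ofReal (c * μ)) ∧
  ENNReal.ofReal (lam q)⁻¹ * eLpNorm (fieldGradient (lowPass χ q f)) ∞ (torusMeasure n)
    < ENNReal.ofReal (c * μ)

/-- The determining wavenumber of a field: the least `λ_q`, `q ∈ ℕ`, with `q` admissible, and `∞`
if there is none. -/
def wavenumber {n : ℕ} (χ : EuclideanSpace ℝ (Fin n) → ℝ) (r δ c μ : ℝ) (f : Torus n → V3) :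
    ℝ≥0∞ :=
  ⨅ (q : ℕ) (_ : Admissible χ r δ c μ f q), ENNReal.ofReal (lam q)

/-- `f|_{≤ Λ} = 0`: all dyadic blocks `f_q` with `q ≥ -1`, `λ_q ≤ Λ` vanish. -/
def VanishesUpTo {n : ℕ} (χ : EuclideanSpace ℝ (Fin n) → ℝ) (Λ : ℝ≥0∞) (f : Torus n → V3) :
    Prop :=
  ∀ q : ℤ, -1 ≤ q → ENNReal.ofReal (lam q) ≤ Λ → ∀ x, block χ q f x = 0

end EMHD

end

/-!
# Determining wavenumbers for electron-MHD

Let `w = b₁ - b₂` be the difference of two weak solutions and let `A = curl⁻¹ w` be its vector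
potential. Testing the equation for `w` with `A` gives the balance of the energy
`E = ‖w‖²_{H⁻¹} = ∑_{k ≠ 0} |ŵ(k)|² / (4π²|k|²)`,

  `dE/dt = -2μ ‖w‖₂² - (T_{b₁} + T_{b₂})`,   `T_b = ∫ ((∇ × w) × b + (∇ × b) × w) · A`,

because `(∇ × b₁) × b₁ - (∇ × b₂) × b₂` is the average over `b = b₁, b₂` of
`(∇ × w) × b + (∇ × b) × w` (`hasSum_triad`). The heart of the matter is the estimate
`|T_b| ≤ C c_r μ ‖w‖₂²` for `w` supported above the determining wavenumber of `b`
(`norm_sum_triad_le`). The form `T_b` is decomposed into interactions of dyadic shells of `w` and `A`.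

* For shells at comparable frequencies `2^q`, symmetrizing in the two arguments moves a derivative
  onto `b` (`triad_add_triad`). Only frequencies of `b` up to a multiple of `2^q` matter, and there
  `‖∇b‖_∞ ≤ C c_r μ 2^q`: below the wavenumber by definition, and above it by Bernstein's inequality
  for the blocks of `b` (`Admissible.controlled`). The factor `2^q` is compensated by `A`.
* For shells at distance `d ≥ 3`, no derivative is left on `b` in the divergence form
  (`triad_eq_divergence`), and only the blocks of `b` next to the higher shell matter. Their bound
  `‖b_p‖_r ≤ c_r μ 2^{-pn/r}` and Bernstein's inequality for the lower shell give the decay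
  `2^{-dn/r}` (`norm_sum_sum_far_le`), which is summed by Schur's test.

For small `c_r` the interactions are thus at most half of the dissipation `2μ ‖w‖₂²`, and
`dE/dt ≤ -μ ‖w‖₂² ≤ -4π²μ E`, so `E → 0` (`energy_decay`). As `w` is bounded in `L²`, convergence in
`H⁻¹` implies convergence in `H^s` for every `s < 0` (`tendsto_sobolevNorm`), and
`s < n/r - 1 < 0`. The zero mode, which `E` does not see, is conserved and hence vanishes.

All of this is carried out on the Fourier coefficients. A weak solution has just enough regularity
for its single modes to be absolutely continuous in time (`IsWeakSolution.vcoef_eq`), which gives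
the energy balance for finitely many modes. The limit is justified by
`∑_{k ≠ 0} |Â(k)| ≤ C ‖∇w‖₂`, which holds since `∑_{k ≠ 0} |k|⁻⁴` converges for `n ≤ 3`, and which
bounds the nonlinear term by an integrable function of time (`norm_hallPairing_le`).
-/

noncomputable section

namespace EMHD

open UnitAddTorus ComplexConjugate

variable {n : ℕ}

/-! ### Trigonometric polynomials on the torus -/

theorem integral_mFourier (k : Fin n → ℤ) :
    ∫ x, mFourier k x ∂(torusMeasure n) = if k = 0 then 1 else 0 := by
  have h := (orthonormal_iff_ite.mp (orthonormal_mFourier (d := Fin n))) 0 k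
  rw [ContinuousMap.inner_toLp] at h
  have h2 : ∫ x, mFourier k x ∂(torusMeasure n) = if (0 : Fin n → ℤ) = k then 1 else 0 := by
    rw [← h]
    refine integral_congr_ae (ae_of_all _ fun x => ?_)
    simp [mFourier_zero]
  rw [h2]
  simp [eq_comm]

theorem norm_mFourier_apply (k : Fin n → ℤ) (x : Torus n) : ‖mFourier k x‖ = 1 := by
  simp only [mFourier, ContinuousMap.coe_mk, norm_prod, fourier_apply, Circle.norm_coe,
    Finset.prod_const_one]

theorem continuous_mFourier (k : Fin n → ℤ) : Continuous fun x : Torus n => mFourier k x :=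
  (mFourier k).continuous

theorem integrable_of_continuous {E : Type*} [NormedAddCommGroup E] {f : Torus n → E}
    (hf : Continuous f) : Integrable f (torusMeasure n) :=
  hf.integrable_of_hasCompactSupport (HasCompactSupport.of_compactSpace f)

theorem memLp_of_continuous {E : Type*} [NormedAddCommGroup E] {f : Torus n → E}
    (hf : Continuous f) (p : ℝ≥0∞) : MemLp f p (torusMeasure n) :=
  hf.memLp_of_hasCompactSupport (HasCompactSupport.of_compactSpace f)

/-- The trigonometric polynomial `∑_{k ∈ S} f(k) e^{2πi k·x}`. -/
def trigPoly (S : Finset (Fin n → ℤ)) (f : (Fin n → ℤ) → ℂ) (x : Torus n) : ℂ :=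
  ∑ k ∈ S, f k * mFourier k x

theorem continuous_trigPoly (S : Finset (Fin n → ℤ)) (f : (Fin n → ℤ) → ℂ) :
    Continuous (trigPoly S f) :=
  continuous_finsetSum _ fun k _ => continuous_const.mul (continuous_mFourier k)

theorem integral_trigPoly_mul_mul (F S S' : Finset (Fin n → ℤ)) (f g h : (Fin n → ℤ) → ℂ) :
    ∫ x, trigPoly F f x * trigPoly S g x * trigPoly S' h x ∂(torusMeasure n)
      = ∑ k ∈ S, ∑ l ∈ S', ∑ m ∈ F, if m + k + l = 0 then f m * g k * h l else 0 := by
  have h1 : ∀ x : Torus n, trigPoly F f x * trigPoly S g x * trigPoly S' h x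
      = ∑ k ∈ S, ∑ l ∈ S', ∑ m ∈ F, f m * g k * h l * mFourier (m + k + l) x := by
    intro x
    simp only [trigPoly]
    rw [mul_assoc, Finset.sum_mul_sum, mul_comm, Finset.sum_mul]
    refine Finset.sum_congr rfl fun k _ => ?_
    rw [Finset.sum_mul]
    refine Finset.sum_congr rfl fun l _ => ?_
    rw [Finset.mul_sum]
    refine Finset.sum_congr rfl fun m _ => ?_
    rw [mFourier_add, mFourier_add]
    ring
  simp_rw [h1]
  rw [integral_finsetSum _ fun _ _ => integrable_of_continuous (by fun_prop)]
  refine Finset.sum_congr rfl fun k _ => ?_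
  rw [integral_finsetSum _ fun _ _ => integrable_of_continuous (by fun_prop)]
  refine Finset.sum_congr rfl fun l _ => ?_
  rw [integral_finsetSum _ fun _ _ => integrable_of_continuous (by fun_prop)]
  refine Finset.sum_congr rfl fun m _ => ?_
  rw [integral_const_mul, integral_mFourier]
  split_ifs <;> simp

theorem integral_norm_trigPoly_sq (S : Finset (Fin n → ℤ)) (g : (Fin n → ℤ) → ℂ) :
    ∫ x, ‖trigPoly S g x‖ ^ 2 ∂(torusMeasure n) = ∑ k ∈ S, ‖g k‖ ^ 2 := by
  have h1 : ∀ x : Torus n, ((‖trigPoly S g x‖ ^ 2 : ℝ) : ℂ)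
      = ∑ k ∈ S, ∑ l ∈ S, g k * conj (g l) * mFourier (k + -l) x := by
    intro x
    rw [Complex.ofReal_pow, ← Complex.mul_conj']
    simp only [trigPoly]
    rw [map_sum, Finset.sum_mul_sum]
    refine Finset.sum_congr rfl fun k _ => Finset.sum_congr rfl fun l _ => ?_
    rw [mFourier_add, mFourier_neg, map_mul]
    ring
  have h2 : ((∫ x, ‖trigPoly S g x‖ ^ 2 ∂(torusMeasure n) : ℝ) : ℂ)
      = ((∑ k ∈ S, ‖g k‖ ^ 2 : ℝ) : ℂ) := by
    rw [← integral_complex_ofReal]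
    simp_rw [h1]
    rw [integral_finsetSum _ fun _ _ => integrable_of_continuous (by fun_prop)]
    push_cast
    refine Finset.sum_congr rfl fun k hk => ?_
    rw [integral_finsetSum _ fun _ _ => integrable_of_continuous (by fun_prop)]
    simp_rw [integral_const_mul, integral_mFourier, ← sub_eq_add_neg, sub_eq_zero]
    rw [Finset.sum_eq_single k (by intro l _ hl; simp [hl.symm]) (by simp [hk])]
    simp [Complex.mul_conj']
  exact_mod_cast h2

theorem norm_trigPoly_le (S : Finset (Fin n → ℤ)) (g : (Fin n → ℤ) → ℂ) (x : Torus n) :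
    ‖trigPoly S g x‖ ≤ √(S.card) * √(∑ k ∈ S, ‖g k‖ ^ 2) := by
  have h1 : ‖trigPoly S g x‖ ≤ ∑ k ∈ S, 1 * ‖g k‖ := by
    refine (norm_sum_le _ _).trans (Finset.sum_le_sum fun k _ => ?_)
    rw [norm_mul, norm_mFourier_apply, one_mul, mul_one]
  refine h1.trans ((Real.sum_mul_le_sqrt_mul_sqrt _ _ _).trans ?_)
  simp

/-- If the coefficients `f` live on `F`, integrating a product of three trigonometric polynomials
picks out the frequency triples that add up to zero. -/
theorem sum_sum_eq_integral (F S S' : Finset (Fin n → ℤ)) (f g h : (Fin n → ℤ) → ℂ)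
    (hf : ∀ k ∈ S, ∀ l ∈ S', -k - l ∈ F) :
    ∑ k ∈ S, ∑ l ∈ S', f (-k - l) * g k * h l
      = ∫ x, trigPoly F f x * trigPoly S g x * trigPoly S' h x ∂(torusMeasure n) := by
  rw [integral_trigPoly_mul_mul]
  refine Finset.sum_congr rfl fun k hk => Finset.sum_congr rfl fun l hl => ?_
  rw [Finset.sum_eq_single (-k - l)]
  · rw [if_pos (by abel)]
  · intro m _ hm
    rw [if_neg]
    intro h
    apply hm
    rw [eq_sub_iff_add_eq, eq_neg_iff_add_eq_zero, ← h]
    abel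
  · exact fun h => absurd (hf k hk l hl) h

theorem integral_norm_mul_le (f g : Torus n → ℂ) (hf : Continuous f) (hg : Continuous g) :
    ∫ x, ‖f x‖ * ‖g x‖ ∂(torusMeasure n)
      ≤ √(∫ x, ‖f x‖ ^ 2 ∂(torusMeasure n)) * √(∫ x, ‖g x‖ ^ 2 ∂(torusMeasure n)) := by
  have h := integral_mul_le_Lp_mul_Lq_of_nonneg (μ := torusMeasure n) (p := 2) (q := 2)
    Real.HolderConjugate.two_two (f := fun x => ‖f x‖) (g := fun x => ‖g x‖)
    (ae_of_all _ fun x => norm_nonneg _) (ae_of_all _ fun x => norm_nonneg _)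
    (memLp_of_continuous hf.norm _) (memLp_of_continuous hg.norm _)
  simpa [Real.sqrt_eq_rpow] using h

/-- The trilinear estimate in `L^∞ × L² × L²`. -/
theorem norm_sum_sum_le_of_bounded (F S S' : Finset (Fin n → ℤ)) (f g h : (Fin n → ℤ) → ℂ)
    (hf : ∀ k ∈ S, ∀ l ∈ S', -k - l ∈ F) {B : ℝ} (hB : ∀ x, ‖trigPoly F f x‖ ≤ B) :
    ‖∑ k ∈ S, ∑ l ∈ S', f (-k - l) * g k * h l‖
      ≤ B * √(∑ k ∈ S, ‖g k‖ ^ 2) * √(∑ l ∈ S', ‖h l‖ ^ 2) := by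
  have hB0 : 0 ≤ B := (norm_nonneg _).trans (hB 0)
  rw [sum_sum_eq_integral F S S' f g h hf]
  have c1 := continuous_trigPoly F f
  have c2 := continuous_trigPoly S g
  have c3 := continuous_trigPoly S' h
  calc ‖∫ x, trigPoly F f x * trigPoly S g x * trigPoly S' h x ∂(torusMeasure n)‖
      ≤ ∫ x, ‖trigPoly F f x * trigPoly S g x * trigPoly S' h x‖ ∂(torusMeasure n) :=
        norm_integral_le_integral_norm _
    _ ≤ ∫ x, B * (‖trigPoly S g x‖ * ‖trigPoly S' h x‖) ∂(torusMeasure n) := by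
        refine integral_mono (integrable_of_continuous (by fun_prop))
          (integrable_of_continuous (by fun_prop)) fun x => ?_
        simp only [norm_mul, mul_assoc]
        exact mul_le_mul_of_nonneg_right (hB x) (by positivity)
    _ = B * ∫ x, (‖trigPoly S g x‖ * ‖trigPoly S' h x‖) ∂(torusMeasure n) :=
        integral_const_mul _ _
    _ ≤ _ := by
        rw [mul_assoc, ← integral_norm_trigPoly_sq, ← integral_norm_trigPoly_sq]
        exact mul_le_mul_of_nonneg_left (integral_norm_mul_le _ _ c2 c3) hB0

/-- The trilinear estimate in `L^r × L^{2r/(r-2)} × L²`; the middle factor is interpolated between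
`L²` and `L^∞`, and its supremum is bounded by Cauchy-Schwarz on the Fourier side. -/
theorem norm_sum_sum_le_of_Lr (F S S' : Finset (Fin n → ℤ)) (f g h : (Fin n → ℤ) → ℂ)
    (hf : ∀ k ∈ S, ∀ l ∈ S', -k - l ∈ F) {r : ℝ} (hr : 2 < r) :
    ‖∑ k ∈ S, ∑ l ∈ S', f (-k - l) * g k * h l‖
      ≤ (∫ x, ‖trigPoly F f x‖ ^ r ∂(torusMeasure n)) ^ (1 / r) * (S.card : ℝ) ^ (1 / r)
        * √(∑ k ∈ S, ‖g k‖ ^ 2) * √(∑ l ∈ S', ‖h l‖ ^ 2) := by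
  rw [sum_sum_eq_integral F S S' f g h hf]
  have c1 := continuous_trigPoly F f
  have c2 := continuous_trigPoly S g
  have c3 := continuous_trigPoly S' h
  set f' := trigPoly F f
  set g' := trigPoly S g
  set h' := trigPoly S' h
  set G := ∑ k ∈ S, ‖g k‖ ^ 2 with hG
  have hG0 : 0 ≤ G := Finset.sum_nonneg fun _ _ => by positivity
  have hr0 : 0 < r := by linarith
  have hS0 : (0 : ℝ) ≤ S.card := by positivity
  have hI0 : 0 ≤ ∫ x, ‖f' x‖ ^ r ∂(torusMeasure n) :=
    integral_nonneg fun x => by positivity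
  have hsup : ∀ x, ‖g' x‖ ^ 2 ≤ S.card * G := by
    intro x
    have := norm_trigPoly_le S g x
    calc ‖g' x‖ ^ 2 ≤ (√(S.card) * √G) ^ 2 := by gcongr
      _ = _ := by rw [mul_pow, Real.sq_sqrt hS0, Real.sq_sqrt hG0]
  have hint : ∫ x, ‖g' x‖ ^ 2 ∂(torusMeasure n) = G := integral_norm_trigPoly_sq S g
  -- Hölder with exponents `r / 2` and `r / (r - 2)`; the excess power of `g'` goes into its supremum
  have key : ∫ x, ‖f' x * g' x‖ ^ 2 ∂(torusMeasure n)
      ≤ ((∫ x, ‖f' x‖ ^ r ∂(torusMeasure n)) ^ (1 / r) * (S.card : ℝ) ^ (1 / r) * √G) ^ 2 := by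
    have hpq : (r / 2).HolderConjugate (r / (r - 2)) := by
      rw [Real.holderConjugate_iff]
      refine ⟨by linarith, ?_⟩
      have : r - 2 ≠ 0 := by linarith
      field_simp
      ring
    have he : 0 < 2 - 4 / r := by
      have : 4 / r < 2 := by rw [div_lt_iff₀ hr0]; linarith
      linarith
    have H := integral_mul_le_Lp_mul_Lq_of_nonneg (μ := torusMeasure n) hpq
      (f := fun x => ‖f' x‖ ^ 2) (g := fun x => ‖g' x‖ ^ (2 - 4 / r))
      (ae_of_all _ fun x => by positivity) (ae_of_all _ fun x => by positivity)
      (memLp_of_continuous (by fun_prop) _)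
      (memLp_of_continuous (c2.norm.rpow_const fun _ => Or.inr he.le) _)
    have e1 : ∀ x, (‖f' x‖ ^ 2) ^ (r / 2) = ‖f' x‖ ^ r := fun x => by
      rw [← Real.rpow_natCast, ← Real.rpow_mul (norm_nonneg _)]
      congr 1
      push_cast
      ring
    have e2 : ∀ x, (‖g' x‖ ^ (2 - 4 / r)) ^ (r / (r - 2)) = ‖g' x‖ ^ 2 := fun x => by
      rw [← Real.rpow_natCast, ← Real.rpow_mul (norm_nonneg _)]
      congr 1
      have : r - 2 ≠ 0 := by linarith
      push_cast
      field_simp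
      ring
    simp_rw [e1, e2] at H
    rw [hint] at H
    have hC0 : 0 ≤ ((S.card : ℝ) * G) ^ (2 / r) := by positivity
    calc ∫ x, ‖f' x * g' x‖ ^ 2 ∂(torusMeasure n)
        ≤ ∫ x, ((S.card : ℝ) * G) ^ (2 / r) * (‖f' x‖ ^ 2 * ‖g' x‖ ^ (2 - 4 / r))
            ∂(torusMeasure n) := by
          refine integral_mono (integrable_of_continuous (by fun_prop))
            (integrable_of_continuous (continuous_const.mul ((c1.norm.pow 2).mul
              (c2.norm.rpow_const fun _ => Or.inr he.le)))) fun x => ?_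
          simp only [norm_mul, mul_pow]
          have : ‖g' x‖ ^ 2 = (‖g' x‖ ^ 2) ^ (2 / r) * ‖g' x‖ ^ (2 - 4 / r) := by
            rcases (norm_nonneg (g' x)).eq_or_lt with h0 | h0
            · rw [← h0, Real.zero_rpow he.ne']
              simp
            · rw [← Real.rpow_natCast, ← Real.rpow_mul (norm_nonneg _), ← Real.rpow_add h0]
              congr 1
              push_cast
              ring
          calc ‖f' x‖ ^ 2 * ‖g' x‖ ^ 2
              = (‖g' x‖ ^ 2) ^ (2 / r) * (‖f' x‖ ^ 2 * ‖g' x‖ ^ (2 - 4 / r)) := by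
                conv_lhs => rw [this]
                ring
            _ ≤ _ := by
                refine mul_le_mul_of_nonneg_right ?_ (by positivity)
                exact Real.rpow_le_rpow (by positivity) (hsup x) (by positivity)
      _ = ((S.card : ℝ) * G) ^ (2 / r) * ∫ x, (‖f' x‖ ^ 2 * ‖g' x‖ ^ (2 - 4 / r))
            ∂(torusMeasure n) := integral_const_mul _ _
      _ ≤ ((S.card : ℝ) * G) ^ (2 / r) * ((∫ x, ‖f' x‖ ^ r ∂(torusMeasure n)) ^ (1 / (r / 2))
            * G ^ (1 / (r / (r - 2)))) := mul_le_mul_of_nonneg_left H hC0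
      _ = _ := by
          rw [mul_pow, mul_pow, Real.sq_sqrt hG0, ← Real.rpow_natCast (_ ^ (1 / r)),
            ← Real.rpow_natCast (_ ^ (1 / r)), ← Real.rpow_mul hI0, ← Real.rpow_mul hS0,
            Real.mul_rpow hS0 hG0]
          have e3 : 1 / (r / 2) = 1 / r * ((2 : ℕ) : ℝ) := by push_cast; field_simp
          have e4 : 2 / r = 1 / r * ((2 : ℕ) : ℝ) := by push_cast; field_simp
          have e5 : G ^ (2 / r) * G ^ (1 / (r / (r - 2))) = G := by
            rw [← Real.rpow_add' hG0]
            · convert Real.rpow_one G using 2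
              have : r - 2 ≠ 0 := by linarith
              field_simp
              ring
            · have : 2 / r + 1 / (r / (r - 2)) = 1 := by
                field_simp
                ring
              rw [this]
              exact one_ne_zero
          rw [e3, ← e4]
          linear_combination (S.card : ℝ) ^ (2 / r) *
            (∫ x, ‖f' x‖ ^ r ∂(torusMeasure n)) ^ (2 / r) * e5
  calc ‖∫ x, f' x * g' x * h' x ∂(torusMeasure n)‖
      ≤ ∫ x, ‖f' x * g' x * h' x‖ ∂(torusMeasure n) := norm_integral_le_integral_norm _
    _ = ∫ x, ‖f' x * g' x‖ * ‖h' x‖ ∂(torusMeasure n) := by simp_rw [norm_mul]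
    _ ≤ _ := integral_norm_mul_le _ _ (c1.mul c2) c3
    _ ≤ _ := by
        rw [integral_norm_trigPoly_sq S' h]
        refine mul_le_mul_of_nonneg_right ?_ (Real.sqrt_nonneg _)
        rw [Real.sqrt_le_left (by positivity)]
        exact key

/-! ### Bernstein's inequality -/

/-- The frequency cube `{k : |kᵢ| ≤ N}`. -/
def box (n N : ℕ) : Finset (Fin n → ℤ) := Fintype.piFinset fun _ => Finset.Icc (-(N : ℤ)) N

theorem mem_box {N : ℕ} {k : Fin n → ℤ} : k ∈ box n N ↔ ∀ i, |k i| ≤ N := by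
  simp [box, Fintype.mem_piFinset, abs_le]

theorem neg_mem_box {N : ℕ} {k : Fin n → ℤ} : -k ∈ box n N ↔ k ∈ box n N := by
  simp [mem_box]

theorem card_box (N : ℕ) : (box n N).card = (2 * N + 1) ^ n := by
  simp only [box, Fintype.card_piFinset, Int.card_Icc, Finset.prod_const, Finset.card_univ,
    Fintype.card_fin]
  congr 1
  lia

theorem card_box_two_mul_le (N : ℕ) : (box n (2 * N)).card ≤ 2 ^ n * (box n N).card := by
  rw [card_box, card_box, ← mul_pow]
  exact Nat.pow_le_pow_left (by lia) n

theorem sum_box_neg {M : Type*} [AddCommMonoid M] (N : ℕ) (f : (Fin n → ℤ) → M) :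
    ∑ k ∈ box n N, f (-k) = ∑ k ∈ box n N, f k :=
  Finset.sum_nbij' (fun k => -k) (fun k => -k) (fun _ h => neg_mem_box.mpr h)
    (fun _ h => neg_mem_box.mpr h) (by simp) (by simp) (by simp)

/-- Hölder's inequality, with the `L^{r'}` norm of `K` interpolated between `L¹` and `L^∞`. -/
theorem integral_norm_mul_le_of_Lr {f K : Torus n → ℂ} (hf : Continuous f) (hK : Continuous K)
    {r : ℝ} (hr : 1 < r) {B₁ B₂ : ℝ} (h₁ : ∫ x, ‖K x‖ ∂(torusMeasure n) ≤ B₁)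
    (h₂ : ∀ x, ‖K x‖ ≤ B₂) :
    ∫ x, ‖f x‖ * ‖K x‖ ∂(torusMeasure n)
      ≤ B₁ ^ (1 - 1 / r) * B₂ ^ (1 / r) * (∫ x, ‖f x‖ ^ r ∂(torusMeasure n)) ^ (1 / r) := by
  have hr0 : 0 < r := by linarith
  have hr1 : 0 < 1 - 1 / r := by
    have : 1 / r < 1 := by rw [div_lt_one hr0]; exact hr
    linarith
  have hir : 0 < 1 / r := by positivity
  have hB2 : 0 ≤ B₂ := (norm_nonneg _).trans (h₂ 0)
  have hI1 : 0 ≤ ∫ x, ‖K x‖ ∂(torusMeasure n) := integral_nonneg fun x => norm_nonneg _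
  have hI : 0 ≤ ∫ x, ‖f x‖ ^ r ∂(torusMeasure n) := integral_nonneg fun x => by positivity
  have hpq : r.HolderConjugate (r / (r - 1)) := Real.HolderConjugate.conjExponent hr
  have cK1 : Continuous fun x => ‖K x‖ ^ (1 / r) := hK.norm.rpow_const fun _ => Or.inr hir.le
  have cK2 : Continuous fun x => ‖K x‖ ^ (1 - 1 / r) := hK.norm.rpow_const fun _ => Or.inr hr1.le
  have cfr : Continuous fun x => ‖f x‖ ^ r := hf.norm.rpow_const fun _ => Or.inr hr0.le
  have H := integral_mul_le_Lp_mul_Lq_of_nonneg (μ := torusMeasure n) hpq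
    (f := fun x => ‖f x‖ * ‖K x‖ ^ (1 / r)) (g := fun x => ‖K x‖ ^ (1 - 1 / r))
    (ae_of_all _ fun x => by positivity) (ae_of_all _ fun x => by positivity)
    (memLp_of_continuous (hf.norm.mul cK1) _) (memLp_of_continuous cK2 _)
  have e1 : ∀ x, ‖f x‖ * ‖K x‖ ^ (1 / r) * ‖K x‖ ^ (1 - 1 / r) = ‖f x‖ * ‖K x‖ := fun x => by
    rw [mul_assoc, ← Real.rpow_add' (norm_nonneg _) (by simp)]
    simp
  have e2 : ∀ x, (‖f x‖ * ‖K x‖ ^ (1 / r)) ^ r = ‖f x‖ ^ r * ‖K x‖ := fun x => by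
    rw [Real.mul_rpow (by positivity) (by positivity), ← Real.rpow_mul (norm_nonneg _)]
    congr 1
    rw [one_div_mul_cancel hr0.ne', Real.rpow_one]
  have e3 : ∀ x, (‖K x‖ ^ (1 - 1 / r)) ^ (r / (r - 1)) = ‖K x‖ := fun x => by
    rw [← Real.rpow_mul (norm_nonneg _)]
    convert Real.rpow_one _ using 2
    have : r - 1 ≠ 0 := by linarith
    field_simp
  have e4 : 1 / (r / (r - 1)) = 1 - 1 / r := by
    have : r - 1 ≠ 0 := by linarith
    field_simp
  simp_rw [e1, e2, e3, e4] at H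
  refine H.trans ?_
  have H2 : ∫ x, ‖f x‖ ^ r * ‖K x‖ ∂(torusMeasure n)
      ≤ B₂ * ∫ x, ‖f x‖ ^ r ∂(torusMeasure n) := by
    rw [← integral_const_mul]
    refine integral_mono (integrable_of_continuous (cfr.mul hK.norm))
      (integrable_of_continuous (continuous_const.mul cfr)) fun x => ?_
    simp only []
    rw [mul_comm]
    exact mul_le_mul_of_nonneg_right (h₂ x) (by positivity)
  calc _ ≤ (B₂ * ∫ x, ‖f x‖ ^ r ∂(torusMeasure n)) ^ (1 / r) * B₁ ^ (1 - 1 / r) := by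
        refine mul_le_mul ?_ ?_ (by positivity) (by positivity)
        · exact Real.rpow_le_rpow (integral_nonneg fun x => by positivity) H2 hir.le
        · exact Real.rpow_le_rpow hI1 h₁ hr1.le
    _ = _ := by
        rw [Real.mul_rpow hB2 hI]
        ring

/-- Integrating against a product of two trigonometric polynomials acts as a Fourier multiplier
whose symbol is the discrete convolution of the two coefficient families. -/
theorem integral_trigPoly_mul_kernel (N : ℕ) (f p q : (Fin n → ℤ) → ℂ) (x : Torus n) :
    ∫ y, trigPoly (box n N) f y * trigPoly (box n N) (fun l => p (-l) * mFourier (-l) x) y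
        * trigPoly (box n (2 * N)) (fun l => q (-l) * mFourier (-l) x) y ∂(torusMeasure n)
      = trigPoly (box n N) (fun m => f m * ∑ l ∈ box n N, p l * q (m - l)) x := by
  rw [integral_trigPoly_mul_mul]
  have h1 : ∀ k ∈ box n N, (∑ l ∈ box n (2 * N), ∑ m ∈ box n N, if m + k + l = 0 then
      f m * (p (-k) * mFourier (-k) x) * (q (-l) * mFourier (-l) x) else 0)
      = ∑ m ∈ box n N, f m * p (-k) * q (m + k) * mFourier m x := by
    intro k hk
    rw [Finset.sum_comm]
    refine Finset.sum_congr rfl fun m hm => ?_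
    rw [Finset.sum_eq_single (-m - k)]
    · rw [if_pos (by abel)]
      have : mFourier m x = mFourier (-k) x * mFourier (-(-m - k)) x := by
        rw [← mFourier_add]
        congr 2
        abel
      rw [this]
      have : -(-m - k) = m + k := by abel
      rw [this]
      ring
    · intro l _ hl
      rw [if_neg]
      intro h
      apply hl
      rw [eq_sub_iff_add_eq, eq_neg_iff_add_eq_zero, ← h]
      abel
    · intro h
      exfalso
      apply h
      rw [mem_box] at hk hm ⊢
      intro i
      have h1 := hk i
      have h2 := hm i
      simp only [Pi.sub_apply, Pi.neg_apply]
      rw [abs_le] at *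
      push_cast
      constructor <;> lia
  have h2 := sum_box_neg N fun k => ∑ m ∈ box n N, f m * p k * q (m - k) * mFourier m x
  simp only [sub_neg_eq_add] at h2
  rw [Finset.sum_congr rfl h1, h2, Finset.sum_comm]
  refine Finset.sum_congr rfl fun m _ => ?_
  simp only [Finset.mul_sum, Finset.sum_mul]
  refine Finset.sum_congr rfl fun l _ => ?_
  ring

/-- A multiplier which is a convolution of two bounded families supported in cubes is bounded from
`L^r` to `L^∞`: its kernel is a product of two functions, whose `L¹` norm is bounded by
Cauchy-Schwarz and Parseval. -/
theorem norm_multiplier_le (N : ℕ) (f p q : (Fin n → ℤ) → ℂ) {r : ℝ} (hr : 1 < r) {α γ : ℝ}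
    (hα : 0 ≤ α) (hγ : 0 ≤ γ) (hp : ∀ l ∈ box n N, ‖p l‖ ≤ α)
    (hq : ∀ l ∈ box n (2 * N), ‖q l‖ ≤ γ) (x : Torus n) :
    ‖trigPoly (box n N) (fun m => f m * ∑ l ∈ box n N, p l * q (m - l)) x‖
      ≤ α * γ * 4 ^ n * ((box n N).card : ℝ) * ((box n N).card : ℝ) ^ (1 / r)
        * (∫ x, ‖trigPoly (box n N) f x‖ ^ r ∂(torusMeasure n)) ^ (1 / r) := by
  rw [← integral_trigPoly_mul_kernel]
  set c : ℝ := ((box n N).card : ℝ) with hc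
  have hcpos : 0 < c := by
    rw [hc, card_box]
    positivity
  have hc2 : ((box n (2 * N)).card : ℝ) ≤ (2 ^ n) ^ 2 * c := by
    have h1 : ((box n (2 * N)).card : ℝ) ≤ 2 ^ n * c := by
      rw [hc]
      exact_mod_cast card_box_two_mul_le N
    refine h1.trans (mul_le_mul_of_nonneg_right ?_ hcpos.le)
    have : (1 : ℝ) ≤ 2 ^ n := one_le_pow₀ (by norm_num)
    nlinarith
  set P := trigPoly (box n N) (fun l => p (-l) * mFourier (-l) x) with hP
  set Q := trigPoly (box n (2 * N)) (fun l => q (-l) * mFourier (-l) x) with hQ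
  have cP : Continuous P := continuous_trigPoly _ _
  have cQ : Continuous Q := continuous_trigPoly _ _
  have cf := continuous_trigPoly (box n N) f
  have sP : √(∑ k ∈ box n N, ‖p (-k) * mFourier (-k) x‖ ^ 2) ≤ α * √c := by
    rw [Real.sqrt_le_left (by positivity), mul_pow, Real.sq_sqrt hcpos.le]
    refine (Finset.sum_le_card_nsmul _ _ (α ^ 2) fun k hk => ?_).trans ?_
    · rw [norm_mul, norm_mFourier_apply, mul_one]
      exact pow_le_pow_left₀ (norm_nonneg _) (hp _ (neg_mem_box.mpr hk)) 2
    · rw [nsmul_eq_mul, mul_comm]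
  have sQ : √(∑ k ∈ box n (2 * N), ‖q (-k) * mFourier (-k) x‖ ^ 2) ≤ γ * 2 ^ n * √c := by
    rw [Real.sqrt_le_left (by positivity), mul_pow, mul_pow, Real.sq_sqrt hcpos.le]
    refine (Finset.sum_le_card_nsmul _ _ (γ ^ 2) fun k hk => ?_).trans ?_
    · rw [norm_mul, norm_mFourier_apply, mul_one]
      exact pow_le_pow_left₀ (norm_nonneg _) (hq _ (neg_mem_box.mpr hk)) 2
    · rw [nsmul_eq_mul, mul_comm, mul_assoc]
      exact mul_le_mul_of_nonneg_left hc2 (by positivity)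
  have h24 : (2 : ℝ) ^ n * 2 ^ n = 4 ^ n := by rw [← mul_pow]; norm_num
  have h1n : (1 : ℝ) ≤ 2 ^ n := one_le_pow₀ (by norm_num)
  have b1 : ∫ y, ‖P y * Q y‖ ∂(torusMeasure n) ≤ α * γ * 4 ^ n * c := by
    simp_rw [norm_mul]
    refine (integral_norm_mul_le P Q cP cQ).trans ?_
    rw [hP, hQ, integral_norm_trigPoly_sq, integral_norm_trigPoly_sq]
    calc _ ≤ (α * √c) * (γ * 2 ^ n * √c) := by gcongr
      _ = α * γ * (2 ^ n * 1) * (√c * √c) := by ring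
      _ ≤ α * γ * (2 ^ n * 2 ^ n) * (√c * √c) := by gcongr
      _ = _ := by rw [Real.mul_self_sqrt hcpos.le, h24]
  have b2 : ∀ y, ‖P y * Q y‖ ≤ α * γ * 4 ^ n * c * c := by
    intro y
    rw [norm_mul]
    have i1 := norm_trigPoly_le (box n N) (fun l => p (-l) * mFourier (-l) x) y
    have i2 := norm_trigPoly_le (box n (2 * N)) (fun l => q (-l) * mFourier (-l) x) y
    have i3 : √((box n (2 * N)).card : ℝ) ≤ 2 ^ n * √c := by
      rw [Real.sqrt_le_left (by positivity), mul_pow, Real.sq_sqrt hcpos.le]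
      exact hc2
    calc ‖P y‖ * ‖Q y‖ ≤ (√c * (α * √c)) * ((2 ^ n * √c) * (γ * 2 ^ n * √c)) := by
          gcongr
          · exact i1.trans (by gcongr)
          · exact i2.trans (by gcongr)
      _ = α * γ * (2 ^ n * 2 ^ n) * ((√c * √c) * (√c * √c)) := by ring
      _ = _ := by
          rw [Real.mul_self_sqrt hcpos.le, h24]
          ring
  have hir : 0 ≤ 1 / r := by positivity
  calc ‖∫ y, trigPoly (box n N) f y * P y * Q y ∂(torusMeasure n)‖
      ≤ ∫ y, ‖trigPoly (box n N) f y * P y * Q y‖ ∂(torusMeasure n) :=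
        norm_integral_le_integral_norm _
    _ = ∫ y, ‖trigPoly (box n N) f y‖ * ‖P y * Q y‖ ∂(torusMeasure n) := by
        simp_rw [mul_assoc, norm_mul]
    _ ≤ _ := integral_norm_mul_le_of_Lr cf (cP.mul cQ) hr b1 b2
    _ = _ := by
        set a := α * γ * 4 ^ n * c with ha
        have ha0 : 0 ≤ a := by positivity
        rw [Real.mul_rpow ha0 hcpos.le, ← mul_assoc, ← Real.rpow_add' ha0 (by simp)]
        simp

/-- **Bernstein's inequality** `‖∂ⱼ f‖_∞ ≤ C N^{1 + n/r} ‖f‖_r` for frequencies in the cube of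
size `N`. The factor `mⱼ` is split as `lⱼ + (m - l)ⱼ`, which writes the multiplier as a
sum of two convolutions of cube-supported families. -/
theorem norm_deriv_trigPoly_le (N : ℕ) (f : (Fin n → ℤ) → ℂ) {r : ℝ} (hr : 1 < r) (j : Fin n)
    (x : Torus n) :
    ‖trigPoly (box n N) (fun m => (m j : ℂ) * f m) x‖
      ≤ 3 * N * 4 ^ n * ((box n N).card : ℝ) ^ (1 / r)
        * (∫ x, ‖trigPoly (box n N) f x‖ ^ r ∂(torusMeasure n)) ^ (1 / r) := by
  have hcpos : 0 < ((box n N).card : ℝ) := by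
    rw [card_box]
    positivity
  have hb : ∀ {M : ℕ} {l : Fin n → ℤ}, l ∈ box n M → ‖(l j : ℂ)‖ ≤ M := by
    intro M l hl
    rw [Complex.norm_intCast]
    exact_mod_cast mem_box.mp hl j
  have h1 := norm_multiplier_le N f (fun l => (l j : ℂ)) (fun _ => 1) hr (α := N) (γ := 1)
    (by positivity) zero_le_one (fun l hl => hb hl) (by simp) x
  have h2 := norm_multiplier_le N f (fun _ => 1) (fun l => (l j : ℂ)) hr (α := 1)
    (γ := (2 * N : ℕ)) zero_le_one (by positivity) (by simp) (fun l hl => hb hl) x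
  have h3 : ((box n N).card : ℂ) * trigPoly (box n N) (fun m => (m j : ℂ) * f m) x
      = trigPoly (box n N) (fun m => f m * ∑ l ∈ box n N, (l j : ℂ) * 1) x
        + trigPoly (box n N) (fun m => f m * ∑ l ∈ box n N, 1 * ((m - l) j : ℂ)) x := by
    simp only [trigPoly]
    rw [← Finset.sum_add_distrib, Finset.mul_sum]
    refine Finset.sum_congr rfl fun m _ => ?_
    rw [← add_mul, ← mul_add, ← Finset.sum_add_distrib]
    have : ∑ l ∈ box n N, ((l j : ℂ) * 1 + 1 * (((m - l) j : ℤ) : ℂ))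
        = (box n N).card * (m j : ℂ) := by
      rw [← nsmul_eq_mul, ← Finset.sum_const]
      refine Finset.sum_congr rfl fun l _ => ?_
      push_cast [Pi.sub_apply]
      ring
    rw [this]
    ring
  have h4 : ((box n N).card : ℝ) * ‖trigPoly (box n N) (fun m => (m j : ℂ) * f m) x‖
      ≤ ((box n N).card : ℝ) * (3 * N * 4 ^ n * ((box n N).card : ℝ) ^ (1 / r)
        * (∫ x, ‖trigPoly (box n N) f x‖ ^ r ∂(torusMeasure n)) ^ (1 / r)) := by
    have h5 := congrArg norm h3
    rw [norm_mul, Complex.norm_natCast] at h5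
    rw [h5]
    refine (norm_add_le _ _).trans ((add_le_add h1 h2).trans (le_of_eq ?_))
    push_cast
    ring
  exact le_of_mul_le_mul_left h4 hcpos

/-! ### Frequencies, vector potentials and interaction coefficients -/

/-- A lattice point as a vector of `ℂ³`, completed by zeros. -/
def emb (k : Fin n → ℤ) : Fin 3 → ℂ := fun a => if h : (a : ℕ) < n then (k ⟨a, h⟩ : ℂ) else 0

/-- `|k|²`, as a natural number. -/
def ksq (k : Fin n → ℤ) : ℕ := ∑ i, (k i).natAbs ^ 2

/-- `|v|²` for `v ∈ ℂ³`. -/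
def vsq (v : Fin 3 → ℂ) : ℝ := ∑ a, ‖v a‖ ^ 2

theorem vsq_nonneg (v : Fin 3 → ℂ) : 0 ≤ vsq v := Finset.sum_nonneg fun _ _ => by positivity

theorem norm_le_sqrt_vsq (v : Fin 3 → ℂ) (a : Fin 3) : ‖v a‖ ≤ √(vsq v) := by
  apply Real.le_sqrt_of_sq_le
  exact Finset.single_le_sum (f := fun a => ‖v a‖ ^ 2) (fun _ _ => by positivity)
    (Finset.mem_univ a)

theorem emb_neg (k : Fin n → ℤ) : emb (-k) = -emb k := by
  funext a
  simp only [emb, Pi.neg_apply]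
  split_ifs <;> simp

theorem emb_add (k l : Fin n → ℤ) : emb (k + l) = emb k + emb l := by
  funext a
  simp only [emb, Pi.add_apply]
  split_ifs <;> simp

theorem emb_neg_sub (k l : Fin n → ℤ) : emb (-k - l) = -emb k - emb l := by
  rw [sub_eq_add_neg, emb_add, emb_neg, emb_neg, sub_eq_add_neg]

theorem emb_zero : emb (0 : Fin n → ℤ) = 0 := by
  funext a
  simp [emb]

theorem ksq_cast (k : Fin n → ℤ) : (ksq k : ℝ) = ∑ i, (k i : ℝ) ^ 2 := by
  simp [ksq]

theorem ksq_eq_zero {k : Fin n → ℤ} : ksq k = 0 ↔ k = 0 := by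
  simp [ksq, funext_iff]

theorem ksq_zero : ksq (0 : Fin n → ℤ) = 0 := ksq_eq_zero.mpr rfl

theorem one_le_ksq {k : Fin n → ℤ} (hk : k ≠ 0) : (1 : ℝ) ≤ ksq k := by
  have : 0 < ksq k := Nat.pos_of_ne_zero fun h => hk (ksq_eq_zero.mp h)
  exact_mod_cast this

theorem ksq_neg (k : Fin n → ℤ) : ksq (-k) = ksq k := by
  simp [ksq]

theorem abs_le_sqrt_ksq (k : Fin n → ℤ) (i : Fin n) : |(k i : ℝ)| ≤ √(ksq k) := by
  apply Real.le_sqrt_of_sq_le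
  rw [sq_abs, ksq_cast]
  exact Finset.single_le_sum (f := fun i => (k i : ℝ) ^ 2) (fun _ _ => by positivity)
    (Finset.mem_univ i)

theorem norm_emb_le (k : Fin n → ℤ) (a : Fin 3) : ‖emb k a‖ ≤ √(ksq k) := by
  simp only [emb]
  split_ifs with h
  · rw [Complex.norm_intCast]
    exact_mod_cast abs_le_sqrt_ksq k ⟨a, h⟩
  · simp

theorem sqrt_ksq_eq (k : Fin n → ℤ) : √(ksq k : ℝ) = ‖freq k‖ := by
  rw [EuclideanSpace.norm_eq, ksq_cast]
  simp [freq]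

theorem freq_add (k l : Fin n → ℤ) : freq (k + l) = freq k + freq l := by
  ext i
  simp [freq]

theorem freq_neg (k : Fin n → ℤ) : freq (-k) = -freq k := by
  ext i
  simp [freq]

theorem emb_dot_self (hn : n = 2 ∨ n = 3) (k : Fin n → ℤ) :
    emb k ⬝ᵥ emb k = ((ksq k : ℝ) : ℂ) := by
  rw [ksq_cast]
  rcases hn with rfl | rfl <;>
  simp [emb, dotProduct, Fin.sum_univ_succ] <;> ring

/-- The Fourier coefficient `i k × w(k) / (2π|k|²)` of the divergence-free vector potential
`curl⁻¹ w`; it is `0` at `k = 0`. -/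
def potential (w : (Fin n → ℤ) → Fin 3 → ℂ) (k : Fin n → ℤ) : Fin 3 → ℂ :=
  (Complex.I / (2 * Real.pi * (ksq k : ℝ))) • (emb k ⨯₃ w k)

/-- `2πi`, the factor that a derivative produces on the Fourier side. -/
def twoPiI : ℂ := 2 * Real.pi * Complex.I

theorem norm_twoPiI : ‖twoPiI‖ = 2 * Real.pi := by
  simp [twoPiI, abs_of_pos Real.pi_pos]

theorem emb_dot_potential (w : (Fin n → ℤ) → Fin 3 → ℂ) (k : Fin n → ℤ) :
    emb k ⬝ᵥ potential w k = 0 := by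
  rw [potential, dotProduct_smul, dot_self_cross, smul_zero]

theorem cross_cross_of_dot_eq_zero {K V : Fin 3 → ℂ} (h : K ⬝ᵥ V = 0) :
    K ⨯₃ (K ⨯₃ V) = -(K ⬝ᵥ K) • V := by
  simp only [dotProduct, Fin.sum_univ_three, cross_apply] at h ⊢
  funext a
  fin_cases a
  · simp
    linear_combination (K 0) * h
  · simp
    linear_combination (K 1) * h
  · simp
    linear_combination (K 2) * h

theorem eq_curl_potential (hn : n = 2 ∨ n = 3) {w : (Fin n → ℤ) → Fin 3 → ℂ} {k : Fin n → ℤ}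
    (hk : k ≠ 0) (hw : emb k ⬝ᵥ w k = 0) : w k = twoPiI • (emb k ⨯₃ potential w k) := by
  have h0 : ((ksq k : ℝ) : ℂ) ≠ 0 := by
    have := one_le_ksq hk
    exact_mod_cast (by linarith : (ksq k : ℝ) ≠ 0)
  have h1 : emb k ⨯₃ (emb k ⨯₃ w k) = -((ksq k : ℝ) : ℂ) • w k := by
    rw [← emb_dot_self hn k]
    exact cross_cross_of_dot_eq_zero hw
  rw [potential, map_smul, h1, smul_smul, smul_smul, twoPiI]
  have hpi : (Real.pi : ℂ) ≠ 0 := by exact_mod_cast Real.pi_ne_zero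
  have : 2 * (Real.pi : ℂ) * Complex.I * (Complex.I / (2 * Real.pi * (ksq k : ℝ)))
      * -((ksq k : ℝ) : ℂ) = 1 := by
    field_simp
    simp
  rw [this, one_smul]

theorem norm_cross_le (u v : Fin 3 → ℂ) {a b : ℝ} (hu : ∀ i, ‖u i‖ ≤ a) (hv : ∀ i, ‖v i‖ ≤ b)
    (i : Fin 3) : ‖(u ⨯₃ v) i‖ ≤ 2 * a * b := by
  have h : ∀ p q s t : Fin 3, ‖u p * v q - u s * v t‖ ≤ 2 * a * b := by
    intro p q s t
    have ha : 0 ≤ a := (norm_nonneg _).trans (hu 0)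
    refine (norm_sub_le _ _).trans ?_
    rw [norm_mul, norm_mul]
    have h1 := mul_le_mul (hu p) (hv q) (norm_nonneg _) ha
    have h2 := mul_le_mul (hu s) (hv t) (norm_nonneg _) ha
    linarith
  rw [cross_apply]
  fin_cases i <;> exact h _ _ _ _

theorem norm_potential_mul_le (w : (Fin n → ℤ) → Fin 3 → ℂ) (k : Fin n → ℤ) (a : Fin 3) :
    √(ksq k) * ‖potential w k a‖ ≤ √(vsq (w k)) := by
  rcases eq_or_ne k 0 with rfl | hk
  · simp [ksq_zero]
  have h1 := norm_cross_le (emb k) (w k) (norm_emb_le k) (norm_le_sqrt_vsq (w k)) a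
  have hk1 := one_le_ksq hk
  have hs : 0 < √(ksq k : ℝ) := Real.sqrt_pos.mpr (by linarith)
  have hss : √(ksq k : ℝ) * √(ksq k : ℝ) = ksq k := Real.mul_self_sqrt (by linarith)
  rw [potential, Pi.smul_apply, norm_smul, norm_div, Complex.norm_I, norm_mul, norm_mul]
  simp only [Complex.norm_real, Complex.norm_ofNat, Real.norm_eq_abs, abs_of_pos Real.pi_pos,
    abs_of_pos (by linarith : (0 : ℝ) < ksq k)]
  set s := √(ksq k : ℝ)
  set v := √(vsq (w k))
  have hv : 0 ≤ v := Real.sqrt_nonneg _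
  have hpi := Real.pi_gt_three
  calc s * (1 / (2 * Real.pi * (ksq k : ℝ)) * ‖(emb k ⨯₃ w k) a‖)
      ≤ s * (1 / (2 * Real.pi * (ksq k : ℝ)) * (2 * s * v)) := by gcongr
    _ = (s * s) * v / (Real.pi * (ksq k : ℝ)) := by field_simp
    _ = v / Real.pi := by
        rw [hss]
        field_simp
    _ ≤ v := div_le_self hv (by linarith)

/-- The contribution of the frequency triple `(-k - l, k, l)` to the trilinear form
`∫ ((∇ × w) × b + (∇ × b) × w) · A`, where `A` is the vector potential of `w`. -/
def triad (w b : (Fin n → ℤ) → Fin 3 → ℂ) (k l : Fin n → ℤ) : ℂ :=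
  ((twoPiI • (emb k ⨯₃ w k)) ⨯₃ b (-k - l)
    + (twoPiI • (emb (-k - l) ⨯₃ b (-k - l))) ⨯₃ w k) ⬝ᵥ potential w l

/-- The divergence form of the interaction coefficient: the derivative falls on the vector
potential. -/
theorem triad_eq_divergence (w b : (Fin n → ℤ) → Fin 3 → ℂ) (k l : Fin n → ℤ)
    (hw : emb k ⬝ᵥ w k = 0) (hb : emb (-k - l) ⬝ᵥ b (-k - l) = 0) :
    triad w b k l = ∑ i, ∑ j, -twoPiI * (b (-k - l) i * w k j * (emb l i * potential w l j)
      + b (-k - l) i * w k j * (emb l j * potential w l i)) := by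
  have hA := emb_dot_potential w l
  rw [triad]
  rw [emb_neg_sub] at hb ⊢
  generalize b (-k - l) = B at *
  generalize potential w l = A at *
  generalize w k = W at *
  generalize emb k = K at *
  generalize emb l = L at *
  generalize twoPiI = C at *
  simp only [dotProduct, cross_apply, Fin.sum_univ_three, Pi.sub_apply, Pi.neg_apply,
    Pi.add_apply, Pi.smul_apply, smul_eq_mul] at *
  simp
  linear_combination (-C * (W 0 * A 0 + W 1 * A 1 + W 2 * A 2)) * hb
    - C * (B 0 * A 0 + B 1 * A 1 + B 2 * A 2) * hw + C * (B 0 * W 0 + B 1 * W 1 + B 2 * W 2) * hA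

/-- The symmetrized interaction coefficient, in which one derivative has been moved onto `b`: the
part without derivatives of `b` is skew-symmetric and cancels. -/
theorem triad_add_triad (hn : n = 2 ∨ n = 3) (w b : (Fin n → ℤ) → Fin 3 → ℂ) {k l : Fin n → ℤ}
    (hk : k ≠ 0) (hl : l ≠ 0) (hwk : emb k ⬝ᵥ w k = 0) (hwl : emb l ⬝ᵥ w l = 0) :
    triad w b k l + triad w b l k =
      ∑ e : Fin 3, ((∑ j, twoPiI ^ 2 *
          (emb (-k - l) j * b (-k - l) (e + 2) * (emb k j * potential w k (e + 1)) * potential w l e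
          - emb (-k - l) j * b (-k - l) (e + 2) * potential w k (e + 1) * (emb l j * potential w l e)
          - emb (-k - l) j * b (-k - l) (e + 1) * (emb k j * potential w k (e + 2)) * potential w l e
          + emb (-k - l) j * b (-k - l) (e + 1) * potential w k (e + 2)
            * (emb l j * potential w l e)))
        + twoPiI *
          (emb (-k - l) (e + 1) * b (-k - l) (e + 2) * w k (e + 1) * potential w l (e + 2)
          - emb (-k - l) (e + 1) * b (-k - l) (e + 2) * w k (e + 2) * potential w l (e + 1)
          - emb (-k - l) (e + 2) * b (-k - l) (e + 1) * w k (e + 1) * potential w l (e + 2)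
          + emb (-k - l) (e + 2) * b (-k - l) (e + 1) * w k (e + 2) * potential w l (e + 1)
          + emb (-k - l) (e + 1) * b (-k - l) (e + 2) * potential w k (e + 2) * w l (e + 1)
          - emb (-k - l) (e + 1) * b (-k - l) (e + 2) * potential w k (e + 1) * w l (e + 2)
          - emb (-k - l) (e + 2) * b (-k - l) (e + 1) * potential w k (e + 2) * w l (e + 1)
          + emb (-k - l) (e + 2) * b (-k - l) (e + 1) * potential w k (e + 1) * w l (e + 2))) := by
  have hAk := emb_dot_potential w k
  have hAl := emb_dot_potential w l
  have hkk := eq_curl_potential hn hk hwk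
  have hll := eq_curl_potential hn hl hwl
  rw [triad, triad]
  have hc : -l - k = -k - l := by abel
  rw [hc, emb_neg_sub]
  generalize potential w l = A' at *
  generalize potential w k = A at *
  -- `curl w = -ΔA` and likewise at `l`: both terms become multiples of the same product `A ⨯₃ A'`
  have h1 : emb k ⨯₃ w k = -(twoPiI * (emb k ⬝ᵥ emb k)) • A := by
    rw [hkk, map_smul, cross_cross_of_dot_eq_zero hAk, smul_smul, mul_neg]
  have h2 : emb l ⨯₃ w l = -(twoPiI * (emb l ⬝ᵥ emb l)) • A' := by
    rw [hll, map_smul, cross_cross_of_dot_eq_zero hAl, smul_smul, mul_neg]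
  rw [h1, h2]
  generalize b (-k - l) = B at *
  generalize w k = W at *
  generalize w l = W' at *
  generalize emb k = K at *
  generalize emb l = L at *
  generalize twoPiI = C at *
  have e1 : (1 : Fin 3) + 1 = 2 := rfl
  have e2 : (1 : Fin 3) + 2 = 0 := rfl
  have e3 : (2 : Fin 3) + 1 = 0 := rfl
  have e4 : (2 : Fin 3) + 2 = 1 := rfl
  simp only [dotProduct, cross_apply, Fin.sum_univ_three, Pi.sub_apply, Pi.neg_apply,
    Pi.add_apply, Pi.smul_apply, smul_eq_mul, e1, e2, e3, e4, zero_add]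
  simp
  ring

/-! ### The trilinear estimate -/

/-- A sequence of Fourier coefficients is controlled above the level `q₀` with size `K`, relative
to dyadic multipliers `φ p` and low-pass multipliers `ψ P`: the gradients of its low-pass parts
are at most `K 2^P` in `L^∞`, and its blocks are at most `K θ^p` in `L^r`. -/
structure Controlled (φ ψ : ℕ → (Fin n → ℤ) → ℂ) (r θ K : ℝ) (q₀ : ℕ)
    (b : (Fin n → ℤ) → Fin 3 → ℂ) : Prop where
  low : ∀ P, q₀ ≤ P → ∀ j c N, 2 ^ (P + 1) ≤ N → ∀ x,
    ‖trigPoly (box n N) (fun m => ψ P m * (emb m j * b m c)) x‖ ≤ K * 2 ^ P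
  high : ∀ p, q₀ < p → ∀ c N, 2 ^ (p + 1) ≤ N →
    (∫ x, ‖trigPoly (box n N) (fun m => φ p m * b m c) x‖ ^ r ∂(torusMeasure n)) ^ (1 / r)
      ≤ K * θ ^ p

theorem abs_le_norm_freq (k : Fin n → ℤ) (i : Fin n) : |(k i : ℝ)| ≤ ‖freq k‖ := by
  rw [← sqrt_ksq_eq]
  exact abs_le_sqrt_ksq k i

theorem mem_box_of_norm_freq_le {k : Fin n → ℤ} {N : ℕ} (h : ‖freq k‖ ≤ N) : k ∈ box n N := by
  rw [mem_box]
  intro i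
  have := (abs_le_norm_freq k i).trans h
  exact_mod_cast this

theorem norm_freq_neg_sub (k l : Fin n → ℤ) : ‖freq (-k - l)‖ = ‖freq k + freq l‖ := by
  rw [show -k - l = -(k + l) by abel, freq_neg, freq_add, norm_neg]

theorem ne_zero_of_norm_freq {k : Fin n → ℤ} {q : ℕ} (h : 2 ^ q ≤ ‖freq k‖) : k ≠ 0 := by
  rintro rfl
  have : freq (0 : Fin n → ℤ) = 0 := by
    ext i
    simp [freq]
  rw [this, norm_zero] at h
  have : (0 : ℝ) < 2 ^ q := by positivity
  linarith

theorem sum_norm_sq_le {S : Finset (Fin n → ℤ)} {w : (Fin n → ℤ) → Fin 3 → ℂ}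
    {g : (Fin n → ℤ) → ℂ} {α : ℝ} (hα : 0 ≤ α) (hg : ∀ k ∈ S, ‖g k‖ ≤ α * √(vsq (w k))) :
    √(∑ k ∈ S, ‖g k‖ ^ 2) ≤ α * √(∑ k ∈ S, vsq (w k)) := by
  have h0 : 0 ≤ ∑ k ∈ S, vsq (w k) := Finset.sum_nonneg fun k _ => vsq_nonneg _
  rw [Real.sqrt_le_left (by positivity), mul_pow, Real.sq_sqrt h0, Finset.mul_sum]
  refine Finset.sum_le_sum fun k hk => ?_
  calc ‖g k‖ ^ 2 ≤ (α * √(vsq (w k))) ^ 2 := pow_le_pow_left₀ (norm_nonneg _) (hg k hk) 2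
    _ = _ := by rw [mul_pow, Real.sq_sqrt (vsq_nonneg _)]

theorem norm_potential_le {w : (Fin n → ℤ) → Fin 3 → ℂ} {k : Fin n → ℤ} {q : ℕ}
    (h : 2 ^ q ≤ ‖freq k‖) (a : Fin 3) :
    ‖potential w k a‖ ≤ ((2 : ℝ) ^ q)⁻¹ * √(vsq (w k)) := by
  have h1 := norm_potential_mul_le w k a
  rw [sqrt_ksq_eq] at h1
  have h2 : (0 : ℝ) < 2 ^ q := by positivity
  rw [inv_mul_eq_div, le_div_iff₀ h2, mul_comm]
  exact (mul_le_mul_of_nonneg_right h (norm_nonneg _)).trans h1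

theorem norm_emb_mul_potential_le (w : (Fin n → ℤ) → Fin 3 → ℂ) (k : Fin n → ℤ) (i a : Fin 3) :
    ‖emb k i * potential w k a‖ ≤ 1 * √(vsq (w k)) := by
  rw [norm_mul, one_mul]
  exact (mul_le_mul_of_nonneg_right (norm_emb_le k i) (norm_nonneg _)).trans
    (norm_potential_mul_le w k a)

theorem sum_sum_sum_comm {ι : Type*} [Fintype ι] (S S' : Finset (Fin n → ℤ))
    (f : ι → (Fin n → ℤ) → (Fin n → ℤ) → ℂ) :
    ∑ k ∈ S, ∑ l ∈ S', ∑ e, f e k l = ∑ e, ∑ k ∈ S, ∑ l ∈ S', f e k l := by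
  rw [Finset.sum_congr rfl fun k _ => Finset.sum_comm, Finset.sum_comm]

/-- Interactions of comparable frequencies: only low frequencies of `b` enter, and one derivative
is moved onto them. -/
theorem norm_sum_triad_add_triad_le (hn : n = 2 ∨ n = 3) {φ ψ : ℕ → (Fin n → ℤ) → ℂ}
    (hψ : ∀ P m, ‖freq m‖ ≤ 2 ^ P → ψ P m = 1) {r θ K : ℝ} {q₀ : ℕ}
    {w b : (Fin n → ℤ) → Fin 3 → ℂ} (hb : Controlled φ ψ r θ K q₀ b)
    (hK : 0 ≤ K) (hw : ∀ k, emb k ⬝ᵥ w k = 0) {S S' : Finset (Fin n → ℤ)} {q q' : ℕ}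
    (hS : ∀ k ∈ S, 2 ^ q ≤ ‖freq k‖ ∧ ‖freq k‖ < 2 ^ (q + 1))
    (hS' : ∀ k ∈ S', 2 ^ q' ≤ ‖freq k‖ ∧ ‖freq k‖ < 2 ^ (q' + 1))
    (hq₀ : q₀ ≤ q) (h1 : q ≤ q') (h2 : q' ≤ q + 2) :
    ‖∑ k ∈ S, ∑ l ∈ S', (triad w b k l + triad w b l k)‖
      ≤ 40000 * K * √(∑ k ∈ S, vsq (w k)) * √(∑ k ∈ S', vsq (w k)) := by
  set X := √(∑ k ∈ S, vsq (w k)) with hX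
  set Y := √(∑ k ∈ S', vsq (w k)) with hY
  have hX0 : 0 ≤ X := Real.sqrt_nonneg _
  have hY0 : 0 ≤ Y := Real.sqrt_nonneg _
  -- sums of two frequencies from the shells have size at most `2^P`
  set P := q' + 2 with hP
  have hfreq : ∀ k ∈ S, ∀ l ∈ S', ‖freq (-k - l)‖ ≤ 2 ^ P := by
    intro k hk l hl
    rw [norm_freq_neg_sub]
    refine (norm_add_le _ _).trans ?_
    have i1 := (hS k hk).2.le
    have i2 := (hS' l hl).2.le
    have i3 : (2 : ℝ) ^ (q + 1) ≤ 2 ^ (q' + 1) := pow_le_pow_right₀ (by norm_num) (by lia)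
    rw [hP, pow_succ]
    linarith
  set Λ : Fin 3 → Fin 3 → ((Fin n → ℤ) → ℂ) → ((Fin n → ℤ) → ℂ) → ℂ := fun j c g h =>
    ∑ k ∈ S, ∑ l ∈ S', emb (-k - l) j * b (-k - l) c * g k * h l with hΛ
  have hmain : ∀ j c g h, ∀ α β : ℝ, 0 ≤ α → 0 ≤ β → α * β ≤ (2 ^ q)⁻¹ →
      (∀ k ∈ S, ‖g k‖ ≤ α * √(vsq (w k))) → (∀ k ∈ S', ‖h k‖ ≤ β * √(vsq (w k))) →
      ‖Λ j c g h‖ ≤ 16 * K * X * Y := by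
    intro j c g h α β hα hβ hαβ hg hh
    have e1 : Λ j c g h = ∑ k ∈ S, ∑ l ∈ S',
        (fun m => ψ P m * (emb m j * b m c)) (-k - l) * g k * h l := by
      refine Finset.sum_congr rfl fun k hk => Finset.sum_congr rfl fun l hl => ?_
      simp only [hψ P _ (hfreq k hk l hl), one_mul]
    rw [e1]
    have hN : ∀ k ∈ S, ∀ l ∈ S', -k - l ∈ box n (2 ^ (P + 1)) := by
      intro k hk l hl
      apply mem_box_of_norm_freq_le
      refine (hfreq k hk l hl).trans ?_
      push_cast
      exact pow_le_pow_right₀ (by norm_num) (by lia)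
    refine (norm_sum_sum_le_of_bounded _ S S' _ g h hN
      (hb.low P (by lia) j c _ le_rfl)).trans ?_
    have g1 := sum_norm_sq_le hα hg
    have g2 := sum_norm_sq_le hβ hh
    have g3 : (2 : ℝ) ^ P * (2 ^ q)⁻¹ ≤ 16 := by
      rw [← div_eq_mul_inv, div_le_iff₀ (by positivity)]
      calc (2 : ℝ) ^ P ≤ 2 ^ (4 + q) := pow_le_pow_right₀ (by norm_num) (by lia)
        _ = _ := by rw [pow_add]; norm_num
    calc K * 2 ^ P * √(∑ k ∈ S, ‖g k‖ ^ 2) * √(∑ l ∈ S', ‖h l‖ ^ 2)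
        ≤ K * 2 ^ P * (α * X) * (β * Y) := by gcongr
      _ = K * X * Y * (2 ^ P * (α * β)) := by ring
      _ ≤ K * X * Y * (2 ^ P * (2 ^ q)⁻¹) := by gcongr
      _ ≤ K * X * Y * 16 := by gcongr
      _ = _ := by ring
  have hqq : ((2 : ℝ) ^ q')⁻¹ ≤ (2 ^ q)⁻¹ :=
    inv_anti₀ (by positivity) (pow_le_pow_right₀ (by norm_num) h1)
  -- the four ways to place the derivative that remains on the two factors from `w`
  have m1 : ∀ j c i a e, ‖Λ j c (fun k => emb k i * potential w k a) (fun l => potential w l e)‖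
      ≤ 16 * K * X * Y := fun j c i a e =>
    hmain j c _ _ 1 (2 ^ q')⁻¹ zero_le_one (by positivity) (by simpa using hqq)
      (fun k hk => norm_emb_mul_potential_le w k i a)
      (fun l hl => norm_potential_le (hS' l hl).1 e)
  have m2 : ∀ j c i a e, ‖Λ j c (fun k => potential w k a) (fun l => emb l i * potential w l e)‖
      ≤ 16 * K * X * Y := fun j c i a e =>
    hmain j c _ _ (2 ^ q)⁻¹ 1 (by positivity) zero_le_one (by simp)
      (fun l hl => norm_potential_le (hS l hl).1 a)
      (fun k hk => norm_emb_mul_potential_le w k i e)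
  have m3 : ∀ j c a e, ‖Λ j c (fun k => w k a) (fun l => potential w l e)‖
      ≤ 16 * K * X * Y := fun j c a e =>
    hmain j c _ _ 1 (2 ^ q')⁻¹ zero_le_one (by positivity) (by simpa using hqq)
      (fun k hk => by rw [one_mul]; exact norm_le_sqrt_vsq _ _)
      (fun l hl => norm_potential_le (hS' l hl).1 e)
  have m4 : ∀ j c a e, ‖Λ j c (fun k => potential w k a) (fun l => w l e)‖
      ≤ 16 * K * X * Y := fun j c a e =>
    hmain j c _ _ (2 ^ q)⁻¹ 1 (by positivity) zero_le_one (by simp)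
      (fun l hl => norm_potential_le (hS l hl).1 a)
      (fun k hk => by rw [one_mul]; exact norm_le_sqrt_vsq _ _)
  set Bd := 16 * K * X * Y with hBd
  have hBd0 : 0 ≤ Bd := by positivity
  have hexp : ∑ k ∈ S, ∑ l ∈ S', (triad w b k l + triad w b l k)
      = ∑ e : Fin 3, ((∑ j, twoPiI ^ 2 *
          (Λ j (e + 2) (fun k => emb k j * potential w k (e + 1)) (fun l => potential w l e)
          - Λ j (e + 2) (fun k => potential w k (e + 1)) (fun l => emb l j * potential w l e)
          - Λ j (e + 1) (fun k => emb k j * potential w k (e + 2)) (fun l => potential w l e)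
          + Λ j (e + 1) (fun k => potential w k (e + 2)) (fun l => emb l j * potential w l e)))
        + twoPiI *
          (Λ (e + 1) (e + 2) (fun k => w k (e + 1)) (fun l => potential w l (e + 2))
          - Λ (e + 1) (e + 2) (fun k => w k (e + 2)) (fun l => potential w l (e + 1))
          - Λ (e + 2) (e + 1) (fun k => w k (e + 1)) (fun l => potential w l (e + 2))
          + Λ (e + 2) (e + 1) (fun k => w k (e + 2)) (fun l => potential w l (e + 1))
          + Λ (e + 1) (e + 2) (fun k => potential w k (e + 2)) (fun l => w l (e + 1))
          - Λ (e + 1) (e + 2) (fun k => potential w k (e + 1)) (fun l => w l (e + 2))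
          - Λ (e + 2) (e + 1) (fun k => potential w k (e + 2)) (fun l => w l (e + 1))
          + Λ (e + 2) (e + 1) (fun k => potential w k (e + 1)) (fun l => w l (e + 2)))) := by
    rw [Finset.sum_congr rfl fun k hk => Finset.sum_congr rfl fun l hl =>
      triad_add_triad hn w b (ne_zero_of_norm_freq (hS k hk).1) (ne_zero_of_norm_freq (hS' l hl).1)
        (hw k) (hw l)]
    rw [sum_sum_sum_comm]
    refine Finset.sum_congr rfl fun e _ => ?_
    simp only [Finset.sum_add_distrib]
    rw [sum_sum_sum_comm]
    congr 1
    · refine Finset.sum_congr rfl fun j _ => ?_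
      simp only [hΛ, ← Finset.mul_sum, Finset.sum_add_distrib, Finset.sum_sub_distrib]
    · simp only [hΛ, ← Finset.mul_sum, Finset.sum_add_distrib, Finset.sum_sub_distrib]
  have n4 : ∀ a b c d : ℂ, ‖a - b - c + d‖ ≤ ‖a‖ + ‖b‖ + ‖c‖ + ‖d‖ := fun a b c d =>
    (norm_add_le _ _).trans (add_le_add_left ((norm_sub_le _ _).trans
      (add_le_add_left (norm_sub_le _ _) _)) _)
  have hpi : ‖twoPiI‖ ≤ 8 := by
    rw [norm_twoPiI]
    linarith [Real.pi_le_four]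
  rw [hexp]
  calc _ ≤ ∑ e : Fin 3, ((∑ j : Fin 3, 8 ^ 2 * (4 * Bd)) + 8 * (8 * Bd)) := by
        refine (norm_sum_le _ _).trans (Finset.sum_le_sum fun e _ => ?_)
        refine (norm_add_le _ _).trans (add_le_add ?_ ?_)
        · refine (norm_sum_le _ _).trans (Finset.sum_le_sum fun j _ => ?_)
          rw [norm_mul, norm_pow]
          refine mul_le_mul (pow_le_pow_left₀ (norm_nonneg _) hpi 2) ?_ (norm_nonneg _)
            (by norm_num)
          refine (n4 _ _ _ _).trans ?_
          linarith [m1 j (e + 2) j (e + 1) e, m2 j (e + 2) j (e + 1) e, m1 j (e + 1) j (e + 2) e,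
            m2 j (e + 1) j (e + 2) e]
        · rw [norm_mul]
          refine mul_le_mul hpi ?_ (norm_nonneg _) (by norm_num)
          refine (norm_add_le _ _).trans ((add_le_add_left ((norm_sub_le _ _).trans
            (add_le_add_left ((norm_sub_le _ _).trans (add_le_add_left ((norm_add_le _ _).trans
            (add_le_add_left (n4 _ _ _ _) _)) _)) _)) _).trans ?_)
          linarith [m3 (e + 1) (e + 2) (e + 1) (e + 2), m3 (e + 1) (e + 2) (e + 2) (e + 1),
            m3 (e + 2) (e + 1) (e + 1) (e + 2), m3 (e + 2) (e + 1) (e + 2) (e + 1),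
            m4 (e + 1) (e + 2) (e + 2) (e + 1), m4 (e + 1) (e + 2) (e + 1) (e + 2),
            m4 (e + 2) (e + 1) (e + 2) (e + 1), m4 (e + 2) (e + 1) (e + 1) (e + 2)]
    _ = 2496 * Bd := by
        simp only [Finset.sum_const, Finset.card_univ, Fintype.card_fin, nsmul_eq_mul]
        push_cast
        ring
    _ ≤ _ := by
        have : 0 ≤ K * X * Y := by positivity
        rw [hBd]
        nlinarith

/-- The number of frequencies in a dyadic ball, in the form in which it compensates the weight
`2^{-(n/r) q}` of a block. -/
theorem card_rpow_le {r : ℝ} (hr : 0 < r) {S : Finset (Fin n → ℤ)} {q : ℕ}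
    (hS : ∀ k ∈ S, ‖freq k‖ < 2 ^ (q + 1)) :
    (S.card : ℝ) ^ (1 / r) ≤ ((2 ^ (-(n / r)) : ℝ)⁻¹) ^ (q + 3) := by
  have hsub : S ⊆ box n (2 ^ (q + 1)) := fun k hk =>
    mem_box_of_norm_freq_le (by push_cast; exact (hS k hk).le)
  have hc : S.card ≤ (2 ^ (q + 3)) ^ n := by
    refine (Finset.card_le_card hsub).trans ?_
    rw [card_box]
    refine Nat.pow_le_pow_left ?_ n
    have : 1 ≤ 2 ^ (q + 1) := Nat.one_le_two_pow
    rw [show q + 3 = (q + 1) + 2 by lia, pow_add 2 (q + 1) 2]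
    lia
  calc (S.card : ℝ) ^ (1 / r) ≤ (((2 : ℝ) ^ (q + 3)) ^ n) ^ (1 / r) :=
        Real.rpow_le_rpow (by positivity) (by exact_mod_cast hc) (by positivity)
    _ = _ := by
        rw [← Real.rpow_neg (by norm_num), neg_neg, ← pow_mul,
          ← Real.rpow_natCast, ← Real.rpow_natCast (_ ^ _), ← Real.rpow_mul (by norm_num),
          ← Real.rpow_mul (by norm_num)]
        congr 1
        push_cast
        ring

/-- A scalar interaction of a low shell with a much higher one: only the frequencies of `b` near
the higher shell enter, and Bernstein's inequality for the low factor yields geometric decay in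
the distance of the shells. -/
theorem norm_sum_sum_far_le {φ ψ : ℕ → (Fin n → ℤ) → ℂ}
    (hφ : ∀ q m, 3 / 4 * 2 ^ (q + 1) ≤ ‖freq m‖ → ‖freq m‖ ≤ 9 / 4 * 2 ^ (q + 1) →
      φ q m + φ (q + 1) m + φ (q + 2) m = 1)
    {r K : ℝ} (hr : 2 < r) (hnr : n < r) {q₀ : ℕ}
    {w b : (Fin n → ℤ) → Fin 3 → ℂ} (hb : Controlled φ ψ r (2 ^ (-(n / r))) K q₀ b)
    (hK : 0 ≤ K) {S S' : Finset (Fin n → ℤ)} {q d : ℕ}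
    (hS : ∀ k ∈ S, ‖freq k‖ < 2 ^ (q + 1))
    (hS' : ∀ k ∈ S', 2 ^ (q + d) ≤ ‖freq k‖ ∧ ‖freq k‖ < 2 ^ (q + d + 1))
    (hq₀ : q₀ ≤ q) (hd : 3 ≤ d) (c : Fin 3) {g h : (Fin n → ℤ) → ℂ}
    (hg : ∀ k ∈ S, ‖g k‖ ≤ 1 * √(vsq (w k))) (hh : ∀ k ∈ S', ‖h k‖ ≤ 1 * √(vsq (w k))) :
    ‖∑ k ∈ S, ∑ l ∈ S', b (-k - l) c * g k * h l‖
      ≤ 48 * K * (2 ^ (-(n / r)) : ℝ) ^ d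
        * √(∑ k ∈ S, vsq (w k)) * √(∑ k ∈ S', vsq (w k)) := by
  set X := √(∑ k ∈ S, vsq (w k)) with hX
  set Y := √(∑ k ∈ S', vsq (w k)) with hY
  have hX0 : 0 ≤ X := Real.sqrt_nonneg _
  have hY0 : 0 ≤ Y := Real.sqrt_nonneg _
  set θ : ℝ := 2 ^ (-(n / r)) with hθ
  have hr0 : 0 < r := by linarith
  have hθ0 : 0 < θ := by positivity
  have hθ1 : θ ≤ 1 := Real.rpow_le_one_of_one_le_of_nonpos (by norm_num)
    (by simp only [Left.neg_nonpos_iff]; positivity)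
  have hθ2 : θ⁻¹ ≤ 2 := by
    rw [hθ, ← Real.rpow_neg (by norm_num), neg_neg]
    calc (2 : ℝ) ^ (n / r) ≤ 2 ^ (1 : ℝ) :=
          Real.rpow_le_rpow_of_exponent_le (by norm_num) (by rw [div_le_one hr0]; exact hnr.le)
      _ = 2 := Real.rpow_one 2
  obtain ⟨d, rfl⟩ : ∃ d', d = d' + 1 := ⟨d - 1, by lia⟩
  have hpow : (2 : ℝ) ^ (q + 1) ≤ 1 / 4 * 2 ^ (q + d + 1) := by
    have : (2 : ℝ) ^ (q + 3) ≤ 2 ^ (q + d + 1) := pow_le_pow_right₀ (by norm_num) (by lia)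
    have h3 : (2 : ℝ) ^ (q + 3) = 4 * 2 ^ (q + 1) := by ring
    linarith
  have hfreq : ∀ k ∈ S, ∀ l ∈ S', 3 / 4 * 2 ^ (q + d + 1) ≤ ‖freq (-k - l)‖ ∧
      ‖freq (-k - l)‖ ≤ 9 / 4 * 2 ^ (q + d + 1) := by
    intro k hk l hl
    rw [norm_freq_neg_sub]
    have i1 := (hS k hk).le
    have i2 := (hS' l hl).1
    have i3 := (hS' l hl).2.le
    have i4 : (2 : ℝ) ^ (q + (d + 1) + 1) = 2 * 2 ^ (q + d + 1) := by ring
    have i5 : (2 : ℝ) ^ (q + (d + 1)) = 2 ^ (q + d + 1) := by ring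
    have i6 := norm_add_le (freq k) (freq l)
    have i7 : ‖freq l‖ ≤ ‖freq k + freq l‖ + ‖freq k‖ := by
      have := norm_sub_le (freq k + freq l) (freq k)
      rwa [add_sub_cancel_left] at this
    constructor <;> linarith
  have hN : ∀ k ∈ S, ∀ l ∈ S', -k - l ∈ box n (2 ^ (q + d + 3)) := by
    intro k hk l hl
    apply mem_box_of_norm_freq_le
    refine (hfreq k hk l hl).2.trans ?_
    push_cast
    have h3 : (2 : ℝ) ^ (q + d + 3) = 4 * 2 ^ (q + d + 1) := by ring
    have : (0 : ℝ) < 2 ^ (q + d + 1) := by positivity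
    linarith
  -- Bernstein's inequality for the low factor costs `θ^{-q}` against `θ^{q + d}` from the blocks of `b`
  have hcard : (S.card : ℝ) ^ (1 / r) ≤ (θ⁻¹) ^ (q + 3) := card_rpow_le hr0 hS
  have hpiece : ∀ p, q + d ≤ p → p ≤ q + d + 2 →
      ‖∑ k ∈ S, ∑ l ∈ S', (fun m => φ p m * b m c) (-k - l) * g k * h l‖
        ≤ 16 * K * θ ^ (d + 1) * X * Y := by
    intro p hp1 hp2
    have g0 := hb.high p (by lia) c (2 ^ (q + d + 3))
      (Nat.pow_le_pow_right (by norm_num) (by lia))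
    generalize 2 ^ (q + d + 3) = N at hN g0
    refine (norm_sum_sum_le_of_Lr (box n N) S S' (fun m => φ p m * b m c) g h hN hr).trans ?_
    have g1 := sum_norm_sq_le zero_le_one hg
    have g2 := sum_norm_sq_le zero_le_one hh
    rw [one_mul] at g1 g2
    have aux : ∀ I C x y : ℝ, 0 ≤ C → 0 ≤ x → 0 ≤ y → I ≤ K * θ ^ p → C ≤ (θ⁻¹) ^ (q + 3) →
        x ≤ X → y ≤ Y → I * C * x * y ≤ (K * θ ^ p) * (θ⁻¹) ^ (q + 3) * X * Y := by
      intro I C x y h1 h2 h3 h4 h5 h6 h7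
      gcongr
    calc _ ≤ (K * θ ^ p) * (θ⁻¹) ^ (q + 3) * X * Y :=
          aux _ _ _ _ (by positivity) (Real.sqrt_nonneg _) (Real.sqrt_nonneg _) g0 hcard g1 g2
      _ ≤ (K * θ ^ (q + d)) * (θ⁻¹) ^ (q + 3) * X * Y := by
          gcongr ?_ * _ * _ * _
          exact mul_le_mul_of_nonneg_left (pow_le_pow_of_le_one hθ0.le hθ1 hp1) hK
      _ = K * (θ ^ (d + 1) * (θ⁻¹) ^ 4) * X * Y := by
          have : θ ^ (q + d) * (θ⁻¹) ^ (q + 3) = θ ^ (d + 1) * (θ⁻¹) ^ 4 := by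
            rw [inv_pow, inv_pow]
            field_simp
            ring
          linear_combination (K * X * Y) * this
      _ ≤ K * (θ ^ (d + 1) * 2 ^ 4) * X * Y := by gcongr
      _ = _ := by ring
  have hsplit : ∑ k ∈ S, ∑ l ∈ S', b (-k - l) c * g k * h l
      = (∑ k ∈ S, ∑ l ∈ S', (fun m => φ (q + d) m * b m c) (-k - l) * g k * h l)
        + (∑ k ∈ S, ∑ l ∈ S', (fun m => φ (q + d + 1) m * b m c) (-k - l) * g k * h l)
        + (∑ k ∈ S, ∑ l ∈ S', (fun m => φ (q + d + 2) m * b m c) (-k - l) * g k * h l) := by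
    rw [← Finset.sum_add_distrib, ← Finset.sum_add_distrib]
    refine Finset.sum_congr rfl fun k hk => ?_
    rw [← Finset.sum_add_distrib, ← Finset.sum_add_distrib]
    refine Finset.sum_congr rfl fun l hl => ?_
    have := hφ (q + d) (-k - l) (hfreq k hk l hl).1 (hfreq k hk l hl).2
    simp only []
    linear_combination (-(b (-k - l) c * g k * h l)) * this
  rw [hsplit]
  refine (norm_add₃_le).trans ?_
  have p1 := hpiece (q + d) le_rfl (by lia)
  have p2 := hpiece (q + d + 1) (by lia) (by lia)
  have p3 := hpiece (q + d + 2) (by lia) le_rfl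
  linarith

/-- Interactions of a low shell with a much higher one. The divergence form leaves no derivative on
`b` and bounded multipliers on `w` and on its vector potential. -/
theorem norm_sum_triad_far_le {φ ψ : ℕ → (Fin n → ℤ) → ℂ}
    (hφ : ∀ q m, 3 / 4 * 2 ^ (q + 1) ≤ ‖freq m‖ → ‖freq m‖ ≤ 9 / 4 * 2 ^ (q + 1) →
      φ q m + φ (q + 1) m + φ (q + 2) m = 1)
    {r K : ℝ} (hr : 2 < r) (hnr : n < r) {q₀ : ℕ}
    {w b : (Fin n → ℤ) → Fin 3 → ℂ} (hb : Controlled φ ψ r (2 ^ (-(n / r))) K q₀ b)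
    (hK : 0 ≤ K) (hw : ∀ k, emb k ⬝ᵥ w k = 0) (hdiv : ∀ k, emb k ⬝ᵥ b k = 0)
    {S S' : Finset (Fin n → ℤ)} {q d : ℕ}
    (hS : ∀ k ∈ S, ‖freq k‖ < 2 ^ (q + 1))
    (hS' : ∀ k ∈ S', 2 ^ (q + d) ≤ ‖freq k‖ ∧ ‖freq k‖ < 2 ^ (q + d + 1))
    (hq₀ : q₀ ≤ q) (hd : 3 ≤ d) :
    ‖∑ k ∈ S, ∑ l ∈ S', (triad w b k l + triad w b l k)‖
      ≤ 16000 * K * (2 ^ (-(n / r)) : ℝ) ^ d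
        * √(∑ k ∈ S, vsq (w k)) * √(∑ k ∈ S', vsq (w k)) := by
  set X := √(∑ k ∈ S, vsq (w k)) with hX
  set Y := √(∑ k ∈ S', vsq (w k)) with hY
  set θ : ℝ := 2 ^ (-(n / r)) with hθ
  have hX0 : 0 ≤ X := Real.sqrt_nonneg _
  have hY0 : 0 ≤ Y := Real.sqrt_nonneg _
  have hθ0 : 0 ≤ θ := by positivity
  have hBd : ∀ (c : Fin 3) (g h : (Fin n → ℤ) → ℂ), (∀ k, ‖g k‖ ≤ 1 * √(vsq (w k))) →
      (∀ k, ‖h k‖ ≤ 1 * √(vsq (w k))) →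
      ‖∑ k ∈ S, ∑ l ∈ S', b (-k - l) c * g k * h l‖ ≤ 48 * K * θ ^ d * X * Y :=
    fun c g h hg hh => norm_sum_sum_far_le hφ hr hnr hb hK hS hS' hq₀ hd c
      (fun k _ => hg k) (fun k _ => hh k)
  have hw1 : ∀ a k, ‖w k a‖ ≤ 1 * √(vsq (w k)) := fun a k => by
    rw [one_mul]; exact norm_le_sqrt_vsq _ _
  have hp1 : ∀ i a k, ‖emb k i * potential w k a‖ ≤ 1 * √(vsq (w k)) := fun i a k =>
    norm_emb_mul_potential_le w k i a
  set Bd := 48 * K * θ ^ d * X * Y with hBdd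
  have hBd0 : 0 ≤ Bd := by positivity
  have hpi : ‖-twoPiI‖ ≤ 8 := by
    rw [norm_neg, norm_twoPiI]
    linarith [Real.pi_le_four]
  have key : ∀ F : Fin 3 → Fin 3 → (Fin n → ℤ) → (Fin n → ℤ) → ℂ,
      (∀ i j, ‖∑ k ∈ S, ∑ l ∈ S', F i j k l‖ ≤ 2 * Bd) →
      ‖∑ k ∈ S, ∑ l ∈ S', ∑ i, ∑ j, -twoPiI * F i j k l‖ ≤ 144 * Bd := by
    intro F hF
    rw [sum_sum_sum_comm]
    simp_rw [sum_sum_sum_comm, ← Finset.mul_sum]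
    rw [norm_mul]
    have : ‖∑ i, ∑ j, ∑ k ∈ S, ∑ l ∈ S', F i j k l‖ ≤ ∑ i : Fin 3, ∑ j : Fin 3, 2 * Bd :=
      (norm_sum_le _ _).trans (Finset.sum_le_sum fun i _ =>
        (norm_sum_le _ _).trans (Finset.sum_le_sum fun j _ => hF i j))
    simp only [Finset.sum_const, Finset.card_univ, Fintype.card_fin, nsmul_eq_mul] at this
    push_cast at this
    calc _ ≤ 8 * (3 * (3 * (2 * Bd))) := mul_le_mul hpi this (norm_nonneg _) (by norm_num)
      _ = _ := by ring
  have h1 : ‖∑ k ∈ S, ∑ l ∈ S', triad w b k l‖ ≤ 144 * Bd := by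
    rw [Finset.sum_congr rfl fun k _ => Finset.sum_congr rfl fun l _ =>
      triad_eq_divergence w b k l (hw k) (hdiv _)]
    apply key
    intro i j
    simp_rw [Finset.sum_add_distrib]
    refine (norm_add_le _ _).trans ?_
    linarith [hBd i _ _ (hw1 j) (hp1 i j), hBd i _ _ (hw1 j) (hp1 j i)]
  have h2 : ‖∑ k ∈ S, ∑ l ∈ S', triad w b l k‖ ≤ 144 * Bd := by
    rw [Finset.sum_congr rfl fun k _ => Finset.sum_congr rfl fun l _ =>
      triad_eq_divergence w b l k (hw l) (hdiv _)]
    apply key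
    intro i j
    simp_rw [Finset.sum_add_distrib]
    refine (norm_add_le _ _).trans ?_
    have e : ∀ (c : Fin 3) (g h : (Fin n → ℤ) → ℂ), ∑ k ∈ S, ∑ l ∈ S', b (-l - k) c * h l * g k
        = ∑ k ∈ S, ∑ l ∈ S', b (-k - l) c * g k * h l := fun c g h => by
      refine Finset.sum_congr rfl fun k _ => Finset.sum_congr rfl fun l _ => ?_
      rw [show -l - k = -k - l by abel]
      ring
    have e1 := e i (fun k => emb k i * potential w k j) (fun l => w l j)
    have e2 := e i (fun k => emb k j * potential w k i) (fun l => w l j)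
    rw [e1, e2]
    linarith [hBd i _ _ (hp1 i j) (hw1 j), hBd i _ _ (hp1 j i) (hw1 j)]
  simp_rw [Finset.sum_add_distrib]
  refine (norm_add_le _ _).trans ?_
  have h3 : 0 ≤ K * θ ^ d * X * Y := by positivity
  have : Bd = 48 * (K * θ ^ d * X * Y) := by rw [hBdd]; ring
  linarith

theorem half_le_two_rpow {r : ℝ} (hnr : n < r) : (1 / 2 : ℝ) ≤ 2 ^ (-(n / r) : ℝ) := by
  have hr0 : 0 < r := lt_of_le_of_lt (by positivity) hnr
  calc (1 / 2 : ℝ) = 2 ^ (-1 : ℝ) := by rw [Real.rpow_neg_one]; norm_num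
    _ ≤ _ := by
        refine Real.rpow_le_rpow_of_exponent_le (by norm_num) ?_
        rw [neg_le_neg_iff, div_le_one hr0]
        exact hnr.le

/-- The interaction of two dyadic shells decays geometrically in their distance. -/
theorem norm_sum_triad_shell_le (hn : n = 2 ∨ n = 3) {φ ψ : ℕ → (Fin n → ℤ) → ℂ}
    (hφ : ∀ q m, 3 / 4 * 2 ^ (q + 1) ≤ ‖freq m‖ → ‖freq m‖ ≤ 9 / 4 * 2 ^ (q + 1) →
      φ q m + φ (q + 1) m + φ (q + 2) m = 1)
    (hψ : ∀ P m, ‖freq m‖ ≤ 2 ^ P → ψ P m = 1)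
    {r K : ℝ} (hr : 2 < r) (hnr : n < r) {q₀ : ℕ}
    {w b : (Fin n → ℤ) → Fin 3 → ℂ} (hb : Controlled φ ψ r (2 ^ (-(n / r))) K q₀ b)
    (hK : 0 ≤ K) (hw : ∀ k, emb k ⬝ᵥ w k = 0) (hdiv : ∀ k, emb k ⬝ᵥ b k = 0)
    {S S' : Finset (Fin n → ℤ)} {q d : ℕ}
    (hS : ∀ k ∈ S, 2 ^ q ≤ ‖freq k‖ ∧ ‖freq k‖ < 2 ^ (q + 1))
    (hS' : ∀ k ∈ S', 2 ^ (q + d) ≤ ‖freq k‖ ∧ ‖freq k‖ < 2 ^ (q + d + 1))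
    (hq₀ : q₀ ≤ q) :
    ‖∑ k ∈ S, ∑ l ∈ S', (triad w b k l + triad w b l k)‖
      ≤ 160000 * K * (2 ^ (-(n / r)) : ℝ) ^ d
        * √(∑ k ∈ S, vsq (w k)) * √(∑ k ∈ S', vsq (w k)) := by
  have hX0 : 0 ≤ √(∑ k ∈ S, vsq (w k)) := Real.sqrt_nonneg _
  have hY0 : 0 ≤ √(∑ k ∈ S', vsq (w k)) := Real.sqrt_nonneg _
  have hθ := half_le_two_rpow hnr
  rcases le_or_gt d 2 with hd | hd
  · refine (norm_sum_triad_add_triad_le hn hψ hb hK hw hS hS' hq₀ (by lia) (by lia)).trans ?_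
    gcongr ?_ * _ * _
    have : (1 / 4 : ℝ) ≤ (2 ^ (-(n / r)) : ℝ) ^ d := by
      calc (1 / 4 : ℝ) = (1 / 2) ^ 2 := by norm_num
        _ ≤ (1 / 2) ^ d := pow_le_pow_of_le_one (by norm_num) (by norm_num) hd
        _ ≤ _ := pow_le_pow_left₀ (by norm_num) hθ d
    nlinarith
  · refine (norm_sum_triad_far_le hφ hr hnr hb hK hw hdiv (fun k hk => (hS k hk).2) hS' hq₀
      hd).trans ?_
    gcongr ?_ * _ * _ * _ * _
    norm_num

theorem sum_pow_dist_le {θ : ℝ} (h0 : 0 ≤ θ) (h1 : θ < 1) (R q : ℕ) :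
    ∑ p ∈ Finset.range R, θ ^ ((p - q) + (q - p)) ≤ 2 / (1 - θ) := by
  have hg : ∀ s : Finset ℕ, ∑ i ∈ s, θ ^ i ≤ 1 / (1 - θ) := fun s => by
    rw [one_div, ← tsum_geometric_of_lt_one h0 h1]
    exact (summable_geometric_of_lt_one h0 h1).sum_le_tsum s fun i _ => by positivity
  rw [← Finset.sum_filter_add_sum_filter_not _ (fun p => p ≤ q)]
  have i1 : ∑ p ∈ Finset.range R with p ≤ q, θ ^ ((p - q) + (q - p)) ≤ 1 / (1 - θ) := by
    rw [Finset.sum_congr rfl (g := fun p => θ ^ (q - p)) (fun p hp => by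
      have := (Finset.mem_filter.mp hp).2
      congr 1
      lia)]
    rw [← Finset.sum_image (f := fun i => θ ^ i) (g := fun p => q - p)]
    · exact hg _
    · intro a ha b hb hab
      simp only [Finset.coe_filter, Set.mem_ofPred_eq] at ha hb hab
      lia
  have i2 : ∑ p ∈ Finset.range R with ¬ p ≤ q, θ ^ ((p - q) + (q - p)) ≤ 1 / (1 - θ) := by
    rw [Finset.sum_congr rfl (g := fun p => θ ^ (p - q)) (fun p hp => by
      have := (Finset.mem_filter.mp hp).2
      congr 1
      lia)]
    rw [← Finset.sum_image (f := fun i => θ ^ i) (g := fun p => p - q)]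
    · exact hg _
    · intro a ha b hb hab
      simp only [Finset.coe_filter, Set.mem_ofPred_eq] at ha hb hab
      lia
  calc _ ≤ 1 / (1 - θ) + 1 / (1 - θ) := add_le_add i1 i2
    _ = _ := by ring

/-- Schur's test for a kernel with geometric decay. -/
theorem sum_sum_pow_dist_le {θ : ℝ} (h0 : 0 ≤ θ) (h1 : θ < 1) (R : ℕ) (x : ℕ → ℝ) :
    ∑ q ∈ Finset.range R, ∑ p ∈ Finset.range R, θ ^ ((p - q) + (q - p)) * (x q * x p)
      ≤ 2 / (1 - θ) * ∑ q ∈ Finset.range R, x q ^ 2 := by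
  have hle : ∀ q p, θ ^ ((p - q) + (q - p)) * (x q * x p)
      ≤ θ ^ ((p - q) + (q - p)) * (x q ^ 2 / 2) + θ ^ ((q - p) + (p - q)) * (x p ^ 2 / 2) := by
    intro q p
    rw [add_comm (q - p), ← mul_add]
    refine mul_le_mul_of_nonneg_left ?_ (by positivity)
    nlinarith [sq_nonneg (x q - x p)]
  have hsum : ∑ q ∈ Finset.range R, ∑ p ∈ Finset.range R, θ ^ ((p - q) + (q - p)) * (x q ^ 2 / 2)
      ≤ 2 / (1 - θ) * ∑ q ∈ Finset.range R, x q ^ 2 / 2 := by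
    rw [Finset.mul_sum]
    refine Finset.sum_le_sum fun q _ => ?_
    rw [← Finset.sum_mul]
    exact mul_le_mul_of_nonneg_right (sum_pow_dist_le h0 h1 R q) (by positivity)
  calc _ ≤ ∑ q ∈ Finset.range R, ∑ p ∈ Finset.range R, (θ ^ ((p - q) + (q - p)) * (x q ^ 2 / 2)
          + θ ^ ((q - p) + (p - q)) * (x p ^ 2 / 2)) :=
        Finset.sum_le_sum fun q _ => Finset.sum_le_sum fun p _ => hle q p
    _ = ∑ q ∈ Finset.range R, ∑ p ∈ Finset.range R, θ ^ ((p - q) + (q - p)) * (x q ^ 2 / 2)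
        + ∑ q ∈ Finset.range R, ∑ p ∈ Finset.range R, θ ^ ((p - q) + (q - p)) * (x q ^ 2 / 2) := by
        simp_rw [Finset.sum_add_distrib]
        congr 1
        rw [Finset.sum_comm]
    _ ≤ _ := by
        rw [← Finset.sum_div] at hsum
        linarith

theorem triad_eq_zero_left {w b : (Fin n → ℤ) → Fin 3 → ℂ} {k l : Fin n → ℤ} (h : w k = 0) :
    triad w b k l = 0 := by
  simp [triad, h]

theorem triad_eq_zero_right {w b : (Fin n → ℤ) → Fin 3 → ℂ} {k l : Fin n → ℤ} (h : w l = 0) :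
    triad w b k l = 0 := by
  simp [triad, potential, h]

/-- The trilinear form is bounded by the dissipation of `w` in `H⁻¹`, with a constant proportional
to the size `K` of `b`, as soon as `w` has no frequencies below the level at which `b` is
controlled. -/
theorem norm_sum_triad_le (hn : n = 2 ∨ n = 3) {φ ψ : ℕ → (Fin n → ℤ) → ℂ}
    (hφ : ∀ q m, 3 / 4 * 2 ^ (q + 1) ≤ ‖freq m‖ → ‖freq m‖ ≤ 9 / 4 * 2 ^ (q + 1) →
      φ q m + φ (q + 1) m + φ (q + 2) m = 1)
    (hψ : ∀ P m, ‖freq m‖ ≤ 2 ^ P → ψ P m = 1)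
    {r K : ℝ} (hr : 2 < r) (hnr : n < r) {q₀ : ℕ}
    {w b : (Fin n → ℤ) → Fin 3 → ℂ} (hb : Controlled φ ψ r (2 ^ (-(n / r))) K q₀ b)
    (hK : 0 ≤ K) (hw : ∀ k, emb k ⬝ᵥ w k = 0) (hdiv : ∀ k, emb k ⬝ᵥ b k = 0)
    (hsupp : ∀ k, w k ≠ 0 → 2 ^ q₀ ≤ ‖freq k‖) (T : Finset (Fin n → ℤ)) :
    ‖∑ k ∈ T, ∑ l ∈ T, triad w b k l‖
      ≤ 160000 / (1 - 2 ^ (-(n / r) : ℝ)) * K * ∑ k ∈ T, vsq (w k) := by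
  classical
  set θ : ℝ := 2 ^ (-(n / r)) with hθ
  have hn0 : 0 < (n : ℝ) := by rcases hn with rfl | rfl <;> norm_num
  have hθ0 : 0 ≤ θ := by positivity
  have hθ1 : θ < 1 := Real.rpow_lt_one_of_one_lt_of_neg (by norm_num)
    (by rw [neg_lt_zero]; positivity)
  set T' := T.filter (fun k => w k ≠ 0) with hT'
  have e1 : ∑ k ∈ T, ∑ l ∈ T, triad w b k l = ∑ k ∈ T', ∑ l ∈ T', triad w b k l := by
    have hr1 : ∀ k, ∑ l ∈ T, triad w b k l = ∑ l ∈ T', triad w b k l := fun k => by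
      rw [hT', Finset.sum_filter_of_ne]
      intro l _ h h0
      exact h (triad_eq_zero_right h0)
    rw [Finset.sum_congr rfl fun k _ => hr1 k]
    symm
    rw [hT', Finset.sum_filter_of_ne]
    intro k _ h h0
    exact h (Finset.sum_eq_zero fun l _ => triad_eq_zero_left h0)
  have e2 : ∑ k ∈ T', vsq (w k) ≤ ∑ k ∈ T, vsq (w k) :=
    Finset.sum_le_sum_of_subset_of_nonneg (Finset.filter_subset _ _) fun k _ _ => vsq_nonneg _
  -- decompose into the dyadic shells `2^q ≤ |k| < 2^{q + 1}`, that is `4^q ≤ |k|² < 4^{q + 1}`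
  set lev : (Fin n → ℤ) → ℕ := fun k => Nat.log 4 (ksq k) with hlev
  set R := T'.sup lev + 1 with hR
  have hmaps : ∀ k ∈ T', lev k ∈ Finset.range R := fun k hk => by
    rw [Finset.mem_range, hR]
    exact Nat.lt_succ_of_le (Finset.le_sup hk)
  set S : ℕ → Finset (Fin n → ℤ) := fun q => T'.filter (fun k => lev k = q) with hSdef
  have hS : ∀ q, ∀ k ∈ S q, 2 ^ q ≤ ‖freq k‖ ∧ ‖freq k‖ < 2 ^ (q + 1) := by
    intro q k hk
    rw [hSdef, Finset.mem_filter, hT', Finset.mem_filter] at hk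
    obtain ⟨⟨_, hwk⟩, rfl⟩ := hk
    have hk0 : ksq k ≠ 0 := by
      intro h
      have := ne_zero_of_norm_freq (hsupp k hwk)
      exact this (ksq_eq_zero.mp h)
    have h4 : ∀ q : ℕ, (2 : ℝ) ^ q = √((4 : ℝ) ^ q) := fun q => by
      rw [show (4 : ℝ) = 2 ^ 2 by norm_num, ← pow_mul, mul_comm, pow_mul,
        Real.sqrt_sq (by positivity)]
    rw [← sqrt_ksq_eq, h4, h4]
    constructor
    · exact Real.sqrt_le_sqrt (by exact_mod_cast Nat.pow_log_le_self 4 hk0)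
    · exact Real.sqrt_lt_sqrt (by positivity)
        (by exact_mod_cast Nat.lt_pow_succ_log_self (by norm_num) (ksq k))
  have hempty : ∀ q, q < q₀ → S q = ∅ := by
    intro q hq
    rw [Finset.eq_empty_iff_forall_notMem]
    intro k hk
    have h1 := (hS q k hk).2
    have h2 : w k ≠ 0 := (Finset.mem_filter.mp (Finset.mem_filter.mp hk).1).2
    have h3 := hsupp k h2
    have h4 : (2 : ℝ) ^ (q + 1) ≤ 2 ^ q₀ := pow_le_pow_right₀ (by norm_num) hq
    linarith
  set x : ℕ → ℝ := fun q => √(∑ k ∈ S q, vsq (w k)) with hx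
  set G : ℕ → ℕ → ℂ := fun q p => ∑ k ∈ S q, ∑ l ∈ S p, (triad w b k l + triad w b l k) with hG
  have hGsymm : ∀ q p, G q p = G p q := fun q p => by
    simp only [hG]
    rw [Finset.sum_comm]
    exact Finset.sum_congr rfl fun k _ => Finset.sum_congr rfl fun l _ => add_comm _ _
  have hGle : ∀ q d, ‖G q (q + d)‖ ≤ 160000 * K * θ ^ d * x q * x (q + d) := by
    intro q d
    rcases lt_or_ge q q₀ with hq | hq
    · have : G q (q + d) = 0 := by simp only [hG]; rw [hempty q hq, Finset.sum_empty]
      rw [this, norm_zero]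
      positivity
    · exact norm_sum_triad_shell_le hn hφ hψ hr hnr hb hK hw hdiv (hS q) (hS (q + d)) hq
  have hGle' : ∀ q p, ‖G q p‖ ≤ 160000 * K * (θ ^ ((p - q) + (q - p)) * (x q * x p)) := by
    intro q p
    rcases le_total q p with h | h
    · obtain ⟨d, rfl⟩ := Nat.exists_eq_add_of_le h
      refine (hGle q d).trans (le_of_eq ?_)
      rw [show q + d - q + (q - (q + d)) = d by lia]
      ring
    · obtain ⟨d, rfl⟩ := Nat.exists_eq_add_of_le h
      rw [hGsymm]
      refine (hGle p d).trans (le_of_eq ?_)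
      rw [show p - (p + d) + (p + d - p) = d by lia]
      ring
  -- twice the sum is symmetric, so that only `q ≤ p` needs an estimate
  have e3 : (2 : ℂ) * ∑ k ∈ T', ∑ l ∈ T', triad w b k l
      = ∑ q ∈ Finset.range R, ∑ p ∈ Finset.range R, G q p := by
    have f1 : ∑ k ∈ T', ∑ l ∈ T', (triad w b k l + triad w b l k)
        = (2 : ℂ) * ∑ k ∈ T', ∑ l ∈ T', triad w b k l := by
      simp_rw [Finset.sum_add_distrib]
      rw [Finset.sum_comm (f := fun k l => triad w b l k), two_mul]
    rw [← f1, ← Finset.sum_fiberwise_of_maps_to hmaps]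
    refine Finset.sum_congr rfl fun q _ => ?_
    simp only [hG]
    rw [Finset.sum_comm (s := Finset.range R)]
    refine Finset.sum_congr rfl fun k _ => ?_
    rw [← Finset.sum_fiberwise_of_maps_to hmaps]
  have e4 : ∑ q ∈ Finset.range R, x q ^ 2 = ∑ k ∈ T', vsq (w k) := by
    rw [← Finset.sum_fiberwise_of_maps_to hmaps]
    refine Finset.sum_congr rfl fun q _ => ?_
    exact Real.sq_sqrt (Finset.sum_nonneg fun k _ => vsq_nonneg _)
  have e5 : ‖(2 : ℂ) * ∑ k ∈ T', ∑ l ∈ T', triad w b k l‖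
      ≤ 160000 * K * (2 / (1 - θ) * ∑ k ∈ T', vsq (w k)) := by
    rw [e3, ← e4]
    calc _ ≤ ∑ q ∈ Finset.range R, ∑ p ∈ Finset.range R,
          160000 * K * (θ ^ ((p - q) + (q - p)) * (x q * x p)) :=
          (norm_sum_le _ _).trans (Finset.sum_le_sum fun q _ =>
            (norm_sum_le _ _).trans (Finset.sum_le_sum fun p _ => hGle' q p))
      _ = 160000 * K * ∑ q ∈ Finset.range R, ∑ p ∈ Finset.range R,
          (θ ^ ((p - q) + (q - p)) * (x q * x p)) := by
          simp_rw [← Finset.mul_sum]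
      _ ≤ _ := mul_le_mul_of_nonneg_left (sum_sum_pow_dist_le hθ0 hθ1 R x) (by positivity)
  rw [e1]
  rw [norm_mul, Complex.norm_ofNat] at e5
  have h1θ : 0 < 1 - θ := by linarith
  calc ‖∑ k ∈ T', ∑ l ∈ T', triad w b k l‖
      ≤ 160000 / (1 - θ) * K * ∑ k ∈ T', vsq (w k) := by
        have : 160000 * K * (2 / (1 - θ) * ∑ k ∈ T', vsq (w k))
          = 2 * (160000 / (1 - θ) * K * ∑ k ∈ T', vsq (w k)) := by ring
        linarith
    _ ≤ _ := by gcongr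

/-! ### Fourier coefficients of square-integrable functions -/

/-- The Fourier coefficient of a real function. -/
def fcoef (f : Torus n → ℝ) (k : Fin n → ℤ) : ℂ := mFourierCoeff (fun x => (f x : ℂ)) k

theorem fcoef_eq (f : Torus n → ℝ) (k : Fin n → ℤ) :
    fcoef f k = ∫ x, mFourier (-k) x * (f x : ℂ) ∂(torusMeasure n) := rfl

theorem mFourierCoeff_toLp_eq {f : Torus n → ℂ} (hf : MemLp f 2 (torusMeasure n))
    (k : Fin n → ℤ) : mFourierCoeff (hf.toLp f) k = mFourierCoeff f k := by
  refine integral_congr_ae ?_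
  have h : (hf.toLp f : Torus n → ℂ) =ᵐ[torusMeasure n] f := hf.coeFn_toLp
  filter_upwards [h] with x hx
  rw [hx]

theorem integrable_of_memLp {E : Type*} [NormedAddCommGroup E] {f : Torus n → E}
    (hf : MemLp f 2 (torusMeasure n)) : Integrable f (torusMeasure n) :=
  hf.integrable (by norm_num)

theorem hasSum_sq_mFourierCoeff_of_memLp {f : Torus n → ℂ} (hf : MemLp f 2 (torusMeasure n)) :
    HasSum (fun k => ‖mFourierCoeff f k‖ ^ 2) (∫ x, ‖f x‖ ^ 2 ∂(torusMeasure n)) := by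
  have h := hasSum_sq_mFourierCoeff (d := Fin n) (hf.toLp f)
  simp only [mFourierCoeff_toLp_eq] at h
  convert h using 1
  refine integral_congr_ae ?_
  have h : (hf.toLp f : Torus n → ℂ) =ᵐ[torusMeasure n] f := hf.coeFn_toLp
  filter_upwards [h] with x hx
  rw [hx]

theorem hasSum_mul_mFourierCoeff {f g : Torus n → ℂ} (hf : MemLp f 2 (torusMeasure n))
    (hg : MemLp g 2 (torusMeasure n)) :
    HasSum (fun k => conj (mFourierCoeff f k) * mFourierCoeff g k)
      (∫ x, conj (f x) * g x ∂(torusMeasure n)) := by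
  have h := hasSum_prod_mFourierCoeff (d := Fin n) (hf.toLp f) (hg.toLp g)
  simp only [mFourierCoeff_toLp_eq] at h
  convert h using 1
  refine integral_congr_ae ?_
  have h1 : (hf.toLp f : Torus n → ℂ) =ᵐ[torusMeasure n] f := hf.coeFn_toLp
  have h2 : (hg.toLp g : Torus n → ℂ) =ᵐ[torusMeasure n] g := hg.coeFn_toLp
  filter_upwards [h1, h2] with x hx hx'
  rw [hx, hx']

theorem memLp_ofReal {f : Torus n → ℝ} {p : ℝ≥0∞} (hf : MemLp f p (torusMeasure n)) :
    MemLp (fun x => (f x : ℂ)) p (torusMeasure n) := hf.ofReal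

theorem fcoef_neg (f : Torus n → ℝ) (k : Fin n → ℤ) : fcoef f (-k) = conj (fcoef f k) := by
  rw [fcoef_eq, fcoef_eq, ← integral_conj]
  refine integral_congr_ae (ae_of_all _ fun x => ?_)
  simp [mFourier_neg]

theorem hasSum_sq_fcoef {f : Torus n → ℝ} (hf : MemLp f 2 (torusMeasure n)) :
    HasSum (fun k => ‖fcoef f k‖ ^ 2) (∫ x, f x ^ 2 ∂(torusMeasure n)) := by
  have := hasSum_sq_mFourierCoeff_of_memLp (memLp_ofReal hf)
  simpa [fcoef] using this

/-- The convolution theorem for two functions in `L²`. -/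
theorem hasSum_fcoef_mul {f g : Torus n → ℝ} (hf : MemLp f 2 (torusMeasure n))
    (hg : MemLp g 2 (torusMeasure n)) (l : Fin n → ℤ) :
    HasSum (fun k => fcoef f k * fcoef g (l - k)) (fcoef (fun x => f x * g x) l) := by
  have hg' : MemLp (fun x => mFourier (-l) x * (g x : ℂ)) 2 (torusMeasure n) := by
    refine (memLp_ofReal hg).of_le
      ((continuous_mFourier _).aestronglyMeasurable.mul (memLp_ofReal hg).1)
      (ae_of_all _ fun x => ?_)
    rw [norm_mul, norm_mFourier_apply, one_mul]
  have h := hasSum_mul_mFourierCoeff (memLp_ofReal hf) hg'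
  have e1 : ∀ k, mFourierCoeff (fun x => mFourier (-l) x * (g x : ℂ)) k = fcoef g (k + l) := by
    intro k
    rw [fcoef_eq]
    refine integral_congr_ae (ae_of_all _ fun x => ?_)
    simp only [smul_eq_mul]
    rw [neg_add, mFourier_add, mul_assoc]
  have e2 : ∫ x, conj (f x : ℂ) * (mFourier (-l) x * (g x : ℂ)) ∂(torusMeasure n)
      = fcoef (fun x => f x * g x) l := by
    rw [fcoef_eq]
    refine integral_congr_ae (ae_of_all _ fun x => ?_)
    simp only [Complex.conj_ofReal]
    push_cast
    ring
  rw [e2] at h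
  rw [← (Equiv.neg (Fin n → ℤ)).hasSum_iff]
  convert h using 2 with k
  simp only [Function.comp, Equiv.neg_apply, e1]
  rw [fcoef_neg, sub_neg_eq_add, add_comm]
  rfl

theorem fcoef_sub {f g : Torus n → ℝ} (hf : MemLp f 2 (torusMeasure n))
    (hg : MemLp g 2 (torusMeasure n)) (k : Fin n → ℤ) :
    fcoef (fun x => f x - g x) k = fcoef f k - fcoef g k := by
  have hi : ∀ {u : Torus n → ℝ}, MemLp u 2 (torusMeasure n) →
      Integrable (fun x => mFourier (-k) x * (u x : ℂ)) (torusMeasure n) := fun hu =>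
    Integrable.bdd_mul (c := 1) (integrable_of_memLp hu).ofReal
      (continuous_mFourier (-k)).aestronglyMeasurable
      (ae_of_all _ fun x => (norm_mFourier_apply _ _).le)
  rw [fcoef_eq, fcoef_eq, fcoef_eq, ← integral_sub (hi hf) (hi hg)]
  simp_rw [Complex.ofReal_sub, mul_sub]

/-! ### Real trigonometric test functions -/

/-- The real trigonometric monomial `Re (c e^{2πi k·x})`. -/
def reTrig (c : ℂ) (k : Fin n → ℤ) (x : Torus n) : ℝ := (c * mFourier k x).re

theorem continuous_reTrig (c : ℂ) (k : Fin n → ℤ) : Continuous (reTrig c k : Torus n → ℝ) :=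
  Complex.continuous_re.comp (continuous_const.mul (continuous_mFourier k))

theorem mFourier_coe (k : Fin n → ℤ) (y : Fin n → ℝ) :
    mFourier k (fun i => (y i : UnitAddCircle))
      = ∏ i, Complex.exp (2 * Real.pi * Complex.I * k i * y i) := by
  simp only [mFourier, ContinuousMap.coe_mk]
  refine Finset.prod_congr rfl fun i _ => ?_
  rw [fourier_coe_apply]
  simp

theorem isSmooth_reTrig_smul {E : Type*} [NormedAddCommGroup E] [NormedSpace ℝ E] (c : ℂ)
    (k : Fin n → ℤ) (e : E) : IsSmooth (fun x : Torus n => reTrig c k x • e) := by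
  unfold IsSmooth reTrig
  simp_rw [mFourier_coe]
  refine ContDiff.smul ?_ contDiff_const
  refine Complex.reCLM.contDiff.comp (contDiff_const.mul (contDiff_prod fun i _ => ?_))
  refine ContDiff.cexp ?_
  refine contDiff_const.mul (Complex.ofRealCLM.contDiff.comp ?_)
  exact contDiff_apply ℝ ℝ i

theorem isSmooth_reTrig (c : ℂ) (k : Fin n → ℤ) : IsSmooth (reTrig c k : Torus n → ℝ) := by
  simpa using isSmooth_reTrig_smul c k (1 : ℝ)

theorem mFourier_add_single (k : Fin n → ℤ) (j : Fin n) (x : Torus n) (h : ℝ) :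
    mFourier k (x + Pi.single j (h : UnitAddCircle))
      = mFourier k x * Complex.exp (twoPiI * k j * h) := by
  simp only [mFourier, ContinuousMap.coe_mk]
  rw [← Finset.mul_prod_erase _ _ (Finset.mem_univ j),
    ← Finset.mul_prod_erase Finset.univ _ (Finset.mem_univ j)]
  have e1 : ∀ i ∈ Finset.univ.erase j,
      fourier (k i) ((x + Pi.single (M := fun _ => UnitAddCircle) j (h : UnitAddCircle)) i)
      = fourier (k i) (x i) := by
    intro i hi
    rw [Pi.add_apply, Pi.single_eq_of_ne (Finset.ne_of_mem_erase hi), add_zero]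
  rw [Finset.prod_congr rfl e1, Pi.add_apply, Pi.single_eq_same]
  have e2 : fourier (k j) (x j + (h : UnitAddCircle))
      = fourier (k j) (x j) * Complex.exp (twoPiI * k j * h) := by
    have : fourier (k j) (x j + (h : UnitAddCircle))
        = fourier (k j) (x j) * fourier (k j) (h : UnitAddCircle) := by
      simp only [fourier_apply, smul_add, AddCircle.toCircle_add, Circle.coe_mul]
    rw [this, fourier_coe_apply]
    simp [twoPiI]
  rw [e2]
  ring

theorem hasDerivAt_mFourier_add_single (k : Fin n → ℤ) (j : Fin n) (x : Torus n) :
    HasDerivAt (fun h : ℝ => mFourier k (x + Pi.single j (h : UnitAddCircle)))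
      (twoPiI * k j * mFourier k x) 0 := by
  simp_rw [mFourier_add_single]
  have h1 : HasDerivAt (fun h : ℝ => (twoPiI * k j * (h : ℂ))) (twoPiI * k j) 0 := by
    simpa using (Complex.ofRealCLM.hasDerivAt (x := (0 : ℝ))).const_mul (twoPiI * (k j : ℂ))
  refine (h1.cexp.const_mul (mFourier k x)).congr_deriv ?_
  simp only [Complex.ofReal_zero, mul_zero, Complex.exp_zero]
  ring

theorem hasDerivAt_reTrig (c : ℂ) (k : Fin n → ℤ) (j : Fin n) (x : Torus n) :
    HasDerivAt (fun h : ℝ => reTrig c k (x + Pi.single j (h : UnitAddCircle)))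
      (reTrig (twoPiI * k j * c) k x) 0 := by
  have h := (hasDerivAt_mFourier_add_single k j x).const_mul c
  refine (Complex.reCLM.hasFDerivAt.comp_hasDerivAt (0 : ℝ) h).congr_deriv ?_
  rw [Complex.reCLM_apply, reTrig]
  congr 1
  ring

theorem partialD_reTrig_smul {E : Type*} [NormedAddCommGroup E] [NormedSpace ℝ E] (c : ℂ)
    (k : Fin n → ℤ) (j : Fin n) (e : E) :
    partialD j (fun x : Torus n => reTrig c k x • e)
      = fun x => reTrig (twoPiI * k j * c) k x • e := by
  funext x
  exact ((hasDerivAt_reTrig c k j x).smul_const e).deriv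

theorem partialD_reTrig (c : ℂ) (k : Fin n → ℤ) (j : Fin n) :
    partialD j (reTrig c k : Torus n → ℝ) = reTrig (twoPiI * k j * c) k := by
  simpa using partialD_reTrig_smul c k j (1 : ℝ)

theorem reTrig_zero (k : Fin n → ℤ) (x : Torus n) : reTrig 0 k x = 0 := by simp [reTrig]

theorem reTrig_sub (c d : ℂ) (k : Fin n → ℤ) (x : Torus n) :
    reTrig (c - d) k x = reTrig c k x - reTrig d k x := by simp [reTrig, sub_mul]

theorem reTrig_mul_ofReal (c : ℂ) (a : ℝ) (k : Fin n → ℤ) (x : Torus n) :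
    reTrig (c * a) k x = reTrig c k x * a := by
  simp only [reTrig]
  rw [mul_right_comm, Complex.re_mul_ofReal]

theorem partial3_reTrig_mul (c : ℂ) (k : Fin n → ℤ) (a : Fin 3) (s : ℝ) (x : Torus n) :
    partial3 a (fun y : Torus n => reTrig c k y * s) x = reTrig (twoPiI * emb k a * c * s) k x := by
  unfold partial3 emb
  split_ifs with h
  · have := partialD_reTrig_smul c k ⟨a, h⟩ s
    simp only [smul_eq_mul] at this
    rw [this, reTrig_mul_ofReal]
  · simp [reTrig_zero]

theorem curl_reTrig_smul (c : ℂ) (k : Fin n → ℤ) (e : V3) (x : Torus n) (i : Fin 3) :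
    curl (fun y : Torus n => reTrig c k y • e) x i
      = reTrig (twoPiI * c * (emb k ⨯₃ fun a => (e a : ℂ)) i) k x := by
  simp only [curl, curlWith, PiLp.smul_apply, smul_eq_mul, partial3_reTrig_mul, cross_apply,
    ← reTrig_sub]
  fin_cases i <;> simp <;> congr 1 <;> ring

theorem laplacian_reTrig_smul (c : ℂ) (k : Fin n → ℤ) (e : V3) (x : Torus n) :
    laplacian (fun y : Torus n => reTrig c k y • e) x
      = reTrig (-(4 * Real.pi ^ 2 * (ksq k : ℝ)) * c) k x • e := by
  simp only [laplacian, partialD_reTrig_smul, ← Finset.sum_smul]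
  congr 1
  have : -(4 * (Real.pi : ℂ) ^ 2 * ((ksq k : ℝ) : ℂ)) * c
      = ∑ j, twoPiI * (k j : ℂ) * (twoPiI * (k j : ℂ) * c) := by
    rw [ksq_cast]
    push_cast
    rw [Finset.mul_sum, ← Finset.sum_neg_distrib, Finset.sum_mul]
    refine Finset.sum_congr rfl fun j _ => ?_
    have hI : twoPiI * twoPiI = -(4 * (Real.pi : ℂ) ^ 2) := by
      rw [twoPiI]
      linear_combination (4 * (Real.pi : ℂ) ^ 2) * Complex.I_mul_I
    linear_combination (-(k j : ℂ) ^ 2 * c) * hI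
  rw [this]
  simp only [reTrig]
  rw [Finset.sum_mul, Complex.re_sum]

theorem integral_mul_reTrig {f : Torus n → ℝ} (hf : Integrable f (torusMeasure n)) (c : ℂ)
    (k : Fin n → ℤ) :
    ∫ x, f x * reTrig c (-k) x ∂(torusMeasure n) = (c * fcoef f k).re := by
  have hint : Integrable (fun x => mFourier (-k) x * (f x : ℂ)) (torusMeasure n) := by
    refine Integrable.bdd_mul (c := 1) hf.ofReal
      (continuous_mFourier (-k)).aestronglyMeasurable (ae_of_all _ fun x => ?_)
    rw [norm_mFourier_apply]
  rw [fcoef_eq, ← integral_const_mul]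
  have := integral_re (hint.const_mul c)
  simp only [RCLike.re_to_complex] at this
  rw [← this]
  refine integral_congr_ae (ae_of_all _ fun x => ?_)
  simp only [reTrig]
  rw [← mul_assoc, Complex.re_mul_ofReal, mul_comm]

theorem integrable_mul_reTrig {f : Torus n → ℝ} (hf : Integrable f (torusMeasure n)) (c : ℂ)
    (k : Fin n → ℤ) : Integrable (fun x => f x * reTrig c k x) (torusMeasure n) := by
  refine Integrable.mul_bdd (c := ‖c‖) hf
      (continuous_reTrig c k).aestronglyMeasurable (ae_of_all _ fun x => ?_)
  refine (Complex.abs_re_le_norm _).trans ?_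
  rw [norm_mul, norm_mFourier_apply, mul_one]

theorem eq_of_re_mul_eq {z w : ℂ} (h : ∀ c : ℂ, (c * z).re = (c * w).re) : z = w := by
  apply Complex.ext
  · simpa using h 1
  · simpa using h (-Complex.I)

/-! ### Weak derivatives on the Fourier side -/

theorem fcoef_of_hasWeakPartial {j : Fin n} {f g : Torus n → ℝ}
    (hf : Integrable f (torusMeasure n)) (hg : Integrable g (torusMeasure n))
    (h : HasWeakPartial j f g) (k : Fin n → ℤ) : fcoef g k = twoPiI * k j * fcoef f k := by
  apply eq_of_re_mul_eq
  intro c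
  have h1 := h _ (isSmooth_reTrig c (-k))
  rw [partialD_reTrig, integral_mul_reTrig hf, integral_mul_reTrig hg] at h1
  rw [← neg_eq_iff_eq_neg] at h1
  rw [← h1, ← Complex.neg_re]
  congr 1
  push_cast [Pi.neg_apply]
  ring

theorem weakPartial_spec {f : Torus n → ℝ} (hf : MemH1 f) (j : Fin n) :
    MemLp (weakPartial j f) 2 (torusMeasure n) ∧
      ∀ k, fcoef (weakPartial j f) k = twoPiI * k j * fcoef f k := by
  have h := hf.2 j
  have h2 := h.choose_spec
  have e : weakPartial j f = h.choose := by
    unfold weakPartial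
    rw [dif_pos h]
  rw [e]
  exact ⟨h2.1, fcoef_of_hasWeakPartial (integrable_of_memLp hf.1) (integrable_of_memLp h2.1) h2.2⟩

theorem weakPartial3_spec {f : Torus n → ℝ} (hf : MemH1 f) (a : Fin 3) :
    MemLp (weakPartial3 a f) 2 (torusMeasure n) ∧
      ∀ k, fcoef (weakPartial3 a f) k = twoPiI * emb k a * fcoef f k := by
  by_cases h : (a : ℕ) < n
  · have e : weakPartial3 a f = weakPartial ⟨a, h⟩ f := by
      funext x
      simp [weakPartial3, h]
    rw [e]
    simpa [emb, h] using weakPartial_spec hf ⟨a, h⟩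
  · have e : weakPartial3 a f = 0 := by
      funext x
      simp [weakPartial3, h]
    rw [e]
    refine ⟨MemLp.zero, fun k => ?_⟩
    simp [emb, h, fcoef, mFourierCoeff]

/-- The Fourier coefficients of a real vector field. -/
def vcoef (f : Torus n → V3) (k : Fin n → ℤ) : Fin 3 → ℂ := fun a => fcoef (fun x => f x a) k

theorem vcoef_neg (f : Torus n → V3) (k : Fin n → ℤ) (a : Fin 3) :
    vcoef f (-k) a = conj (vcoef f k a) := fcoef_neg _ _

theorem memLp_apply {f : Torus n → V3} (hf : MemLp f 2 (torusMeasure n)) (a : Fin 3) :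
    MemLp (fun x => f x a) 2 (torusMeasure n) :=
  (EuclideanSpace.proj (𝕜 := ℝ) a : V3 →L[ℝ] ℝ).comp_memLp' hf

theorem emb_dot_vcoef {f : Torus n → V3} (hf : MemLp f 2 (torusMeasure n)) (hdiv : DivFree f)
    (k : Fin n → ℤ) : emb k ⬝ᵥ vcoef f k = 0 := by
  have hi : ∀ a, Integrable (fun x => f x a) (torusMeasure n) := fun a =>
    integrable_of_memLp (memLp_apply hf a)
  have hz : -twoPiI * (emb k ⬝ᵥ vcoef f k) = 0 := by
    apply eq_of_re_mul_eq
    intro c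
    have h := hdiv _ (isSmooth_reTrig c (-k))
    have e : ∀ (a : Fin 3) (x : Torus n), partial3 a (reTrig c (-k)) x
        = reTrig (twoPiI * emb (-k) a * c) (-k) x := by
      intro a x
      have := partial3_reTrig_mul c (-k) a 1 x
      simpa using this
    simp_rw [e] at h
    rw [integral_finsetSum _ fun a _ => integrable_mul_reTrig (hi a) _ _] at h
    simp_rw [integral_mul_reTrig (hi _)] at h
    rw [← Complex.re_sum] at h
    rw [mul_zero, Complex.zero_re, ← h]
    congr 1
    rw [dotProduct, Finset.mul_sum, Finset.mul_sum]
    refine Finset.sum_congr rfl fun a _ => ?_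
    rw [emb_neg, Pi.neg_apply, vcoef]
    ring
  have h0 : twoPiI ≠ 0 := by
    intro h
    have := norm_twoPiI
    rw [h, norm_zero] at this
    linarith [Real.pi_pos]
  simpa [h0] using hz

/-! ### Absolute convergence of the trilinear form -/

theorem summable_mul_and_tsum_le {ι : Type*} {x y : ι → ℝ} (hx0 : ∀ i, 0 ≤ x i)
    (hy0 : ∀ i, 0 ≤ y i) (hx : Summable fun i => x i ^ 2) (hy : Summable fun i => y i ^ 2) :
    Summable (fun i => x i * y i) ∧
      ∑' i, x i * y i ≤ √(∑' i, x i ^ 2) * √(∑' i, y i ^ 2) := by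
  have := Real.summable_and_inner_le_Lp_mul_Lq_tsum_of_nonneg Real.HolderConjugate.two_two hx0 hy0
    (by simpa using hx) (by simpa using hy)
  simpa [Real.sqrt_eq_rpow] using this

/-- `∑ₖ |u(k)|²`. -/
def s0 (u : (Fin n → ℤ) → Fin 3 → ℂ) : ℝ := ∑' k, vsq (u k)

/-- `∑ₖ |k|² |u(k)|²`. -/
def s1 (u : (Fin n → ℤ) → Fin 3 → ℂ) : ℝ := ∑' k, (ksq k : ℝ) * vsq (u k)

/-- The Fourier coefficients of a field in `H¹`. -/
structure H1Seq (u : (Fin n → ℤ) → Fin 3 → ℂ) : Prop where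
  summable0 : Summable fun k => vsq (u k)
  summable1 : Summable fun k => (ksq k : ℝ) * vsq (u k)

theorem s1_nonneg (u : (Fin n → ℤ) → Fin 3 → ℂ) : 0 ≤ s1 u :=
  tsum_nonneg fun _ => mul_nonneg (by positivity) (vsq_nonneg _)

theorem vsq_sub_le (u v : Fin 3 → ℂ) : vsq (u - v) ≤ 2 * vsq u + 2 * vsq v := by
  simp only [vsq, Finset.mul_sum, ← Finset.sum_add_distrib]
  refine Finset.sum_le_sum fun a _ => ?_
  have := norm_sub_le (u a) (v a)
  have h := pow_le_pow_left₀ (norm_nonneg _) this 2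
  rw [Pi.sub_apply]
  nlinarith [sq_nonneg (‖u a‖ - ‖v a‖)]

theorem H1Seq.sub {u v : (Fin n → ℤ) → Fin 3 → ℂ} (hu : H1Seq u) (hv : H1Seq v) :
    H1Seq (u - v) := by
  constructor
  · exact Summable.of_nonneg_of_le (fun k => vsq_nonneg _) (fun k => vsq_sub_le (u k) (v k))
      ((hu.summable0.mul_left 2).add (hv.summable0.mul_left 2))
  · refine Summable.of_nonneg_of_le (fun k => mul_nonneg (by positivity) (vsq_nonneg _))
      (fun k => ?_) ((hu.summable1.mul_left 2).add (hv.summable1.mul_left 2))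
    have h := mul_le_mul_of_nonneg_left (vsq_sub_le (u k) (v k))
      (by positivity : (0 : ℝ) ≤ ksq k)
    rw [Pi.sub_apply]
    linarith

theorem s0_sub_le {u v : (Fin n → ℤ) → Fin 3 → ℂ} (hu : Summable fun k => vsq (u k))
    (hv : Summable fun k => vsq (v k)) : s0 (u - v) ≤ 2 * s0 u + 2 * s0 v := by
  rw [s0, s0, s0, ← tsum_mul_left, ← tsum_mul_left,
    ← (hu.mul_left 2).tsum_add (hv.mul_left 2)]
  have hs := (hu.mul_left 2).add (hv.mul_left 2)
  exact Summable.tsum_le_tsum (fun k => vsq_sub_le (u k) (v k))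
    (Summable.of_nonneg_of_le (fun k => vsq_nonneg _) (fun k => vsq_sub_le (u k) (v k)) hs) hs

theorem s1_sub_le {u v : (Fin n → ℤ) → Fin 3 → ℂ} (hu : H1Seq u) (hv : H1Seq v) :
    s1 (u - v) ≤ 2 * s1 u + 2 * s1 v := by
  rw [s1, s1, s1, ← tsum_mul_left, ← tsum_mul_left,
    ← (hu.summable1.mul_left 2).tsum_add (hv.summable1.mul_left 2)]
  refine Summable.tsum_le_tsum (fun k => ?_) (hu.sub hv).summable1
    ((hu.summable1.mul_left 2).add (hv.summable1.mul_left 2))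
  have h := mul_le_mul_of_nonneg_left (vsq_sub_le (u k) (v k)) (by positivity : (0 : ℝ) ≤ ksq k)
  rw [Pi.sub_apply]
  linarith

/-- The `k`-th term in the convolution sum for the `l`-th Fourier coefficient of
`(∇ × u) × v`. -/
def convTerm (u v : (Fin n → ℤ) → Fin 3 → ℂ) (l k : Fin n → ℤ) : Fin 3 → ℂ :=
  (twoPiI • (emb k ⨯₃ u k)) ⨯₃ v (l - k)

theorem norm_convTerm_le (u v : (Fin n → ℤ) → Fin 3 → ℂ) (l k : Fin n → ℤ) (i : Fin 3) :
    ‖convTerm u v l k i‖ ≤ 32 * (√((ksq k : ℝ) * vsq (u k)) * √(vsq (v (l - k)))) := by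
  have h1 : ∀ i, ‖(twoPiI • (emb k ⨯₃ u k)) i‖ ≤ 8 * (2 * √(ksq k) * √(vsq (u k))) := fun i => by
    rw [Pi.smul_apply, norm_smul]
    refine mul_le_mul ?_ (norm_cross_le _ _ (norm_emb_le k) (norm_le_sqrt_vsq _) i)
      (norm_nonneg _) (by norm_num)
    rw [norm_twoPiI]
    linarith [Real.pi_le_four]
  refine (norm_cross_le _ _ h1 (norm_le_sqrt_vsq _) i).trans (le_of_eq ?_)
  rw [Real.sqrt_mul (by positivity)]
  ring

theorem summable_convTerm_and_tsum_le {u v : (Fin n → ℤ) → Fin 3 → ℂ} (hu : H1Seq u)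
    (hv : Summable fun k => vsq (v k)) (l : Fin n → ℤ) :
    Summable (fun k => √((ksq k : ℝ) * vsq (u k)) * √(vsq (v (l - k)))) ∧
      ∑' k, √((ksq k : ℝ) * vsq (u k)) * √(vsq (v (l - k))) ≤ √(s1 u) * √(s0 v) := by
  have e1 : ∀ k, √((ksq k : ℝ) * vsq (u k)) ^ 2 = (ksq k : ℝ) * vsq (u k) := fun k =>
    Real.sq_sqrt (mul_nonneg (by positivity) (vsq_nonneg _))
  have e2 : ∀ k, √(vsq (v (l - k))) ^ 2 = vsq (v (l - k)) := fun k =>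
    Real.sq_sqrt (vsq_nonneg _)
  have h := summable_mul_and_tsum_le (x := fun k => √((ksq k : ℝ) * vsq (u k)))
    (y := fun k => √(vsq (v (l - k)))) (fun _ => Real.sqrt_nonneg _) (fun _ => Real.sqrt_nonneg _)
    (by simp_rw [e1]; exact hu.summable1)
    (by simp_rw [e2]; exact (Equiv.subLeft l).summable_iff.mpr hv)
  simp_rw [e1, e2] at h
  have e3 : ∑' k, vsq (v (l - k)) = s0 v := (Equiv.subLeft l).tsum_eq fun k => vsq (v k)
  rwa [e3] at h

theorem summable_convTerm {u v : (Fin n → ℤ) → Fin 3 → ℂ} (hu : H1Seq u)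
    (hv : Summable fun k => vsq (v k)) (l : Fin n → ℤ) (i : Fin 3) :
    Summable fun k => convTerm u v l k i :=
  Summable.of_norm_bounded ((summable_convTerm_and_tsum_le hu hv l).1.mul_left 32)
    fun k => norm_convTerm_le u v l k i

theorem norm_tsum_convTerm_le {u v : (Fin n → ℤ) → Fin 3 → ℂ} (hu : H1Seq u)
    (hv : Summable fun k => vsq (v k)) (l : Fin n → ℤ) (i : Fin 3) :
    ‖∑' k, convTerm u v l k i‖ ≤ 32 * (√(s1 u) * √(s0 v)) := by
  have h := summable_convTerm_and_tsum_le hu hv l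
  refine (tsum_of_norm_bounded (h.1.mul_left 32).hasSum
    fun k => norm_convTerm_le u v l k i).trans ?_
  rw [tsum_mul_left]
  exact mul_le_mul_of_nonneg_left h.2 (by norm_num)

theorem triad_eq_sum_convTerm (w b : (Fin n → ℤ) → Fin 3 → ℂ) (k l : Fin n → ℤ) :
    triad w b k l
      = ∑ i, (convTerm w b (-l) k i + convTerm b w (-l) (-l - k) i) * potential w l i := by
  rw [triad, dotProduct]
  refine Finset.sum_congr rfl fun i _ => ?_
  rw [convTerm, convTerm, Pi.add_apply]
  rw [show -l - (-l - k) = k by abel, show -l - k = -k - l by abel]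

/-- Polarization: the difference of the nonlinear terms of two solutions, tested against the
vector potential of the difference `w`, is a sum of interaction coefficients of `w`. -/
theorem hasSum_triad {u₁ u₂ : (Fin n → ℤ) → Fin 3 → ℂ} (h₁ : H1Seq u₁) (h₂ : H1Seq u₂)
    (l : Fin n → ℤ) :
    HasSum (fun k => (triad (u₁ - u₂) u₁ k l + triad (u₁ - u₂) u₂ k l) / 2)
      (∑ i, (∑' k, convTerm u₁ u₁ (-l) k i - ∑' k, convTerm u₂ u₂ (-l) k i)
        * potential (u₁ - u₂) l i) := by
  set w := u₁ - u₂ with hw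
  have hwH : H1Seq w := h₁.sub h₂
  have a : ∀ {u v : (Fin n → ℤ) → Fin 3 → ℂ}, H1Seq u → H1Seq v → ∀ i,
      HasSum (fun k => convTerm u v (-l) k i) (∑' k, convTerm u v (-l) k i) := fun hu hv i =>
    (summable_convTerm hu hv.summable0 (-l) i).hasSum
  have b : ∀ {u v : (Fin n → ℤ) → Fin 3 → ℂ}, H1Seq u → H1Seq v → ∀ i,
      HasSum (fun k => convTerm u v (-l) (-l - k) i) (∑' k, convTerm u v (-l) k i) := fun hu hv i =>
    (Equiv.subLeft (-l)).hasSum_iff.mpr (a hu hv i)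
  have key : ∀ i, ∑' k, convTerm u₁ u₁ (-l) k i - ∑' k, convTerm u₂ u₂ (-l) k i
      = ((∑' k, convTerm w u₁ (-l) k i + ∑' k, convTerm u₁ w (-l) k i)
        + (∑' k, convTerm w u₂ (-l) k i + ∑' k, convTerm u₂ w (-l) k i)) / 2 := by
    intro i
    have c1 := (a h₁ h₁ i).sub (a h₂ h₂ i)
    have c2 := (((a hwH h₁ i).add (a h₁ hwH i)).add ((a hwH h₂ i).add (a h₂ hwH i))).div_const 2
    refine c1.unique (c2.congr_fun fun k => ?_)
    simp only [convTerm, hw, Pi.sub_apply, cross_apply]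
    fin_cases i <;> simp <;> ring
  have h := hasSum_sum (s := Finset.univ) (f := fun (i : Fin 3) k =>
      ((convTerm w u₁ (-l) k i + convTerm u₁ w (-l) (-l - k) i)
        + (convTerm w u₂ (-l) k i + convTerm u₂ w (-l) (-l - k) i)) / 2 * potential w l i)
    fun i _ => ((((a hwH h₁ i).add (b h₁ hwH i)).add ((a hwH h₂ i).add
      (b h₂ hwH i))).div_const 2).mul_right (potential w l i)
  simp_rw [key]
  refine h.congr_fun fun k => ?_
  rw [triad_eq_sum_convTerm, triad_eq_sum_convTerm, ← Finset.sum_add_distrib, Finset.sum_div]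
  refine Finset.sum_congr rfl fun i _ => ?_
  ring

/-- `∑_{l ≠ 0} |l|⁻⁴`, the constant in the embedding `H² ⊂ L^∞`; the term at `l = 0` is `0⁻¹ = 0`. -/
def zeta4 (n : ℕ) : ℝ := ∑' l : Fin n → ℤ, ((ksq l : ℝ)⁻¹) ^ 2

/-- The lattice sum converges because `n < 4`. -/
theorem summable_ksq_inv_sq (hn : n ≤ 3) :
    Summable fun l : Fin n → ℤ => ((ksq l : ℝ)⁻¹) ^ 2 := by
  set B := Pi.basisFun ℝ (Fin n)
  set L := Submodule.span ℤ (Set.range B)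
  have hrank : Module.finrank ℤ L < 4 := by
    rw [Module.finrank_eq_card_basis (B.restrictScalars ℤ), Fintype.card_fin]
    lia
  have hmem : ∀ k : Fin n → ℤ, (fun i => (k i : ℝ)) ∈ L := fun k => by
    have : (fun i => (k i : ℝ)) = ∑ i, k i • B i := by
      funext j
      simp [B, Finset.sum_apply, Pi.single_apply]
    rw [this]
    exact Submodule.sum_mem _ fun i _ => Submodule.smul_mem _ _ (Submodule.subset_span ⟨i, rfl⟩)
  have hinj : Function.Injective fun k : Fin n → ℤ => (⟨fun i => (k i : ℝ), hmem k⟩ : L) := by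
    intro k l h
    have h2 := congrArg Subtype.val h
    funext i
    have : (k i : ℝ) = l i := congrFun h2 i
    exact_mod_cast this
  have h := (ZLattice.summable_norm_pow_inv L 4 hrank).comp_injective hinj
  refine Summable.of_nonneg_of_le (fun k => by positivity) (fun k => ?_) h
  simp only [Function.comp, Submodule.coe_norm]
  set v : Fin n → ℝ := fun i => (k i : ℝ) with hv
  rcases eq_or_ne k 0 with rfl | hk
  · simp [ksq_zero]
  have hv0 : 0 < ‖v‖ := by
    rw [norm_pos_iff]
    intro h0
    apply hk
    funext i
    have := congrFun h0 i
    simpa [hv] using this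
  have hle : ‖v‖ ≤ √(ksq k) :=
    (pi_norm_le_iff_of_nonneg (Real.sqrt_nonneg _)).mpr fun i => abs_le_sqrt_ksq k i
  have hle2 : ‖v‖ ^ 2 ≤ ksq k := by
    calc ‖v‖ ^ 2 ≤ √(ksq k) ^ 2 := pow_le_pow_left₀ hv0.le hle 2
      _ = _ := Real.sq_sqrt (by positivity)
  calc ((ksq k : ℝ)⁻¹) ^ 2 ≤ ((‖v‖ ^ 2)⁻¹) ^ 2 :=
        pow_le_pow_left₀ (by positivity) (inv_anti₀ (by positivity) hle2) 2
    _ = _ := by rw [inv_pow, inv_pow, ← pow_mul]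

theorem summable_potential_and_tsum_le (hn : n ≤ 3) {w : (Fin n → ℤ) → Fin 3 → ℂ}
    (hw : H1Seq w) (i : Fin 3) :
    Summable (fun l => ‖potential w l i‖) ∧
      ∑' l, ‖potential w l i‖ ≤ √(zeta4 n) * √(s1 w) := by
  have e1 : ∀ k, √((ksq k : ℝ) * vsq (w k)) ^ 2 = (ksq k : ℝ) * vsq (w k) := fun k =>
    Real.sq_sqrt (mul_nonneg (by positivity) (vsq_nonneg _))
  have h := summable_mul_and_tsum_le (x := fun k => (ksq k : ℝ)⁻¹)
    (y := fun k => √((ksq k : ℝ) * vsq (w k))) (fun _ => by positivity)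
    (fun _ => Real.sqrt_nonneg _) (summable_ksq_inv_sq hn)
    (by simp_rw [e1]; exact hw.summable1)
  simp_rw [e1] at h
  have hle : ∀ l, ‖potential w l i‖ ≤ (ksq l : ℝ)⁻¹ * √((ksq l : ℝ) * vsq (w l)) := by
    intro l
    rcases eq_or_ne l 0 with rfl | hl
    · simp [potential, ksq_zero]
    have hl1 := one_le_ksq hl
    have hs : 0 < √(ksq l : ℝ) := Real.sqrt_pos.mpr (by linarith)
    have hm := norm_potential_mul_le w l i
    rw [Real.sqrt_mul (by linarith), ← div_eq_inv_mul, le_div_iff₀ (by linarith)]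
    calc ‖potential w l i‖ * (ksq l : ℝ)
        = √(ksq l) * (√(ksq l) * ‖potential w l i‖) := by
          rw [← mul_assoc, Real.mul_self_sqrt (by linarith), mul_comm]
      _ ≤ _ := mul_le_mul_of_nonneg_left hm hs.le
  refine ⟨Summable.of_nonneg_of_le (fun l => norm_nonneg _) hle h.1, ?_⟩
  exact (Summable.tsum_le_tsum hle
    (Summable.of_nonneg_of_le (fun l => norm_nonneg _) hle h.1) h.1).trans h.2

/-- The trilinear form of three fields in `H¹` converges absolutely, since the vector potential has
absolutely summable Fourier coefficients in dimension at most three. -/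
theorem summable_triad_prod (hn : n ≤ 3) {w b : (Fin n → ℤ) → Fin 3 → ℂ}
    (hw : H1Seq w) (hb : H1Seq b) :
    Summable fun p : (Fin n → ℤ) × (Fin n → ℤ) => triad w b p.2 p.1 := by
  set x : (Fin n → ℤ) → (Fin n → ℤ) → ℝ := fun l k =>
    √((ksq k : ℝ) * vsq (w k)) * √(vsq (b (-l - k))) with hx
  set y : (Fin n → ℤ) → (Fin n → ℤ) → ℝ := fun l k =>
    √((ksq k : ℝ) * vsq (b k)) * √(vsq (w (-l - k))) with hy
  have sx := fun l => summable_convTerm_and_tsum_le hw hb.summable0 (-l)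
  have sy := fun l => summable_convTerm_and_tsum_le hb hw.summable0 (-l)
  have sy' : ∀ l, Summable (fun k => y l (-l - k)) := fun l =>
    (Equiv.subLeft (-l)).summable_iff.mpr (sy l).1
  have ty' : ∀ l, ∑' k, y l (-l - k) = ∑' k, y l k := fun l =>
    (Equiv.subLeft (-l)).tsum_eq (y l)
  set Q := √(s1 w) * √(s0 b) + √(s1 b) * √(s0 w) with hQ
  have hpt : ∀ k l, ‖triad w b k l‖
      ≤ (∑ i, ‖potential w l i‖) * (32 * (x l k + y l (-l - k))) := by
    intro k l
    rw [triad_eq_sum_convTerm, Finset.sum_mul]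
    refine (norm_sum_le _ _).trans (Finset.sum_le_sum fun i _ => ?_)
    rw [norm_mul, mul_comm]
    refine mul_le_mul_of_nonneg_left ?_ (norm_nonneg _)
    refine (norm_add_le _ _).trans ?_
    rw [mul_add]
    exact add_le_add (norm_convTerm_le w b (-l) k i) (norm_convTerm_le b w (-l) (-l - k) i)
  have hrow : ∀ l, Summable fun k =>
      (∑ i, ‖potential w l i‖) * (32 * (x l k + y l (-l - k))) := fun l =>
    (((sx l).1.add (sy' l)).mul_left 32).mul_left _
  have hrowt : ∀ l, ∑' k, (∑ i, ‖potential w l i‖) * (32 * (x l k + y l (-l - k)))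
      ≤ (∑ i, ‖potential w l i‖) * (32 * Q) := by
    intro l
    rw [tsum_mul_left, tsum_mul_left, Summable.tsum_add (sx l).1 (sy' l), ty']
    refine mul_le_mul_of_nonneg_left (mul_le_mul_of_nonneg_left
      (add_le_add (sx l).2 (sy l).2) (by norm_num)) ?_
    exact Finset.sum_nonneg fun _ _ => norm_nonneg _
  refine Summable.of_norm_bounded (g := fun p : (Fin n → ℤ) × (Fin n → ℤ) =>
    (∑ i, ‖potential w p.1 i‖) * (32 * (x p.1 p.2 + y p.1 (-p.1 - p.2)))) ?_
    fun p => hpt p.2 p.1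
  have hnn : ∀ l k, 0 ≤ (∑ i, ‖potential w l i‖) * (32 * (x l k + y l (-l - k))) := by
    intro l k
    have : 0 ≤ ∑ i, ‖potential w l i‖ := Finset.sum_nonneg fun _ _ => norm_nonneg _
    have h1 : 0 ≤ x l k := by positivity
    have h2 : 0 ≤ y l (-l - k) := by positivity
    positivity
  rw [summable_prod_of_nonneg fun p => hnn p.1 p.2]
  refine ⟨hrow, ?_⟩
  refine Summable.of_nonneg_of_le (fun l => tsum_nonneg fun k => hnn l k) hrowt ?_
  exact (summable_sum fun i _ => (summable_potential_and_tsum_le hn hw i).1).mul_right _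

theorem box_mono : Monotone (box n) := fun N M h k hk => by
  rw [mem_box] at hk ⊢
  intro i
  have : (N : ℤ) ≤ M := by exact_mod_cast h
  exact (hk i).trans this

theorem tendsto_box_atTop : Tendsto (box n) atTop atTop := by
  refine tendsto_atTop_finset_of_monotone ?_ ?_
  · exact box_mono
  · intro k
    refine ⟨∑ i, (k i).natAbs, ?_⟩
    rw [mem_box]
    intro i
    have := Finset.single_le_sum (f := fun i => (k i).natAbs) (fun _ _ => Nat.zero_le _)
      (Finset.mem_univ i)
    rw [Int.abs_eq_natAbs]
    exact_mod_cast this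

/-- The energy balance produces the sums with `k` unrestricted, while the estimate of the trilinear
form concerns finite sums in both variables; they have the same limit. -/
theorem tendsto_sum_box_triad (hn : n ≤ 3) {w b : (Fin n → ℤ) → Fin 3 → ℂ}
    (hw : H1Seq w) (hb : H1Seq b) :
    Tendsto (fun N => ∑ l ∈ box n N, ∑' k, triad w b k l) atTop
        (𝓝 (∑' p : (Fin n → ℤ) × (Fin n → ℤ), triad w b p.2 p.1)) ∧
      Tendsto (fun N => ∑ k ∈ box n N, ∑ l ∈ box n N, triad w b k l) atTop
        (𝓝 (∑' p : (Fin n → ℤ) × (Fin n → ℤ), triad w b p.2 p.1)) := by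
  have hs := summable_triad_prod hn hw hb
  constructor
  · have h := hs.hasSum.prod_fiberwise fun l => (hs.prod_factor l).hasSum
    exact h.comp tendsto_box_atTop
  · have ht : Tendsto (fun N => box n N ×ˢ box n N) atTop atTop := by
      refine tendsto_atTop_finset_of_monotone (fun N M h => ?_) fun p => ?_
      · exact Finset.product_subset_product (box_mono h) (box_mono h)
      · obtain ⟨N, hN⟩ := (tendsto_box_atTop.eventually (eventually_ge_atTop {p.1, p.2})).exists
        refine ⟨N, Finset.mem_product.mpr ⟨hN (by simp), hN (by simp)⟩⟩
    have h := hs.hasSum.comp ht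
    refine h.congr fun N => ?_
    simp only [Function.comp]
    rw [Finset.sum_product, Finset.sum_comm]

/-! ### Weak solutions on the Fourier side -/

theorem eLpNorm_two_sq {E : Type*} [NormedAddCommGroup E] {f : Torus n → E}
    (hf : MemLp f 2 (torusMeasure n)) :
    eLpNorm f 2 (torusMeasure n) ^ 2 = ENNReal.ofReal (∫ x, ‖f x‖ ^ 2 ∂(torusMeasure n)) := by
  have hI : 0 ≤ ∫ x, ‖f x‖ ^ 2 ∂(torusMeasure n) := integral_nonneg fun x => by positivity
  rw [hf.eLpNorm_eq_integral_rpow_norm (by norm_num) (by norm_num)]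
  rw [← ENNReal.ofReal_pow (by positivity)]
  congr 1
  simp only [ENNReal.toReal_ofNat, Real.rpow_ofNat]
  rw [← Real.rpow_natCast, ← Real.rpow_mul hI]
  norm_num

theorem hasSum_vsq_vcoef {f : Torus n → V3} (hf : MemLp f 2 (torusMeasure n)) :
    HasSum (fun k => vsq (vcoef f k)) (∫ x, ‖f x‖ ^ 2 ∂(torusMeasure n)) := by
  have h := hasSum_sum (s := Finset.univ) fun (a : Fin 3) _ => hasSum_sq_fcoef (memLp_apply hf a)
  have e : ∫ x, ‖f x‖ ^ 2 ∂(torusMeasure n) = ∑ a : Fin 3, ∫ x, f x a ^ 2 ∂(torusMeasure n) := by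
    rw [← integral_finsetSum (f := fun a x => f x a ^ 2) Finset.univ
      fun a _ => (memLp_apply hf a).integrable_sq]
    refine integral_congr_ae (ae_of_all _ fun x => ?_)
    simp [EuclideanSpace.norm_sq_eq]
  rw [e]
  exact h

theorem s0_vcoef_le {f : Torus n → V3} (hf : MemLp f 2 (torusMeasure n)) {M : NNReal}
    (hM : eLpNorm f 2 (torusMeasure n) ≤ M) : s0 (vcoef f) ≤ (M : ℝ) ^ 2 := by
  rw [s0, (hasSum_vsq_vcoef hf).tsum_eq]
  have h := pow_le_pow_left₀ (by positivity) hM 2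
  rw [eLpNorm_two_sq hf, ← ENNReal.coe_pow, ENNReal.ofReal_le_coe] at h
  exact_mod_cast h

theorem hasSum_ksq_mul_vsq {f : Torus n → V3} (hH : ∀ a, MemH1 fun x => f x a) :
    HasSum (fun k => 4 * Real.pi ^ 2 * ((ksq k : ℝ) * vsq (vcoef f k)))
      (∑ j, ∑ a, ∫ x, weakPartial j (fun x => f x a) x ^ 2 ∂(torusMeasure n)) := by
  have h := hasSum_sum (s := Finset.univ) fun (j : Fin n) _ =>
    hasSum_sum (s := Finset.univ) fun (a : Fin 3) _ =>
      hasSum_sq_fcoef (weakPartial_spec (hH a) j).1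
  refine h.congr_fun fun k => ?_
  rw [ksq_cast, Finset.sum_mul, Finset.mul_sum]
  refine Finset.sum_congr rfl fun j _ => ?_
  rw [vsq, Finset.mul_sum, Finset.mul_sum]
  refine Finset.sum_congr rfl fun a _ => ?_
  rw [(weakPartial_spec (hH a) j).2 k, norm_mul, norm_mul, norm_twoPiI, Complex.norm_intCast,
    mul_pow, mul_pow, sq_abs, vcoef]
  ring

theorem h1Seq_vcoef {f : Torus n → V3} (hf : MemLp f 2 (torusMeasure n))
    (hH : ∀ a, MemH1 fun x => f x a) : H1Seq (vcoef f) := by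
  refine ⟨(hasSum_vsq_vcoef hf).summable, ?_⟩
  have h := (hasSum_ksq_mul_vsq hH).summable
  have hpi : (4 * Real.pi ^ 2 : ℝ) ≠ 0 := by positivity
  exact (summable_mul_left_iff hpi).mp h

theorem ofReal_s1_le_gradEnergy {f : Torus n → V3} (hH : ∀ a, MemH1 fun x => f x a) :
    ENNReal.ofReal (s1 (vcoef f)) ≤ gradEnergy f := by
  have h := (hasSum_ksq_mul_vsq hH).tsum_eq
  rw [tsum_mul_left] at h
  have hs : s1 (vcoef f) ≤ ∑ j, ∑ a, ∫ x, weakPartial j (fun x => f x a) x ^ 2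
      ∂(torusMeasure n) := by
    rw [← h]
    have h1 := s1_nonneg (vcoef f)
    have h2 : (1 : ℝ) ≤ 4 * Real.pi ^ 2 := by nlinarith [Real.pi_gt_three]
    rw [s1] at h1 ⊢
    nlinarith
  refine (ENNReal.ofReal_le_ofReal hs).trans (le_of_eq ?_)
  rw [gradEnergy, ENNReal.ofReal_sum_of_nonneg fun j _ => Finset.sum_nonneg fun a _ =>
    integral_nonneg fun x => by positivity]
  refine Finset.sum_congr rfl fun j _ => ?_
  rw [ENNReal.ofReal_sum_of_nonneg fun a _ => integral_nonneg fun x => by positivity]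
  refine Finset.sum_congr rfl fun a _ => ?_
  rw [eLpNorm_two_sq (weakPartial_spec (hH a) j).1]
  simp

/-- The Hall term `(∇ × f) × f`. -/
def hall (f : Torus n → V3) (x : Torus n) : Fin 3 → ℝ := weakCurl f x ⨯₃ (f x).ofLp

theorem weakCurl_spec {f : Torus n → V3} (hH : ∀ a, MemH1 fun x => f x a) (i : Fin 3) :
    MemLp (fun x => weakCurl f x i) 2 (torusMeasure n) ∧
      ∀ k, fcoef (fun x => weakCurl f x i) k = (twoPiI • (emb k ⨯₃ vcoef f k)) i := by
  have h := fun a c => weakPartial3_spec (hH c) a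
  have key : ∀ a c a' c' : Fin 3,
      MemLp (fun x => weakPartial3 a (fun y => f y c) x - weakPartial3 a' (fun y => f y c') x) 2
        (torusMeasure n) ∧ ∀ k, fcoef (fun x => weakPartial3 a (fun y => f y c) x
          - weakPartial3 a' (fun y => f y c') x) k
          = twoPiI * (emb k a * vcoef f k c - emb k a' * vcoef f k c') := by
    intro a c a' c'
    refine ⟨(h a c).1.sub (h a' c').1, fun k => ?_⟩
    rw [fcoef_sub (h a c).1 (h a' c').1, (h a c).2, (h a' c').2]
    simp only [vcoef]
    ring
  simp only [cross_apply]
  fin_cases i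
  · exact key 1 2 2 1
  · exact key 2 0 0 2
  · exact key 0 1 1 0

/-- The Hall term is integrable, and the convolution theorem gives its Fourier coefficients. -/
theorem hall_spec {f : Torus n → V3} (hf : MemLp f 2 (torusMeasure n))
    (hH : ∀ a, MemH1 fun x => f x a) (i : Fin 3) :
    Integrable (fun x => hall f x i) (torusMeasure n) ∧
      ∀ l, HasSum (fun k => convTerm (vcoef f) (vcoef f) l k i)
        (fcoef (fun x => hall f x i) l) := by
  have hC := weakCurl_spec hH
  have hb := memLp_apply hf
  have key : ∀ a c a' c' : Fin 3,
      Integrable (fun x => weakCurl f x a * f x c - weakCurl f x a' * f x c') (torusMeasure n) ∧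
      ∀ l, HasSum (fun k => (twoPiI • (emb k ⨯₃ vcoef f k)) a * vcoef f (l - k) c
          - (twoPiI • (emb k ⨯₃ vcoef f k)) a' * vcoef f (l - k) c')
        (fcoef (fun x => weakCurl f x a * f x c - weakCurl f x a' * f x c') l) := by
    intro a c a' c'
    have i1 : Integrable (fun x => weakCurl f x a * f x c) (torusMeasure n) :=
      (hC a).1.integrable_mul (hb c)
    have i2 : Integrable (fun x => weakCurl f x a' * f x c') (torusMeasure n) :=
      (hC a').1.integrable_mul (hb c')
    refine ⟨i1.sub i2, fun l => ?_⟩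
    have h := (hasSum_fcoef_mul (hC a).1 (hb c) l).sub (hasSum_fcoef_mul (hC a').1 (hb c') l)
    simp only [(hC a).2, (hC a').2] at h
    have e : fcoef (fun x => weakCurl f x a * f x c - weakCurl f x a' * f x c') l
        = fcoef (fun x => weakCurl f x a * f x c) l
          - fcoef (fun x => weakCurl f x a' * f x c') l := by
      have hi : ∀ {u : Torus n → ℝ}, Integrable u (torusMeasure n) →
          Integrable (fun x => mFourier (-l) x * (u x : ℂ)) (torusMeasure n) := fun hu =>
        Integrable.bdd_mul (c := 1) hu.ofReal
          (continuous_mFourier (-l)).aestronglyMeasurable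
          (ae_of_all _ fun x => (norm_mFourier_apply _ _).le)
      rw [fcoef_eq, fcoef_eq, fcoef_eq, ← integral_sub (hi i1) (hi i2)]
      simp_rw [Complex.ofReal_sub, mul_sub]
    rw [e]
    exact h
  unfold hall convTerm
  simp only [cross_apply]
  fin_cases i
  · exact key 1 2 2 1
  · exact key 2 0 0 2
  · exact key 0 1 1 0

/-- The Fourier coefficients of `∇ × ((∇ × f) × f)`. -/
def nonlin (f : Torus n → V3) (k : Fin n → ℤ) : Fin 3 → ℂ :=
  twoPiI • (emb k ⨯₃ fun i => fcoef (fun x => hall f x i) k)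

theorem integral_dot_single {f : Torus n → V3} (hf : MemLp f 2 (torusMeasure n)) (c : ℂ)
    (k : Fin n → ℤ) (a : Fin 3) :
    ∫ x, (f x).ofLp ⬝ᵥ (reTrig c (-k) x • EuclideanSpace.single a (1 : ℝ) : V3).ofLp
      ∂(torusMeasure n) = (c * vcoef f k a).re := by
  have e : ∀ x, (f x).ofLp ⬝ᵥ (reTrig c (-k) x • EuclideanSpace.single a (1 : ℝ) : V3).ofLp
      = f x a * reTrig c (-k) x := fun x => by
    simp [dotProduct]
  simp_rw [e]
  exact integral_mul_reTrig (integrable_of_memLp (memLp_apply hf a)) c k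

/-- Tests against `Re (c e^{-2πi k·x}) e_a` for all `c ∈ ℂ` read off the `k`-th Fourier coefficient. -/
theorem integral_hall_dot_curl {f : Torus n → V3} (hf : MemLp f 2 (torusMeasure n))
    (hH : ∀ a, MemH1 fun x => f x a) (c : ℂ) (k : Fin n → ℤ) (a : Fin 3) :
    ∫ x, (weakCurl f x ⨯₃ (f x).ofLp) ⬝ᵥ
        curl (fun y : Torus n => reTrig c (-k) y • EuclideanSpace.single a (1 : ℝ)) x
        ∂(torusMeasure n) = (c * nonlin f k a).re := by
  have hi := fun i => (hall_spec hf hH i).1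
  have e : ∀ x, (weakCurl f x ⨯₃ (f x).ofLp) ⬝ᵥ
        curl (fun y : Torus n => reTrig c (-k) y • EuclideanSpace.single a (1 : ℝ)) x
      = ∑ i, hall f x i * reTrig (twoPiI * c * (emb (-k) ⨯₃
          fun b => ((EuclideanSpace.single a (1 : ℝ) : V3) b : ℂ)) i) (-k) x := fun x => by
    rw [dotProduct]
    refine Finset.sum_congr rfl fun i _ => ?_
    rw [curl_reTrig_smul, hall]
  simp_rw [e]
  rw [integral_finsetSum _ fun i _ => integrable_mul_reTrig (hi i) _ _]
  simp_rw [integral_mul_reTrig (hi _)]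
  rw [← Complex.re_sum]
  congr 1
  rw [nonlin, emb_neg]
  fin_cases a <;> simp [cross_apply, Fin.sum_univ_three] <;> ring

theorem integral_dot_laplacian {f : Torus n → V3} (hf : MemLp f 2 (torusMeasure n)) (c : ℂ)
    (k : Fin n → ℤ) (a : Fin 3) :
    ∫ x, (f x).ofLp ⬝ᵥ (laplacian (fun y : Torus n => reTrig c (-k) y •
        (EuclideanSpace.single a (1 : ℝ) : V3)) x).ofLp ∂(torusMeasure n)
      = (c * (-(4 * Real.pi ^ 2 * (ksq k : ℝ)) * vcoef f k a)).re := by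
  simp_rw [laplacian_reTrig_smul]
  rw [integral_dot_single hf, ksq_neg]
  congr 1
  ring

variable {μ : ℝ} {b : ℝ → Torus n → V3}

theorem IsWeakSolution.continuousOn_vcoef (hb : IsWeakSolution μ b) (k : Fin n → ℤ) (a : Fin 3) :
    ContinuousOn (fun t => vcoef (b t) k a) (Ici 0) := by
  have h : ∀ c : ℂ, ContinuousOn (fun t => (c * vcoef (b t) k a).re) (Ici 0) := by
    intro c
    have hφ : MemLp (fun x : Torus n => (reTrig c (-k) x • EuclideanSpace.single a (1 : ℝ) : V3)) 2
        (torusMeasure n) :=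
      memLp_of_continuous ((continuous_reTrig c (-k)).smul continuous_const) 2
    refine (hb.weakCont _ hφ).congr fun t ht => ?_
    exact (integral_dot_single (hb.memL2 t ht) c k a).symm
  have h1 : ContinuousOn (fun t => (vcoef (b t) k a).re) (Ici 0) := by simpa using h 1
  have h2 : ContinuousOn (fun t => (vcoef (b t) k a).im) (Ici 0) := by simpa using h (-Complex.I)
  have h3 := (Complex.continuous_ofReal.comp_continuousOn h1).add
    ((Complex.continuous_ofReal.comp_continuousOn h2).mul_const Complex.I)
  refine h3.congr fun t _ => ?_
  simp [Complex.re_add_im]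

theorem IsWeakSolution.continuousOn_vcoef' (hb : IsWeakSolution μ b) (k : Fin n → ℤ) :
    ContinuousOn (fun t => vcoef (b t) k) (Ici 0) :=
  continuousOn_pi.mpr fun a => hb.continuousOn_vcoef k a

theorem IsWeakSolution.ae_h1Seq (hb : IsWeakSolution μ b) :
    ∀ᵐ t ∂(volume.restrict (Ioi (0 : ℝ))), H1Seq (vcoef (b t)) := by
  filter_upwards [hb.memH1, ae_restrict_mem measurableSet_Ioi] with t ht h0
  exact h1Seq_vcoef (hb.memL2 t (le_of_lt h0)) ht

theorem continuous_vsq : Continuous vsq := by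
  unfold vsq
  fun_prop

theorem aestronglyMeasurable_tsum {E : Type*} [NormedAddCommGroup E] [CompleteSpace E]
    {ν : Measure ℝ} {f : ℝ → (Fin n → ℤ) → E} {g : ℝ → E}
    (hf : ∀ k, AEStronglyMeasurable (fun t => f t k) ν) (hg : ∀ᵐ t ∂ν, HasSum (f t) (g t)) :
    AEStronglyMeasurable g ν := by
  refine aestronglyMeasurable_of_tendsto_ae (atTop : Filter (Finset (Fin n → ℤ)))
    (f := fun s t => ∑ k ∈ s, f t k) (fun s => ?_) ?_
  · exact Finset.aestronglyMeasurable_fun_sum s fun k _ => hf k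
  · filter_upwards [hg] with t ht
    exact ht

theorem IsWeakSolution.aestronglyMeasurable_vcoef (hb : IsWeakSolution μ b) (k : Fin n → ℤ) :
    AEStronglyMeasurable (fun t => vcoef (b t) k) (volume.restrict (Ioi (0 : ℝ))) :=
  ((hb.continuousOn_vcoef' k).mono Ioi_subset_Ici_self).aestronglyMeasurable measurableSet_Ioi

theorem IsWeakSolution.aestronglyMeasurable_s1 (hb : IsWeakSolution μ b) :
    AEStronglyMeasurable (fun t => s1 (vcoef (b t))) (volume.restrict (Ioi (0 : ℝ))) := by
  refine aestronglyMeasurable_tsum (f := fun t k => (ksq k : ℝ) * vsq (vcoef (b t) k))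
    (fun k => ?_) ?_
  · exact (continuous_vsq.comp_aestronglyMeasurable (hb.aestronglyMeasurable_vcoef k)).const_mul _
  · filter_upwards [hb.ae_h1Seq] with t ht
    exact ht.summable1.hasSum

theorem IsWeakSolution.integrableOn_s1 (hb : IsWeakSolution μ b) {T : ℝ} (hT : 0 < T) :
    IntegrableOn (fun t => s1 (vcoef (b t))) (Ioo 0 T) := by
  have hsub : volume.restrict (Ioo 0 T) ≤ volume.restrict (Ioi (0 : ℝ)) :=
    Measure.restrict_mono Ioo_subset_Ioi_self le_rfl
  refine ⟨hb.aestronglyMeasurable_s1.mono_measure hsub, ?_⟩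
  rw [hasFiniteIntegral_iff_ofReal (ae_of_all _ fun t => s1_nonneg _)]
  refine lt_of_le_of_lt (lintegral_mono_ae ?_) (hb.dissipation T hT)
  filter_upwards [ae_mono hsub hb.memH1] with t ht
  exact ofReal_s1_le_gradEnergy ht

/-- The `l`-th Fourier coefficient of the Hall term, in terms of those of the field. -/
def hallCoef (u : (Fin n → ℤ) → Fin 3 → ℂ) (l : Fin n → ℤ) : Fin 3 → ℂ :=
  fun i => ∑' k, convTerm u u l k i

theorem nonlin_eq {f : Torus n → V3} (hf : MemLp f 2 (torusMeasure n))
    (hH : ∀ a, MemH1 fun x => f x a) (k : Fin n → ℤ) :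
    nonlin f k = twoPiI • (emb k ⨯₃ hallCoef (vcoef f) k) := by
  rw [nonlin]
  congr 2
  funext i
  exact ((hall_spec hf hH i).2 k).tsum_eq.symm

theorem norm_hallCoef_le {u : (Fin n → ℤ) → Fin 3 → ℂ} (hu : H1Seq u) (l : Fin n → ℤ)
    (i : Fin 3) : ‖hallCoef u l i‖ ≤ 32 * (√(s1 u) * √(s0 u)) :=
  norm_tsum_convTerm_le hu hu.summable0 l i

theorem IsWeakSolution.aestronglyMeasurable_hallCoef (hb : IsWeakSolution μ b) (l : Fin n → ℤ)
    (i : Fin 3) : AEStronglyMeasurable (fun t => hallCoef (vcoef (b t)) l i)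
      (volume.restrict (Ioi (0 : ℝ))) := by
  refine aestronglyMeasurable_tsum (f := fun t k => convTerm (vcoef (b t)) (vcoef (b t)) l k i)
    (fun k => ?_) ?_
  · have hc : ∀ k a, ContinuousOn (fun t => vcoef (b t) k a) (Ioi 0) := fun k a =>
      (hb.continuousOn_vcoef k a).mono Ioi_subset_Ici_self
    refine ContinuousOn.aestronglyMeasurable ?_ measurableSet_Ioi
    simp only [convTerm, cross_apply]
    fin_cases i <;> simp <;> fun_prop (disch := assumption)
  · filter_upwards [hb.ae_h1Seq] with t ht
    exact (summable_convTerm ht ht.summable0 l i).hasSum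

/-! ### The evolution of single Fourier modes -/

/-- The right-hand side of the equation `û' = -4π²μ|k|² û - 2πi k × F̂` for the `k`-th Fourier mode,
where `F` is the Hall term. -/
def evol (μ : ℝ) (u : (Fin n → ℤ) → Fin 3 → ℂ) (k : Fin n → ℤ) (a : Fin 3) : ℂ :=
  -(4 * Real.pi ^ 2 * (ksq k : ℝ)) * μ * u k a - (twoPiI • (emb k ⨯₃ hallCoef u k)) a

theorem IsWeakSolution.exists_s0_le (hb : IsWeakSolution μ b) :
    ∃ M : ℝ, 0 ≤ M ∧ ∀ t, 0 ≤ t → s0 (vcoef (b t)) ≤ M ^ 2 := by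
  obtain ⟨M, hM⟩ := hb.bounded
  exact ⟨M, M.2, fun t ht => s0_vcoef_le (hb.memL2 t ht) (hM t ht)⟩

theorem restrict_Ioc_le (s t : ℝ) (hs : 0 ≤ s) :
    volume.restrict (Ioc s t) ≤ volume.restrict (Ioi (0 : ℝ)) :=
  Measure.restrict_mono (fun _ hx => lt_of_le_of_lt hs hx.1) le_rfl

theorem IsWeakSolution.intervalIntegrable_s1 (hb : IsWeakSolution μ b) {s t : ℝ} (hs : 0 ≤ s)
    (hst : s ≤ t) : IntervalIntegrable (fun t => s1 (vcoef (b t))) volume s t := by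
  rw [intervalIntegrable_iff_integrableOn_Ioc_of_le hst]
  refine (hb.integrableOn_s1 (T := t + 1) (by linarith)).mono_set fun x hx => ?_
  exact ⟨lt_of_le_of_lt hs hx.1, by linarith [hx.2]⟩

theorem IsWeakSolution.intervalIntegrable_hallCoef (hb : IsWeakSolution μ b) {s t : ℝ}
    (hs : 0 ≤ s) (hst : s ≤ t) (l : Fin n → ℤ) (i : Fin 3) :
    IntervalIntegrable (fun t => hallCoef (vcoef (b t)) l i) volume s t := by
  obtain ⟨M, hM0, hM⟩ := hb.exists_s0_le
  have hsub := restrict_Ioc_le s t hs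
  have hdom : IntervalIntegrable (fun t => 32 * M * (1 + s1 (vcoef (b t)))) volume s t :=
    (intervalIntegrable_const.add (hb.intervalIntegrable_s1 hs hst)).const_mul _
  rw [intervalIntegrable_iff_integrableOn_Ioc_of_le hst] at hdom ⊢
  refine Integrable.mono' hdom ((hb.aestronglyMeasurable_hallCoef l i).mono_measure hsub) ?_
  filter_upwards [ae_mono hsub hb.ae_h1Seq, ae_restrict_mem measurableSet_Ioc] with τ hτ hmem
  have h1 : √(s0 (vcoef (b τ))) ≤ M :=
    Real.sqrt_le_iff.mpr ⟨hM0, hM τ (hs.trans hmem.1.le)⟩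
  have h2 : √(s1 (vcoef (b τ))) ≤ 1 + s1 (vcoef (b τ)) := by
    rw [Real.sqrt_le_iff]
    constructor <;> nlinarith [s1_nonneg (vcoef (b τ))]
  calc _ ≤ 32 * (√(s1 (vcoef (b τ))) * √(s0 (vcoef (b τ)))) := norm_hallCoef_le hτ l i
    _ ≤ 32 * ((1 + s1 (vcoef (b τ))) * M) := by
        have := s1_nonneg (vcoef (b τ))
        gcongr
    _ = _ := by ring

theorem IsWeakSolution.intervalIntegrable_vcoef (hb : IsWeakSolution μ b) {s t : ℝ}
    (hs : 0 ≤ s) (hst : s ≤ t) (k : Fin n → ℤ) (a : Fin 3) :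
    IntervalIntegrable (fun t => vcoef (b t) k a) volume s t := by
  refine ((hb.continuousOn_vcoef k a).mono ?_).intervalIntegrable
  rw [uIcc_of_le hst]
  exact fun x hx => hs.trans hx.1

theorem IsWeakSolution.intervalIntegrable_curlHall (hb : IsWeakSolution μ b) {s t : ℝ}
    (hs : 0 ≤ s) (hst : s ≤ t) (k : Fin n → ℤ) (a : Fin 3) :
    IntervalIntegrable (fun t => (twoPiI • (emb k ⨯₃ hallCoef (vcoef (b t)) k)) a)
      volume s t := by
  have h := fun i c => (hb.intervalIntegrable_hallCoef hs hst k i).const_mul c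
  have key : ∀ i j i' j', IntervalIntegrable (fun t => twoPiI *
      (emb k i * hallCoef (vcoef (b t)) k j - emb k i' * hallCoef (vcoef (b t)) k j'))
      volume s t := fun i j i' j' => ((h j _).sub (h j' _)).const_mul _
  simp only [cross_apply]
  fin_cases a
  · exact key 1 2 2 1
  · exact key 2 0 0 2
  · exact key 0 1 1 0

theorem IsWeakSolution.intervalIntegrable_evol (hb : IsWeakSolution μ b) {s t : ℝ}
    (hs : 0 ≤ s) (hst : s ≤ t) (k : Fin n → ℤ) (a : Fin 3) :
    IntervalIntegrable (fun t => evol μ (vcoef (b t)) k a) volume s t :=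
  ((hb.intervalIntegrable_vcoef hs hst k a).const_mul _).sub
    (hb.intervalIntegrable_curlHall hs hst k a)

/-- Each Fourier mode of a weak solution is absolutely continuous in time and solves its ordinary
differential equation: this is the weak formulation for trigonometric test fields. -/
theorem IsWeakSolution.vcoef_eq (hb : IsWeakSolution μ b) {t : ℝ} (ht : 0 ≤ t) (k : Fin n → ℤ)
    (a : Fin 3) :
    vcoef (b t) k a = vcoef (b 0) k a + ∫ τ in (0 : ℝ)..t, evol μ (vcoef (b τ)) k a := by
  have hI := hb.intervalIntegrable_vcoef le_rfl ht k a
  have hN := hb.intervalIntegrable_curlHall le_rfl ht k a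
  have hre : ∀ (c : ℂ) {g : ℝ → ℂ}, IntervalIntegrable g volume 0 t →
      ∫ τ in (0 : ℝ)..t, (c * g τ).re = (c * ∫ τ in (0 : ℝ)..t, g τ).re := fun c g hg => by
    have := Complex.reCLM.intervalIntegral_comp_comm (hg.const_mul c)
    rw [intervalIntegral.integral_const_mul] at this
    exact this
  refine eq_of_re_mul_eq fun c => ?_
  have h := hb.weakForm _ (isSmooth_reTrig_smul c (-k) (EuclideanSpace.single a (1 : ℝ) : V3)) t ht
  rw [integral_dot_single (hb.memL2 t ht), integral_dot_single (hb.memL2 0 le_rfl)] at h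
  have e1 : ∫ τ in (0 : ℝ)..t, ∫ x, (weakCurl (b τ) x ⨯₃ (b τ x).ofLp) ⬝ᵥ
        curl (fun y : Torus n => reTrig c (-k) y • (EuclideanSpace.single a (1 : ℝ) : V3)) x
        ∂(torusMeasure n)
      = (c * ∫ τ in (0 : ℝ)..t, (twoPiI • (emb k ⨯₃ hallCoef (vcoef (b τ)) k)) a).re := by
    rw [← hre c hN]
    rw [intervalIntegral.integral_of_le ht, intervalIntegral.integral_of_le ht]
    refine integral_congr_ae ?_
    filter_upwards [ae_mono (restrict_Ioc_le 0 t le_rfl) hb.memH1,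
      ae_restrict_mem measurableSet_Ioc] with τ hτ hmem
    have hm := hb.memL2 τ hmem.1.le
    rw [integral_hall_dot_curl hm hτ, nonlin_eq hm hτ]
  have e2 : ∫ τ in (0 : ℝ)..t, ∫ x, (b τ x).ofLp ⬝ᵥ (laplacian (fun y : Torus n =>
        reTrig c (-k) y • (EuclideanSpace.single a (1 : ℝ) : V3)) x).ofLp ∂(torusMeasure n)
      = (c * (-(4 * Real.pi ^ 2 * (ksq k : ℝ)) * ∫ τ in (0 : ℝ)..t, vcoef (b τ) k a)).re := by
    rw [← mul_assoc, ← hre _ hI]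
    rw [intervalIntegral.integral_of_le ht, intervalIntegral.integral_of_le ht]
    refine setIntegral_congr_fun measurableSet_Ioc fun τ hmem => ?_
    have hm := hb.memL2 τ hmem.1.le
    simp only
    rw [integral_dot_laplacian hm, ← mul_assoc c]
  rw [e1, e2] at h
  have e3 : ∫ τ in (0 : ℝ)..t, evol μ (vcoef (b τ)) k a
      = -(4 * Real.pi ^ 2 * (ksq k : ℝ)) * μ * (∫ τ in (0 : ℝ)..t, vcoef (b τ) k a)
        - ∫ τ in (0 : ℝ)..t, (twoPiI • (emb k ⨯₃ hallCoef (vcoef (b τ)) k)) a := by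
    unfold evol
    rw [intervalIntegral.integral_sub (hI.const_mul _) hN, intervalIntegral.integral_const_mul]
  rw [e3]
  generalize (∫ τ in (0 : ℝ)..t, vcoef (b τ) k a) = X at *
  generalize (∫ τ in (0 : ℝ)..t, (twoPiI • (emb k ⨯₃ hallCoef (vcoef (b τ)) k)) a) = Y at *
  have e4 : (c * (vcoef (b 0) k a + (-(4 * Real.pi ^ 2 * (ksq k : ℝ)) * μ * X - Y))).re
      = (c * vcoef (b 0) k a).re + μ * (c * (-(4 * Real.pi ^ 2 * (ksq k : ℝ)) * X)).re
        - (c * Y).re := by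
    rw [← Complex.re_ofReal_mul, ← Complex.add_re, ← Complex.sub_re]
    congr 1
    ring
  rw [e4]
  linarith

/-! ### The energy identity for absolutely continuous functions -/

/-- The chain rule for the square of an absolutely continuous function, given as a primitive. -/
theorem sq_sub_sq_eq_integral {f g : ℝ → ℝ} {s t : ℝ}
    (hg : IntervalIntegrable g volume s t)
    (hf : ∀ τ ∈ uIcc s t, f τ = f s + ∫ x in s..τ, g x) :
    f t ^ 2 - f s ^ 2 = ∫ τ in s..t, 2 * (f τ * g τ) := by
  set G : ℝ → ℝ := fun τ => ∫ x in s..τ, g x with hG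
  have hac : AbsolutelyContinuousOnInterval G s t :=
    hg.absolutelyContinuousOnInterval_intervalIntegral left_mem_uIcc
  have hcont : ContinuousOn G (uIcc s t) := hac.continuousOn
  have h := hac.integral_deriv_mul_eq_sub hac
  have hd : ∫ x in s..t, deriv G x * G x + G x * deriv G x
      = ∫ x in s..t, 2 * (G x * g x) := by
    refine intervalIntegral.integral_congr_ae ?_
    filter_upwards [hg.ae_hasDerivAt_integral] with x hx hxs
    have := (hx (uIoc_subset_uIcc hxs) s left_mem_uIcc).deriv
    rw [this]
    ring
  have h0 : G s = 0 := intervalIntegral.integral_same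
  rw [hd, h0] at h
  have e : ∫ τ in s..t, 2 * (f τ * g τ)
      = ∫ τ in s..t, (2 * f s * g τ + 2 * (G τ * g τ)) := by
    refine intervalIntegral.integral_congr fun τ hτ => ?_
    rw [hf τ hτ]
    ring
  rw [e, intervalIntegral.integral_add (hg.const_mul _)
    ((hg.continuousOn_mul hcont).const_mul _), h, intervalIntegral.integral_const_mul,
    hf t right_mem_uIcc]
  ring

theorem norm_sq_sub_norm_sq_eq_integral {f g : ℝ → ℂ}
    (hg : ∀ s t, 0 ≤ s → s ≤ t → IntervalIntegrable g volume s t)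
    (hf : ∀ t, 0 ≤ t → f t = f 0 + ∫ τ in (0 : ℝ)..t, g τ) {s t : ℝ} (hs : 0 ≤ s) (hst : s ≤ t) :
    IntervalIntegrable (fun τ => 2 * (conj (f τ) * g τ).re) volume s t ∧
      ‖f t‖ ^ 2 - ‖f s‖ ^ 2 = ∫ τ in s..t, 2 * (conj (f τ) * g τ).re := by
  have hst' := hg s t hs hst
  have hfs : ∀ τ ∈ uIcc s t, f τ = f s + ∫ x in s..τ, g x := by
    intro τ hτ
    rw [uIcc_of_le hst] at hτ
    rw [hf τ (hs.trans hτ.1), hf s hs, add_assoc,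
      intervalIntegral.integral_add_adjacent_intervals (hg 0 s le_rfl hs) (hg s τ hs hτ.1)]
  have hcont : ContinuousOn f (uIcc s t) := by
    refine ContinuousOn.congr (f := fun τ => f s + ∫ x in s..τ, g x) ?_ hfs
    exact continuousOn_const.add
      (intervalIntegral.continuousOn_primitive_interval'  hst' left_mem_uIcc)
  have hre : IntervalIntegrable (fun τ => (g τ).re) volume s t := ⟨hst'.1.re, hst'.2.re⟩
  have him : IntervalIntegrable (fun τ => (g τ).im) volume s t := ⟨hst'.1.im, hst'.2.im⟩
  have hsub : ∀ τ ∈ uIcc s t, IntervalIntegrable g volume s τ := fun τ hτ =>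
    hst'.mono_set (uIcc_subset_uIcc_left hτ)
  have h1 := sq_sub_sq_eq_integral (f := fun τ => (f τ).re) hre fun τ hτ => by
    have := Complex.reCLM.intervalIntegral_comp_comm (hsub τ hτ)
    simp only [Complex.reCLM_apply] at this
    rw [this, ← Complex.add_re, ← hfs τ hτ]
  have h2 := sq_sub_sq_eq_integral (f := fun τ => (f τ).im) him fun τ hτ => by
    have := Complex.imCLM.intervalIntegral_comp_comm (hsub τ hτ)
    simp only [Complex.imCLM_apply] at this
    rw [this, ← Complex.add_im, ← hfs τ hτ]
  have i1 : IntervalIntegrable (fun τ => 2 * ((f τ).re * (g τ).re)) volume s t :=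
    (hre.continuousOn_mul (Complex.continuous_re.comp_continuousOn hcont)).const_mul 2
  have i2 : IntervalIntegrable (fun τ => 2 * ((f τ).im * (g τ).im)) volume s t :=
    (him.continuousOn_mul (Complex.continuous_im.comp_continuousOn hcont)).const_mul 2
  have e : (fun τ => 2 * (conj (f τ) * g τ).re)
      = fun τ => 2 * ((f τ).re * (g τ).re) + 2 * ((f τ).im * (g τ).im) := by
    funext τ
    simp only [Complex.mul_re, Complex.conj_re, Complex.conj_im]
    ring
  rw [e]
  refine ⟨i1.add i2, ?_⟩
  rw [intervalIntegral.integral_add i1 i2, ← h1, ← h2]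
  simp only [Complex.sq_norm, Complex.normSq_apply]
  ring

/-! ### The energy balance in `H⁻¹` for the difference of two solutions -/

/-- The square of the norm of `u` in the homogeneous space `H⁻¹`. The zero mode is discarded
because `0⁻¹ = 0`. -/
def energy (u : (Fin n → ℤ) → Fin 3 → ℂ) : ℝ :=
  ∑' k, (4 * Real.pi ^ 2 * (ksq k : ℝ))⁻¹ * vsq (u k)

theorem inv_ksq_le_one (k : Fin n → ℤ) : (4 * Real.pi ^ 2 * (ksq k : ℝ))⁻¹ ≤ 1 := by
  by_cases hk : k = 0
  · simp [hk, ksq_zero]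
  · apply inv_le_one_of_one_le₀
    have h2 : (1 : ℝ) ≤ 4 * Real.pi ^ 2 := by nlinarith [Real.pi_gt_three]
    nlinarith [one_le_ksq hk]

theorem summable_energy {u : (Fin n → ℤ) → Fin 3 → ℂ} (hu : Summable fun k => vsq (u k)) :
    Summable fun k => (4 * Real.pi ^ 2 * (ksq k : ℝ))⁻¹ * vsq (u k) :=
  Summable.of_nonneg_of_le (fun k => mul_nonneg (by positivity) (vsq_nonneg _))
    (fun k => mul_le_of_le_one_left (vsq_nonneg _) (inv_ksq_le_one k)) hu

theorem energy_nonneg (u : (Fin n → ℤ) → Fin 3 → ℂ) : 0 ≤ energy u :=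
  tsum_nonneg fun k => mul_nonneg (by positivity) (vsq_nonneg _)

/-- The Poincaré inequality. -/
theorem energy_le_s0 {u : (Fin n → ℤ) → Fin 3 → ℂ} (hu : Summable fun k => vsq (u k)) :
    4 * Real.pi ^ 2 * energy u ≤ s0 u := by
  rw [energy, s0, ← tsum_mul_left]
  refine Summable.tsum_le_tsum (fun k => ?_) ((summable_energy hu).mul_left _) hu
  by_cases hk : k = 0
  · simp [hk, ksq_zero, vsq_nonneg]
  · have h1 := one_le_ksq hk
    rw [mul_inv, mul_assoc _ (ksq k : ℝ)⁻¹, ← mul_assoc, mul_inv_cancel₀ (by positivity), one_mul]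
    exact mul_le_of_le_one_left (vsq_nonneg _) (inv_le_one_of_one_le₀ h1)

/-- The Hall terms of two fields, tested against the vector potential of the difference and summed
over the frequencies in a box. -/
def hallPairing (N : ℕ) (u₁ u₂ : (Fin n → ℤ) → Fin 3 → ℂ) : ℂ :=
  ∑ l ∈ box n N, ∑ i, (hallCoef u₁ (-l) i - hallCoef u₂ (-l) i) * potential (u₁ - u₂) l i

/-- The contribution of one mode to the energy balance. The pairing of `k × F̂` with `ŵ` becomes the
pairing of `F̂` with the vector potential. -/
theorem mode_balance (μ : ℝ) {u₁ u₂ : (Fin n → ℤ) → Fin 3 → ℂ}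
    (hconj : ∀ k a, (u₁ - u₂) (-k) a = conj ((u₁ - u₂) k a)) (h0 : (u₁ - u₂) 0 = 0)
    (l : Fin n → ℤ) :
    (((4 * Real.pi ^ 2 * (ksq l : ℝ))⁻¹ : ℝ) : ℂ) *
        ∑ a, conj ((u₁ - u₂) l a) * (evol μ u₁ l a - evol μ u₂ l a)
      = -(μ * vsq ((u₁ - u₂) l) : ℝ)
        - ∑ i, (hallCoef u₁ l i - hallCoef u₂ l i) * potential (u₁ - u₂) (-l) i := by
  by_cases hl : l = 0
  · subst hl
    simp [h0, ksq_zero, vsq, potential]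
  have hk : ((ksq l : ℝ) : ℂ) ≠ 0 := by
    have := one_le_ksq hl
    exact_mod_cast (by linarith : (ksq l : ℝ) ≠ 0)
  have hpi : (Real.pi : ℂ) ≠ 0 := by exact_mod_cast Real.pi_ne_zero
  set w := u₁ - u₂ with hw
  have ev : ∀ a, evol μ u₁ l a - evol μ u₂ l a
      = -(4 * Real.pi ^ 2 * (ksq l : ℝ)) * μ * w l a
        - (twoPiI • (emb l ⨯₃ (hallCoef u₁ l - hallCoef u₂ l))) a := fun a => by
    simp only [evol, hw, map_sub, smul_sub, Pi.sub_apply]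
    ring
  have hv : ((vsq (w l) : ℝ) : ℂ) = ∑ a, conj (w l a) * w l a := by
    simp only [vsq, Complex.ofReal_sum, Complex.conj_mul']
    push_cast
    rfl
  have hwn : w (-l) = fun a => conj (w l a) := funext fun a => hconj l a
  simp only [ev, potential, ksq_neg, emb_neg, hwn]
  rw [Complex.ofReal_mul μ, hv]
  simp only [← Pi.sub_apply (hallCoef u₁ l) (hallCoef u₂ l)]
  generalize hallCoef u₁ l - hallCoef u₂ l = F
  generalize w l = W
  generalize emb l = L
  simp only [Fin.sum_univ_three, cross_apply, twoPiI, Pi.smul_apply, Pi.neg_apply, smul_eq_mul,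
    Matrix.cons_val_zero, Matrix.cons_val_one, Matrix.cons_val_two, Matrix.head_cons,
    Matrix.tail_cons]
  push_cast at hk ⊢
  field_simp
  ring

theorem sum_mode_balance (μ : ℝ) {u₁ u₂ : (Fin n → ℤ) → Fin 3 → ℂ}
    (hconj : ∀ k a, (u₁ - u₂) (-k) a = conj ((u₁ - u₂) k a)) (h0 : (u₁ - u₂) 0 = 0) (N : ℕ) :
    ∑ l ∈ box n N, (4 * Real.pi ^ 2 * (ksq l : ℝ))⁻¹ *
        ∑ a, 2 * (conj ((u₁ - u₂) l a) * (evol μ u₁ l a - evol μ u₂ l a)).re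
      = -(2 * μ) * ∑ l ∈ box n N, vsq ((u₁ - u₂) l) - 2 * (hallPairing N u₁ u₂).re := by
  have h : ∀ l, (4 * Real.pi ^ 2 * (ksq l : ℝ))⁻¹ *
        ∑ a, 2 * (conj ((u₁ - u₂) l a) * (evol μ u₁ l a - evol μ u₂ l a)).re
      = -(2 * μ) * vsq ((u₁ - u₂) l) - 2 * (∑ i, (hallCoef u₁ l i - hallCoef u₂ l i)
          * potential (u₁ - u₂) (-l) i).re := fun l => by
    have := congrArg Complex.re (mode_balance μ hconj h0 l)
    rw [Complex.re_ofReal_mul, Complex.sub_re, ← Complex.ofReal_neg, Complex.ofReal_re,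
      Complex.re_sum] at this
    rw [← Finset.mul_sum, mul_left_comm, this]
    ring
  rw [Finset.sum_congr rfl fun l _ => h l, Finset.sum_sub_distrib, ← Finset.mul_sum,
    ← Finset.mul_sum, ← Complex.re_sum, hallPairing]
  rw [← sum_box_neg N fun l => ∑ i, (hallCoef u₁ (-l) i - hallCoef u₂ (-l) i)
    * potential (u₁ - u₂) l i]
  simp only [neg_neg]

theorem hallPairing_eq (hn : n ≤ 3) {u₁ u₂ : (Fin n → ℤ) → Fin 3 → ℂ} (h₁ : H1Seq u₁)
    (h₂ : H1Seq u₂) (N : ℕ) :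
    hallPairing N u₁ u₂ = (∑ l ∈ box n N, ∑' k, triad (u₁ - u₂) u₁ k l
      + ∑ l ∈ box n N, ∑' k, triad (u₁ - u₂) u₂ k l) / 2 := by
  rw [hallPairing, ← Finset.sum_add_distrib, Finset.sum_div]
  refine Finset.sum_congr rfl fun l _ => ?_
  have hw := h₁.sub h₂
  have s1 := (summable_triad_prod hn hw h₁).prod_factor l
  have s2 := (summable_triad_prod hn hw h₂).prod_factor l
  have h := (hasSum_triad h₁ h₂ l).tsum_eq
  rw [tsum_div_const, s1.tsum_add s2] at h
  exact h.symm

/-- A bound uniform in `N`, integrable in time along two weak solutions. -/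
theorem norm_hallPairing_le (hn : n ≤ 3) {u₁ u₂ : (Fin n → ℤ) → Fin 3 → ℂ} (h₁ : H1Seq u₁)
    (h₂ : H1Seq u₂) {M : ℝ} (hM : 0 ≤ M) (hM₁ : s0 u₁ ≤ M ^ 2) (hM₂ : s0 u₂ ≤ M ^ 2) (N : ℕ) :
    ‖hallPairing N u₁ u₂‖ ≤ 384 * M * √(zeta4 n) * (s1 u₁ + s1 u₂) := by
  have hw := h₁.sub h₂
  set σ := s1 u₁ + s1 u₂ with hσ
  have p1 := s1_nonneg u₁
  have p2 := s1_nonneg u₂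
  have hF : ∀ l i, ‖hallCoef u₁ l i - hallCoef u₂ l i‖ ≤ 64 * M * √σ := by
    intro l i
    have a1 := norm_hallCoef_le h₁ l i
    have a2 := norm_hallCoef_le h₂ l i
    have e1 : √(s1 u₁) * √(s0 u₁) ≤ √σ * M :=
      mul_le_mul (Real.sqrt_le_sqrt (by linarith)) (Real.sqrt_le_iff.mpr ⟨hM, hM₁⟩)
        (Real.sqrt_nonneg _) (Real.sqrt_nonneg _)
    have e2 : √(s1 u₂) * √(s0 u₂) ≤ √σ * M :=
      mul_le_mul (Real.sqrt_le_sqrt (by linarith)) (Real.sqrt_le_iff.mpr ⟨hM, hM₂⟩)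
        (Real.sqrt_nonneg _) (Real.sqrt_nonneg _)
    have := norm_sub_le (hallCoef u₁ l i) (hallCoef u₂ l i)
    linarith
  have hS : √(s1 (u₁ - u₂)) ≤ 2 * √σ := by
    rw [show (2 : ℝ) = √4 by rw [show (4 : ℝ) = 2 ^ 2 by norm_num, Real.sqrt_sq (by norm_num)],
      ← Real.sqrt_mul (by norm_num)]
    exact Real.sqrt_le_sqrt (by linarith [s1_sub_le h₁ h₂])
  have hP : ∀ i, ∑ l ∈ box n N, ‖potential (u₁ - u₂) l i‖ ≤ √(zeta4 n) * (2 * √σ) := fun i => by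
    obtain ⟨hs, hle⟩ := summable_potential_and_tsum_le hn hw i
    refine (hs.sum_le_tsum _ fun _ _ => norm_nonneg _).trans (hle.trans ?_)
    gcongr
  rw [hallPairing, Finset.sum_comm]
  have hi : ∀ i : Fin 3, ‖∑ l ∈ box n N, (hallCoef u₁ (-l) i - hallCoef u₂ (-l) i)
      * potential (u₁ - u₂) l i‖ ≤ 128 * M * √(zeta4 n) * σ := fun i => by
    calc _ ≤ ∑ l ∈ box n N, 64 * M * √σ * ‖potential (u₁ - u₂) l i‖ := by
          refine norm_sum_le_of_le _ fun l _ => ?_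
          rw [norm_mul]
          exact mul_le_mul_of_nonneg_right (hF _ i) (norm_nonneg _)
      _ ≤ 64 * M * √σ * (√(zeta4 n) * (2 * √σ)) := by
          rw [← Finset.mul_sum]
          exact mul_le_mul_of_nonneg_left (hP i) (by positivity)
      _ = 128 * M * √(zeta4 n) * (√σ * √σ) := by ring
      _ = _ := by rw [Real.mul_self_sqrt (by positivity)]
  refine (norm_sum_le_of_le _ fun i _ => hi i).trans (le_of_eq ?_)
  rw [Finset.sum_const, Finset.card_univ, Fintype.card_fin]
  simp
  ring

/-- The zero mode of the difference vanishes, and the interactions with either field are at most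
a quarter of the dissipation rate `2μ ∑ₖ |w(k)|²`, where `w = u₁ - u₂`. -/
structure Dominated (μ : ℝ) (u₁ u₂ : (Fin n → ℤ) → Fin 3 → ℂ) : Prop where
  zero : (u₁ - u₂) 0 = 0
  left : ∀ N, ‖∑ k ∈ box n N, ∑ l ∈ box n N, triad (u₁ - u₂) u₁ k l‖
    ≤ μ / 2 * ∑ k ∈ box n N, vsq ((u₁ - u₂) k)
  right : ∀ N, ‖∑ k ∈ box n N, ∑ l ∈ box n N, triad (u₁ - u₂) u₂ k l‖
    ≤ μ / 2 * ∑ k ∈ box n N, vsq ((u₁ - u₂) k)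

/-- The rate of change of the truncated energies converges, and half of the dissipation survives in
the limit; the Poincaré inequality turns it into a multiple of the energy. -/
theorem exists_tendsto_rate (hn : n ≤ 3) (hμ : 0 < μ) {u₁ u₂ : (Fin n → ℤ) → Fin 3 → ℂ}
    (h₁ : H1Seq u₁) (h₂ : H1Seq u₂) (hd : Dominated μ u₁ u₂) :
    ∃ I : ℝ, Tendsto (fun N => -(2 * μ) * ∑ l ∈ box n N, vsq ((u₁ - u₂) l)
        - 2 * (hallPairing N u₁ u₂).re) atTop (𝓝 I) ∧
      I ≤ -(4 * Real.pi ^ 2 * μ) * energy (u₁ - u₂) := by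
  have hw := h₁.sub h₂
  obtain ⟨ta, tb⟩ := tendsto_sum_box_triad hn hw h₁
  obtain ⟨tc, td⟩ := tendsto_sum_box_triad hn hw h₂
  set X := ∑' p : (Fin n → ℤ) × (Fin n → ℤ), triad (u₁ - u₂) u₁ p.2 p.1
  set Y := ∑' p : (Fin n → ℤ) × (Fin n → ℤ), triad (u₁ - u₂) u₂ p.2 p.1
  have tD : Tendsto (fun N => ∑ l ∈ box n N, vsq ((u₁ - u₂) l)) atTop (𝓝 (s0 (u₁ - u₂))) :=
    hw.summable0.hasSum.comp tendsto_box_atTop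
  have hX : ‖X‖ ≤ μ / 2 * s0 (u₁ - u₂) :=
    le_of_tendsto_of_tendsto' tb.norm (tD.const_mul _) hd.left
  have hY : ‖Y‖ ≤ μ / 2 * s0 (u₁ - u₂) :=
    le_of_tendsto_of_tendsto' td.norm (tD.const_mul _) hd.right
  refine ⟨-(2 * μ) * s0 (u₁ - u₂) - 2 * ((X + Y) / 2).re, ?_, ?_⟩
  · simp_rw [hallPairing_eq hn h₁ h₂]
    exact (tD.const_mul _).sub
      (((Complex.continuous_re.tendsto _).comp ((ta.add tc).div_const 2)).const_mul 2)
  · have hre : -(‖X‖ + ‖Y‖) ≤ 2 * ((X + Y) / 2).re := by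
      have e : 2 * ((X + Y) / 2).re = X.re + Y.re := by
        rw [show (X + Y) / 2 = ((1 / 2 : ℝ) : ℂ) * (X + Y) by push_cast; ring,
          Complex.re_ofReal_mul, Complex.add_re]
        ring
      rw [e]
      have := Complex.abs_re_le_norm X
      have := Complex.abs_re_le_norm Y
      linarith [neg_abs_le X.re, neg_abs_le Y.re]
    have := mul_le_mul_of_nonneg_left (energy_le_s0 hw.summable0) hμ.le
    linarith

variable {b₁ b₂ : ℝ → Torus n → V3}

theorem intervalIntegrable_sum {ι : Type*} (S : Finset ι) {f : ι → ℝ → ℝ} {s t : ℝ}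
    (h : ∀ i, IntervalIntegrable (f i) volume s t) :
    IntervalIntegrable (fun τ => ∑ i ∈ S, f i τ) volume s t := by
  simpa only [Finset.sum_fn] using IntervalIntegrable.sum S fun i _ => h i

/-- The energy balance for the modes in a box. -/
theorem sum_box_energy_sub (h₁ : IsWeakSolution μ b₁) (h₂ : IsWeakSolution μ b₂)
    (h0 : ∀ᵐ t ∂(volume.restrict (Ioi (0 : ℝ))), (vcoef (b₁ t) - vcoef (b₂ t)) 0 = 0)
    {s t : ℝ} (hs : 0 ≤ s) (hst : s ≤ t) (N : ℕ) :
    IntervalIntegrable (fun τ => -(2 * μ) * ∑ l ∈ box n N, vsq ((vcoef (b₁ τ) - vcoef (b₂ τ)) l)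
        - 2 * (hallPairing N (vcoef (b₁ τ)) (vcoef (b₂ τ))).re) volume s t ∧
      ∑ l ∈ box n N, (4 * Real.pi ^ 2 * (ksq l : ℝ))⁻¹ * vsq ((vcoef (b₁ t) - vcoef (b₂ t)) l)
        - ∑ l ∈ box n N, (4 * Real.pi ^ 2 * (ksq l : ℝ))⁻¹
            * vsq ((vcoef (b₁ s) - vcoef (b₂ s)) l)
      = ∫ τ in s..t, (-(2 * μ) * ∑ l ∈ box n N, vsq ((vcoef (b₁ τ) - vcoef (b₂ τ)) l)
        - 2 * (hallPairing N (vcoef (b₁ τ)) (vcoef (b₂ τ))).re) := by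
  have hmode := fun (l : Fin n → ℤ) (a : Fin 3) => norm_sq_sub_norm_sq_eq_integral
    (f := fun t => (vcoef (b₁ t) - vcoef (b₂ t)) l a)
    (g := fun t => evol μ (vcoef (b₁ t)) l a - evol μ (vcoef (b₂ t)) l a)
    (fun s t hs hst => (h₁.intervalIntegrable_evol hs hst l a).sub
      (h₂.intervalIntegrable_evol hs hst l a))
    (fun t ht => by
      simp only [Pi.sub_apply]
      rw [intervalIntegral.integral_sub (h₁.intervalIntegrable_evol le_rfl ht l a)
        (h₂.intervalIntegrable_evol le_rfl ht l a), h₁.vcoef_eq ht, h₂.vcoef_eq ht]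
      ring) hs hst
  have hrow := fun l => intervalIntegrable_sum Finset.univ fun a => (hmode l a).1
  have hint : IntervalIntegrable (fun τ => ∑ l ∈ box n N, (4 * Real.pi ^ 2 * (ksq l : ℝ))⁻¹ *
      ∑ a, 2 * (conj ((vcoef (b₁ τ) - vcoef (b₂ τ)) l a) *
        (evol μ (vcoef (b₁ τ)) l a - evol μ (vcoef (b₂ τ)) l a)).re) volume s t :=
    intervalIntegrable_sum _ fun l => (hrow l).const_mul _
  have hae : ∀ᵐ τ ∂(volume.restrict (Ioc s t)), ∑ l ∈ box n N,
      (4 * Real.pi ^ 2 * (ksq l : ℝ))⁻¹ *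
      ∑ a, 2 * (conj ((vcoef (b₁ τ) - vcoef (b₂ τ)) l a) *
        (evol μ (vcoef (b₁ τ)) l a - evol μ (vcoef (b₂ τ)) l a)).re
      = -(2 * μ) * ∑ l ∈ box n N, vsq ((vcoef (b₁ τ) - vcoef (b₂ τ)) l)
        - 2 * (hallPairing N (vcoef (b₁ τ)) (vcoef (b₂ τ))).re := by
    filter_upwards [ae_mono (restrict_Ioc_le s t hs) h0] with τ hτ
    refine sum_mode_balance μ (fun k a => ?_) hτ N
    simp only [Pi.sub_apply, vcoef_neg, map_sub]
  refine ⟨?_, ?_⟩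
  · rw [intervalIntegrable_iff_integrableOn_Ioc_of_le hst] at hint ⊢
    exact hint.congr hae
  · rw [intervalIntegral.integral_of_le hst, ← integral_congr_ae hae,
      ← intervalIntegral.integral_of_le hst, intervalIntegral.integral_finsetSum fun l _ =>
        (hrow l).const_mul _,
      ← Finset.sum_sub_distrib]
    refine Finset.sum_congr rfl fun l _ => ?_
    rw [intervalIntegral.integral_const_mul, intervalIntegral.integral_finsetSum fun a _ =>
      (hmode l a).1, ← mul_sub]
    congr 1
    rw [vsq, vsq, ← Finset.sum_sub_distrib]
    exact Finset.sum_congr rfl fun a _ => (hmode l a).2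

/-- The energy of the difference is absolutely continuous, with derivative at most `-4π²μ` times the
energy. The balance for the modes in a box passes to the limit by dominated convergence. -/
theorem exists_energy_sub (hn : n ≤ 3) (hμ : 0 < μ) (h₁ : IsWeakSolution μ b₁)
    (h₂ : IsWeakSolution μ b₂)
    (hd : ∀ᵐ t ∂(volume.restrict (Ioi (0 : ℝ))), Dominated μ (vcoef (b₁ t)) (vcoef (b₂ t)))
    {s t : ℝ} (hs : 0 ≤ s) (hst : s ≤ t) :
    ∃ I : ℝ → ℝ, IntervalIntegrable I volume s t ∧
      (∀ᵐ τ ∂(volume.restrict (Ioc s t)),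
        I τ ≤ -(4 * Real.pi ^ 2 * μ) * energy (vcoef (b₁ τ) - vcoef (b₂ τ))) ∧
      energy (vcoef (b₁ t) - vcoef (b₂ t)) - energy (vcoef (b₁ s) - vcoef (b₂ s))
        = ∫ τ in s..t, I τ := by
  classical
  set F : ℕ → ℝ → ℝ := fun N τ => -(2 * μ) * ∑ l ∈ box n N, vsq ((vcoef (b₁ τ) - vcoef (b₂ τ)) l)
        - 2 * (hallPairing N (vcoef (b₁ τ)) (vcoef (b₂ τ))).re with hF
  have hsub := restrict_Ioc_le s t hs
  have hbal := sum_box_energy_sub h₁ h₂ (hd.mono fun _ h => h.zero) hs hst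
  obtain ⟨M₁, hM₁0, hM₁⟩ := h₁.exists_s0_le
  obtain ⟨M₂, hM₂0, hM₂⟩ := h₂.exists_s0_le
  set M := max M₁ M₂ with hM
  have hM0 : 0 ≤ M := le_max_of_le_left hM₁0
  have hq₁ : ∀ τ, 0 ≤ τ → s0 (vcoef (b₁ τ)) ≤ M ^ 2 := fun τ hτ =>
    (hM₁ τ hτ).trans (pow_le_pow_left₀ hM₁0 (le_max_left _ _) 2)
  have hq₂ : ∀ τ, 0 ≤ τ → s0 (vcoef (b₂ τ)) ≤ M ^ 2 := fun τ hτ =>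
    (hM₂ τ hτ).trans (pow_le_pow_left₀ hM₂0 (le_max_right _ _) 2)
  have hs0 : ∀ {b : ℝ → Torus n → V3}, IsWeakSolution μ b → ∀ τ, 0 ≤ τ →
      Summable fun k => vsq (vcoef (b τ) k) := fun h τ hτ =>
    (hasSum_vsq_vcoef (h.memL2 τ hτ)).summable
  have hlim : ∀ᵐ τ ∂(volume.restrict (Ioc s t)), ∃ I : ℝ,
      Tendsto (fun N => F N τ) atTop (𝓝 I) ∧
        I ≤ -(4 * Real.pi ^ 2 * μ) * energy (vcoef (b₁ τ) - vcoef (b₂ τ)) := by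
    filter_upwards [ae_mono hsub h₁.ae_h1Seq, ae_mono hsub h₂.ae_h1Seq, ae_mono hsub hd]
      with τ e1 e2 e3
    exact exists_tendsto_rate hn hμ e1 e2 e3
  set I : ℝ → ℝ := fun τ => limUnder atTop fun N => F N τ with hI
  have hI' : ∀ᵐ τ ∂(volume.restrict (Ioc s t)), Tendsto (fun N => F N τ) atTop (𝓝 (I τ)) ∧
        I τ ≤ -(4 * Real.pi ^ 2 * μ) * energy (vcoef (b₁ τ) - vcoef (b₂ τ)) := by
    filter_upwards [hlim] with τ ⟨J, h1, h2⟩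
    have : I τ = J := h1.limUnder_eq
    rw [this]
    exact ⟨h1, h2⟩
  set g : ℝ → ℝ := fun τ => 8 * μ * M ^ 2
    + 768 * M * √(zeta4 n) * (s1 (vcoef (b₁ τ)) + s1 (vcoef (b₂ τ))) with hg
  have hgI : IntervalIntegrable g volume s t :=
    intervalIntegrable_const.add
      (((h₁.intervalIntegrable_s1 hs hst).add (h₂.intervalIntegrable_s1 hs hst)).const_mul _)
  have hbound : ∀ N, ∀ᵐ τ ∂(volume.restrict (Ioc s t)), ‖F N τ‖ ≤ g τ := by
    intro N
    filter_upwards [ae_mono hsub h₁.ae_h1Seq, ae_mono hsub h₂.ae_h1Seq,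
      ae_restrict_mem measurableSet_Ioc] with τ e1 e2 e3
    have hτ : 0 ≤ τ := hs.trans e3.1.le
    have hw := e1.sub e2
    have a1 := norm_hallPairing_le hn e1 e2 hM0 (hq₁ τ hτ) (hq₂ τ hτ) N
    have a2 := (Complex.abs_re_le_norm (hallPairing N (vcoef (b₁ τ)) (vcoef (b₂ τ)))).trans a1
    have a3 : ∑ l ∈ box n N, vsq ((vcoef (b₁ τ) - vcoef (b₂ τ)) l) ≤ 4 * M ^ 2 := by
      refine (hw.summable0.sum_le_tsum _ fun _ _ => vsq_nonneg _).trans ?_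
      have := s0_sub_le e1.summable0 e2.summable0
      rw [s0] at this
      linarith [hq₁ τ hτ, hq₂ τ hτ]
    have a4 : 0 ≤ ∑ l ∈ box n N, vsq ((vcoef (b₁ τ) - vcoef (b₂ τ)) l) :=
      Finset.sum_nonneg fun _ _ => vsq_nonneg _
    have a5 := mul_le_mul_of_nonneg_left a3 hμ.le
    have a6 := mul_nonneg hμ.le a4
    rw [abs_le] at a2
    rw [hF, hg, Real.norm_eq_abs, abs_le]
    simp only
    constructor <;> linarith [a2.1, a2.2]
  have hmeas : ∀ N, AEStronglyMeasurable (F N) (volume.restrict (Ioc s t)) := fun N =>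
    ((intervalIntegrable_iff_integrableOn_Ioc_of_le hst).mp (hbal N).1).aestronglyMeasurable
  have hgI' : Integrable g (volume.restrict (Ioc s t)) :=
    (intervalIntegrable_iff_integrableOn_Ioc_of_le hst).mp hgI
  have htend := tendsto_integral_of_dominated_convergence g hmeas hgI' hbound
    (hI'.mono fun _ h => h.1)
  refine ⟨I, ?_, hI'.mono fun _ h => h.2, ?_⟩
  · rw [intervalIntegrable_iff_integrableOn_Ioc_of_le hst]
    refine Integrable.mono' hgI' (aestronglyMeasurable_of_tendsto_ae atTop hmeas
      (hI'.mono fun _ h => h.1)) ?_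
    filter_upwards [hI', ae_all_iff.mpr hbound] with τ e1 e2
    exact le_of_tendsto e1.1.norm (Eventually.of_forall e2)
  · have hE : ∀ τ, 0 ≤ τ → Tendsto (fun N => ∑ l ∈ box n N, (4 * Real.pi ^ 2 * (ksq l : ℝ))⁻¹
        * vsq ((vcoef (b₁ τ) - vcoef (b₂ τ)) l)) atTop
        (𝓝 (energy (vcoef (b₁ τ) - vcoef (b₂ τ)))) := fun τ hτ => by
      have hsum : Summable fun k => vsq ((vcoef (b₁ τ) - vcoef (b₂ τ)) k) :=
        Summable.of_nonneg_of_le (fun k => vsq_nonneg _) (fun k => vsq_sub_le _ _)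
          (((hs0 h₁ τ hτ).mul_left 2).add ((hs0 h₂ τ hτ).mul_left 2))
      exact (summable_energy hsum).hasSum.comp tendsto_box_atTop
    rw [intervalIntegral.integral_of_le hst]
    refine tendsto_nhds_unique ((hE t (hs.trans hst)).sub (hE s hs)) ?_
    refine htend.congr fun N => ?_
    rw [(hbal N).2, intervalIntegral.integral_of_le hst]

theorem energy_antitone (hn : n ≤ 3) (hμ : 0 < μ) (h₁ : IsWeakSolution μ b₁)
    (h₂ : IsWeakSolution μ b₂)
    (hd : ∀ᵐ t ∂(volume.restrict (Ioi (0 : ℝ))), Dominated μ (vcoef (b₁ t)) (vcoef (b₂ t)))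
    {s t : ℝ} (hs : 0 ≤ s) (hst : s ≤ t) :
    energy (vcoef (b₁ t) - vcoef (b₂ t)) ≤ energy (vcoef (b₁ s) - vcoef (b₂ s)) := by
  obtain ⟨I, -, hle, heq⟩ := exists_energy_sub hn hμ h₁ h₂ hd hs hst
  have : ∫ τ in s..t, I τ ≤ 0 := by
    rw [intervalIntegral.integral_of_le hst]
    refine integral_nonpos_of_ae (hle.mono fun τ h => h.trans ?_)
    have := energy_nonneg (vcoef (b₁ τ) - vcoef (b₂ τ))
    rw [neg_mul]
    exact neg_nonpos.mpr (by positivity)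
  linarith

/-- The energy is nonincreasing, so that integrating the differential inequality over `[0, t]` gives
`4π²μ t E(t) ≤ E(0)`. -/
theorem energy_decay (hn : n ≤ 3) (hμ : 0 < μ) (h₁ : IsWeakSolution μ b₁)
    (h₂ : IsWeakSolution μ b₂)
    (hd : ∀ᵐ t ∂(volume.restrict (Ioi (0 : ℝ))), Dominated μ (vcoef (b₁ t)) (vcoef (b₂ t))) :
    Tendsto (fun t => energy (vcoef (b₁ t) - vcoef (b₂ t))) atTop (𝓝 0) := by
  set E := fun t => energy (vcoef (b₁ t) - vcoef (b₂ t)) with hE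
  have hκ : 0 < 4 * Real.pi ^ 2 * μ := by positivity
  have key : ∀ t, 0 < t → E t ≤ E 0 / (4 * Real.pi ^ 2 * μ) / t := by
    intro t ht
    obtain ⟨I, hI, hle, heq⟩ := exists_energy_sub hn hμ h₁ h₂ hd le_rfl ht.le
    have hint : ∫ τ in (0 : ℝ)..t, I τ ≤ ∫ _τ in (0 : ℝ)..t, -(4 * Real.pi ^ 2 * μ) * E t := by
      refine intervalIntegral.integral_mono_ae_restrict ht.le hI intervalIntegrable_const ?_
      rw [Measure.restrict_congr_set Ioc_ae_eq_Icc.symm]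
      filter_upwards [hle, ae_restrict_mem measurableSet_Ioc] with τ e1 e2
      have := energy_antitone hn hμ h₁ h₂ hd e2.1.le e2.2
      refine e1.trans ?_
      rw [neg_mul, neg_mul]
      exact neg_le_neg (mul_le_mul_of_nonneg_left this hκ.le)
    rw [intervalIntegral.integral_const, sub_zero, smul_eq_mul, ← heq] at hint
    have h0 : 0 ≤ E t := energy_nonneg _
    rw [div_div, le_div_iff₀ (by positivity)]
    change E t - E 0 ≤ _ at hint
    nlinarith
  refine squeeze_zero' (Eventually.of_forall fun t => energy_nonneg _)
    ((eventually_gt_atTop 0).mono key) ?_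
  exact tendsto_const_nhds.div_atTop tendsto_id

/-- The mean of the difference is preserved by the flow. -/
theorem zero_mode_eq_zero (h₁ : IsWeakSolution μ b₁) (h₂ : IsWeakSolution μ b₂)
    (h0 : ∀ᵐ t ∂(volume.restrict (Ioi (0 : ℝ))), (vcoef (b₁ t) - vcoef (b₂ t)) 0 = 0)
    {t : ℝ} (ht : 0 ≤ t) : (vcoef (b₁ t) - vcoef (b₂ t)) 0 = 0 := by
  have hconst : ∀ {b : ℝ → Torus n → V3}, IsWeakSolution μ b → ∀ τ, 0 ≤ τ →
      vcoef (b τ) 0 = vcoef (b 0) 0 := fun {b} h τ hτ => by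
    funext a
    rw [h.vcoef_eq hτ]
    simp [evol, ksq_zero, emb_zero]
  have hne : (ae (volume.restrict (Ioi (0 : ℝ)))).NeBot := by
    rw [ae_neBot]
    simp
  obtain ⟨τ, hτ, hτ0⟩ := (h0.and (ae_restrict_mem measurableSet_Ioi)).exists
  rw [Pi.sub_apply] at hτ ⊢
  rw [hconst h₁ t ht, hconst h₂ t ht]
  rw [hconst h₁ τ (le_of_lt hτ0), hconst h₂ τ (le_of_lt hτ0)] at hτ
  exact hτ

variable {χ : EuclideanSpace ℝ (Fin n) → ℝ}

/-! ### Littlewood-Paley blocks as trigonometric polynomials -/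

theorem coeff_apply {f : Torus n → V3} (hf : MemLp f 2 (torusMeasure n)) (k : Fin n → ℤ)
    (c : Fin 3) : coeff f k c = vcoef f k c := by
  have hi : Integrable (fun x => complexify (f x)) (torusMeasure n) := by
    have hm : MemLp (fun x => complexify (f x)) 2 (torusMeasure n) := by
      refine MemLp.of_le (g := f) hf ?_ (ae_of_all _ fun x => ?_)
      · have : Continuous (complexify : V3 → C3) := by
          unfold complexify
          fun_prop
        exact this.comp_aestronglyMeasurable hf.aestronglyMeasurable
      · simp [complexify, EuclideanSpace.norm_eq]
    exact integrable_of_memLp hm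
  have hi' : Integrable (fun x => mFourier (-k) x • complexify (f x)) (torusMeasure n) :=
    Integrable.bdd_smul hi 1 (continuous_mFourier (-k)).aestronglyMeasurable
      (ae_of_all _ fun x => (norm_mFourier_apply _ _).le)
  exact ((EuclideanSpace.proj (𝕜 := ℂ) c : C3 →L[ℂ] ℂ).integral_comp_comm hi').symm

theorem lam_natCast (q : ℕ) : lam (q : ℤ) = 2 ^ q := by simp [lam]

theorem lam_pos (q : ℤ) : 0 < lam q := zpow_pos (by norm_num) q

theorem lam_add_one (q : ℤ) : lam (q + 1) = 2 * lam q := by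
  rw [lam, lam, zpow_add_one₀ (by norm_num), mul_comm]

theorem symbol_natCast (q : ℕ) (ξ : EuclideanSpace ℝ (Fin n)) :
    symbol χ q ξ = χ ((1 / 2 : ℝ) • (lam q)⁻¹ • ξ) - χ ((lam q)⁻¹ • ξ) := by
  simp [symbol]

/-- The symbol of the low-pass filter `f ↦ f_{≤ Q}`; the dyadic symbols telescope to it. -/
def lowSymbol (χ : EuclideanSpace ℝ (Fin n) → ℝ) (Q : ℤ) (ξ : EuclideanSpace ℝ (Fin n)) : ℝ :=
  χ ((1 / 2 : ℝ) • (lam Q)⁻¹ • ξ)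

theorem symbol_succ (q : ℕ) (ξ : EuclideanSpace ℝ (Fin n)) :
    symbol χ (q + 1 : ℕ) ξ = lowSymbol χ (q + 1 : ℕ) ξ - lowSymbol χ q ξ := by
  rw [symbol_natCast, lowSymbol, lowSymbol]
  congr 2
  rw [Nat.cast_succ, lam_add_one, smul_smul]
  congr 1
  rw [mul_inv]
  ring

theorem sum_symbol (Q : ℕ) (ξ : EuclideanSpace ℝ (Fin n)) :
    ∑ q ∈ Finset.Icc (-1 : ℤ) Q, symbol χ q ξ = lowSymbol χ Q ξ := by
  induction Q with
  | zero =>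
    have : Finset.Icc (-1 : ℤ) (0 : ℕ) = {-1, 0} := by decide
    rw [this, Finset.sum_pair (by norm_num)]
    simp [symbol, lowSymbol, lam]
  | succ Q ih =>
    have : Finset.Icc (-1 : ℤ) (Q + 1 : ℕ) = insert ((Q + 1 : ℕ) : ℤ) (Finset.Icc (-1 : ℤ) Q) := by
      ext q
      simp only [Finset.mem_Icc, Finset.mem_insert]
      push_cast
      lia
    rw [this, Finset.sum_insert (by simp), ih, symbol_succ]
    ring

theorem norm_half_smul (Q : ℤ) (ξ : EuclideanSpace ℝ (Fin n)) :
    ‖(1 / 2 : ℝ) • (lam Q)⁻¹ • ξ‖ = ‖ξ‖ / (2 * lam Q) := by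
  have := lam_pos Q
  rw [norm_smul, norm_smul, norm_inv, Real.norm_eq_abs, Real.norm_eq_abs, abs_of_pos this,
    abs_of_pos (by norm_num)]
  field_simp

theorem lowSymbol_eq_one (hχ : IsCutoff χ) {Q : ℤ} {ξ : EuclideanSpace ℝ (Fin n)}
    (h : ‖ξ‖ ≤ 3 / 2 * lam Q) : lowSymbol χ Q ξ = 1 := by
  have := lam_pos Q
  refine hχ.eq_one _ ?_
  rw [norm_half_smul, div_le_iff₀ (by positivity)]
  linarith

theorem lowSymbol_eq_zero (hχ : IsCutoff χ) {Q : ℤ} {ξ : EuclideanSpace ℝ (Fin n)}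
    (h : 2 * lam Q ≤ ‖ξ‖) : lowSymbol χ Q ξ = 0 := by
  have := lam_pos Q
  refine hχ.eq_zero _ ?_
  rwa [norm_half_smul, le_div_iff₀ (by positivity), one_mul]

theorem symbol_eq_zero (hχ : IsCutoff χ) {q : ℤ} {ξ : EuclideanSpace ℝ (Fin n)}
    (h : 2 * lam q ≤ ‖ξ‖) : symbol χ q ξ = 0 := by
  have hpos := lam_pos q
  rw [symbol]
  split_ifs with h0 h1
  · have e := lowSymbol_eq_zero hχ h
    rw [lowSymbol] at e
    rw [e, zero_sub, neg_eq_zero]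
    refine hχ.eq_zero _ ?_
    rw [norm_smul, norm_inv, Real.norm_eq_abs, abs_of_pos hpos, inv_mul_eq_div,
      le_div_iff₀ hpos]
    linarith
  · refine hχ.eq_zero _ ?_
    rw [h1] at h
    simpa [lam] using h
  · rfl

/-- Three consecutive dyadic symbols add up to one in the middle of their range. -/
theorem symbol_add_symbol_add_symbol (hχ : IsCutoff χ) (q : ℕ) (ξ : EuclideanSpace ℝ (Fin n))
    (h₁ : 3 / 4 * 2 ^ (q + 1) ≤ ‖ξ‖) (h₂ : ‖ξ‖ ≤ 9 / 4 * 2 ^ (q + 1)) :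
    symbol χ q ξ + symbol χ (q + 1 : ℕ) ξ + symbol χ (q + 2 : ℕ) ξ = 1 := by
  rw [symbol_succ, symbol_succ (q + 1), symbol_natCast]
  have e0 : χ ((lam q)⁻¹ • ξ) = 0 := by
    have hpos := lam_pos q
    refine hχ.eq_zero _ ?_
    rw [norm_smul, norm_inv, Real.norm_eq_abs, abs_of_pos hpos, inv_mul_eq_div, le_div_iff₀ hpos,
      lam_natCast]
    rw [pow_succ] at h₁
    have : (0 : ℝ) < 2 ^ q := by positivity
    linarith
  have e1 : lowSymbol χ (q + 2 : ℕ) ξ = 1 := by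
    refine lowSymbol_eq_one hχ ?_
    rw [lam_natCast]
    rw [pow_succ] at h₂
    rw [pow_succ, pow_succ]
    have : (0 : ℝ) < 2 ^ q := by positivity
    linarith
  rw [e0, e1]
  simp only [lowSymbol]
  ring

theorem exists_abs_symbol_le (hχ : IsCutoff χ) : ∃ B : ℝ, 0 ≤ B ∧ ∀ q ξ, |symbol χ q ξ| ≤ B := by
  obtain ⟨B, hB⟩ := (isCompact_closedBall (0 : EuclideanSpace ℝ (Fin n)) 1).exists_bound_of_continuousOn
    hχ.smooth.continuous.continuousOn
  have hB0 : 0 ≤ B := (norm_nonneg _).trans (hB 0 (by simp))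
  have h : ∀ ξ, |χ ξ| ≤ B := fun ξ => by
    by_cases hξ : ‖ξ‖ ≤ 1
    · exact hB ξ (by simpa using hξ)
    · rw [hχ.eq_zero ξ (le_of_not_ge hξ), abs_zero]
      exact hB0
  refine ⟨2 * B, by positivity, fun q ξ => ?_⟩
  rw [symbol]
  split_ifs
  · refine (abs_sub _ _).trans ?_
    linarith [h ((1 / 2 : ℝ) • (lam q)⁻¹ • ξ), h ((lam q)⁻¹ • ξ)]
  · linarith [h ξ]
  · simpa using hB0

theorem trigPoly_box_eq {N₀ N : ℕ} (hN : N₀ ≤ N) {f : (Fin n → ℤ) → ℂ}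
    (hf : ∀ m ∉ box n N₀, f m = 0) (x : Torus n) :
    trigPoly (box n N) f x = trigPoly (box n N₀) f x :=
  (Finset.sum_subset (box_mono hN) fun m _ hm => by rw [hf m hm, zero_mul]).symm

theorem symbol_freq_eq_zero (hχ : IsCutoff χ) {q : ℤ} {N : ℕ} (hN : 2 * lam q ≤ N)
    {m : Fin n → ℤ} (hm : m ∉ box n N) : symbol χ q (freq m) = 0 :=
  symbol_eq_zero hχ (hN.trans (le_of_not_ge fun h => hm (mem_box_of_norm_freq_le h)))

theorem block_eq_sum (hχ : IsCutoff χ) (f : Torus n → V3) {q : ℤ} {N : ℕ}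
    (hN : 2 * lam q ≤ N) (x : Torus n) :
    block χ q f x
      = ∑ m ∈ box n N, ((symbol χ q (freq m) : ℂ) * mFourier m x) • coeff f m :=
  tsum_eq_sum fun m hm => by simp [symbol_freq_eq_zero hχ hN hm]

theorem block_apply (hχ : IsCutoff χ) {f : Torus n → V3} (hf : MemLp f 2 (torusMeasure n)) {q : ℤ} {N : ℕ}
    (hN : 2 * lam q ≤ N) (x : Torus n) (c : Fin 3) :
    block χ q f x c = trigPoly (box n N) (fun m => symbol χ q (freq m) * vcoef f m c) x := by
  rw [block_eq_sum hχ f hN, trigPoly, WithLp.ofLp_sum, Finset.sum_apply]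
  refine Finset.sum_congr rfl fun m _ => ?_
  rw [PiLp.smul_apply, coeff_apply hf, smul_eq_mul]
  ring

theorem continuous_block (hχ : IsCutoff χ) (f : Torus n → V3) (q : ℤ) :
    Continuous (block χ q f) := by
  obtain ⟨N, hN⟩ := exists_nat_ge (2 * lam q)
  rw [funext fun x => block_eq_sum hχ f hN x]
  exact continuous_finsetSum _ fun m _ =>
    (continuous_const.mul (continuous_mFourier m)).smul continuous_const

theorem eq_zero_of_trigPoly_eq_zero {S : Finset (Fin n → ℤ)} {g : (Fin n → ℤ) → ℂ}
    (h : ∀ x, trigPoly S g x = 0) {k : Fin n → ℤ} (hk : k ∈ S) : g k = 0 := by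
  have e := integral_norm_trigPoly_sq S g
  simp only [h, norm_zero, ne_eq, OfNat.ofNat_ne_zero, not_false_eq_true, zero_pow,
    integral_zero] at e
  have := (Finset.sum_eq_zero_iff_of_nonneg fun k _ => by positivity).mp e.symm k hk
  simpa using this

theorem symbol_mul_vcoef_eq_zero (hχ : IsCutoff χ) {f : Torus n → V3}
    (hf : MemLp f 2 (torusMeasure n)) {q : ℤ} (h : ∀ x, block χ q f x = 0)
    (k : Fin n → ℤ) (c : Fin 3) : (symbol χ q (freq k) : ℂ) * vcoef f k c = 0 := by
  obtain ⟨N, hN⟩ := exists_nat_ge (2 * lam q)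
  by_cases hk : k ∈ box n N
  · refine eq_zero_of_trigPoly_eq_zero (S := box n N)
      (g := fun m => symbol χ q (freq m) * vcoef f m c) (fun x => ?_) hk
    rw [← block_apply hχ hf hN, h x]
    rfl
  · rw [symbol_freq_eq_zero hχ hN hk]
    simp

/-- If the blocks up to the level `Q` vanish, so do the Fourier coefficients at all frequencies up
to `3/2 · 2^Q`. -/
theorem vcoef_eq_zero_of_block_eq_zero (hχ : IsCutoff χ) {f : Torus n → V3}
    (hf : MemLp f 2 (torusMeasure n)) {Q : ℕ}
    (h : ∀ q : ℤ, -1 ≤ q → q ≤ Q → ∀ x, block χ q f x = 0) {k : Fin n → ℤ}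
    (hk : ‖freq k‖ ≤ 3 / 2 * 2 ^ Q) : vcoef f k = 0 := by
  funext c
  have e : (lowSymbol χ Q (freq k) : ℂ) * vcoef f k c = 0 := by
    rw [← sum_symbol, Complex.ofReal_sum, Finset.sum_mul]
    refine Finset.sum_eq_zero fun q hq => ?_
    rw [Finset.mem_Icc] at hq
    exact symbol_mul_vcoef_eq_zero hχ hf (h q hq.1 hq.2) k c
  rw [lowSymbol_eq_one hχ (by rwa [lam_natCast])] at e
  simpa using e

/-! ### Gradients of low-pass parts -/

theorem lowPass_eq_sum (hχ : IsCutoff χ) (f : Torus n → V3) (Q : ℕ) {N : ℕ}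
    (hN : 2 ^ (Q + 1) ≤ N) (x : Torus n) :
    lowPass χ Q f x = ∑ m ∈ box n N, mFourier m x • (lowSymbol χ Q (freq m) : ℂ) • coeff f m := by
  have hN' : ((2 ^ (Q + 1) : ℕ) : ℝ) ≤ N := by exact_mod_cast hN
  have hb : ∀ q ∈ Finset.Icc (-1 : ℤ) Q, block χ q f x
      = ∑ m ∈ box n N, ((symbol χ q (freq m) : ℂ) * mFourier m x) • coeff f m := fun q hq => by
    rw [Finset.mem_Icc] at hq
    refine block_eq_sum hχ f (le_trans ?_ hN') x
    have : lam q ≤ lam (Q : ℤ) := zpow_le_zpow_right₀ (by norm_num) hq.2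
    rw [lam_natCast] at this
    push_cast
    rw [pow_succ]
    linarith
  rw [lowPass, Finset.sum_congr rfl hb, Finset.sum_comm]
  refine Finset.sum_congr rfl fun m _ => ?_
  rw [← Finset.sum_smul, ← Finset.sum_mul, ← Complex.ofReal_sum, sum_symbol, smul_smul, mul_comm]

theorem fieldGradient_lowPass (hχ : IsCutoff χ) (f : Torus n → V3) (Q : ℕ) {N : ℕ}
    (hN : 2 ^ (Q + 1) ≤ N) (x : Torus n) (j : Fin n) :
    fieldGradient (lowPass χ Q f) x j
      = ∑ m ∈ box n N, (twoPiI * m j * mFourier m x) • (lowSymbol χ Q (freq m) : ℂ) • coeff f m := by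
  have h : HasDerivAt (fun h : ℝ => lowPass χ Q f (x + Pi.single j (h : UnitAddCircle)))
      (∑ m ∈ box n N, (twoPiI * m j * mFourier m x) • (lowSymbol χ Q (freq m) : ℂ) • coeff f m)
      0 := by
    simp_rw [lowPass_eq_sum hχ f Q hN]
    exact HasDerivAt.fun_sum fun m _ => (hasDerivAt_mFourier_add_single m j x).smul_const _
  exact h.deriv

theorem continuous_fieldGradient_lowPass (hχ : IsCutoff χ) (f : Torus n → V3) (Q : ℕ) :
    Continuous (fieldGradient (lowPass χ Q f)) := by
  refine (PiLp.continuous_toLp 2 _).comp (continuous_pi fun j => ?_)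
  have h : ∀ x, partialD j (lowPass χ Q f) x = _ := fun x =>
    fieldGradient_lowPass hχ f Q le_rfl x j
  rw [funext h]
  exact continuous_finsetSum _ fun m _ =>
    (continuous_const.mul (continuous_mFourier m)).smul continuous_const

/-- An essential bound for a continuous function holds everywhere. -/
theorem norm_le_of_eLpNorm_top_le {E : Type*} [NormedAddCommGroup E] {g : Torus n → E}
    (hg : Continuous g) {C : ℝ} (hC : 0 ≤ C)
    (h : eLpNorm g ∞ (torusMeasure n) ≤ ENNReal.ofReal C) (x : Torus n) : ‖g x‖ ≤ C := by
  have hae : ∀ᵐ x ∂(torusMeasure n), x ∈ {x | ‖g x‖ ≤ C} := by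
    rw [eLpNorm_exponent_top] at h
    filter_upwards [enorm_ae_le_eLpNormEssSup g (torusMeasure n)] with x hx
    have := hx.trans h
    rwa [← ofReal_norm, ENNReal.ofReal_le_ofReal_iff hC] at this
  have hcl : IsClosed {x | ‖g x‖ ≤ C} := isClosed_le hg.norm continuous_const
  have huniv := (hcl.ae_eq_univ_iff_eq (μ := torusMeasure n)).mp
    (eventuallyEq_univ.mpr hae)
  have : x ∈ {x | ‖g x‖ ≤ C} := huniv ▸ mem_univ x
  exact this

/-- The bound on the gradient of a low-pass part, read on the Fourier side. -/
theorem norm_trigPoly_lowSymbol_le (hχ : IsCutoff χ) {f : Torus n → V3}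
    (hf : MemLp f 2 (torusMeasure n)) {Q : ℕ} {C : ℝ} (hC : 0 ≤ C)
    (h : eLpNorm (fieldGradient (lowPass χ Q f)) ∞ (torusMeasure n) ≤ ENNReal.ofReal C)
    (j c : Fin 3) {N : ℕ} (hN : 2 ^ (Q + 1) ≤ N) (x : Torus n) :
    ‖trigPoly (box n N) (fun m => lowSymbol χ Q (freq m) * (emb m j * vcoef f m c)) x‖ ≤ C := by
  by_cases hj : (j : ℕ) < n
  · have h1 := norm_le_of_eLpNorm_top_le (continuous_fieldGradient_lowPass hχ f Q) hC h x
    have h2 := (PiLp.norm_apply_le (fieldGradient (lowPass χ Q f) x) ⟨j, hj⟩).trans h1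
    have h3 := (PiLp.norm_apply_le (fieldGradient (lowPass χ Q f) x ⟨j, hj⟩) c).trans h2
    have e : fieldGradient (lowPass χ Q f) x ⟨j, hj⟩ c = twoPiI * trigPoly (box n N)
        (fun m => lowSymbol χ Q (freq m) * (emb m j * vcoef f m c)) x := by
      rw [fieldGradient_lowPass hχ f Q hN, trigPoly, WithLp.ofLp_sum, Finset.sum_apply,
        Finset.mul_sum]
      refine Finset.sum_congr rfl fun m _ => ?_
      rw [PiLp.smul_apply, PiLp.smul_apply, coeff_apply hf, smul_eq_mul, smul_eq_mul, emb,
        dif_pos hj]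
      ring
    rw [e, norm_mul, norm_twoPiI] at h3
    have hp := norm_nonneg (trigPoly (box n N)
        (fun m => lowSymbol χ Q (freq m) * (emb m j * vcoef f m c)) x)
    nlinarith [Real.pi_gt_three]
  · simp [trigPoly, emb, hj, hC]

/-! ### Fields with a finite determining wavenumber -/

variable {r δ c : ℝ}

/-- The first condition at an admissible level. The factor `λ_{p-q}^δ` is at least one. -/
theorem Admissible.integral_rpow_le (hχ : IsCutoff χ) {f : Torus n → V3}
    (hf : MemLp f 2 (torusMeasure n)) (hr : 1 < r) (hδ : 0 ≤ δ) {q : ℕ}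
    (hcμ : 0 < c * μ) (h : Admissible χ r δ c μ f q) {p : ℕ} (hp : q < p) (a : Fin 3) {N : ℕ}
    (hN : 2 ^ (p + 1) ≤ N) :
    (∫ x, ‖trigPoly (box n N) (fun m => symbol χ p (freq m) * vcoef f m a) x‖ ^ r
      ∂(torusMeasure n)) ^ (1 / r) ≤ c * μ * (2 ^ (-(n / r) : ℝ)) ^ p := by
  have hr0 : 0 < r := by linarith
  have hN' : 2 * lam (p : ℤ) ≤ N := by
    rw [lam_natCast, mul_comm, ← pow_succ]
    exact_mod_cast hN
  have e : ∀ x, trigPoly (box n N) (fun m => symbol χ p (freq m) * vcoef f m a) x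
      = block χ p f x a := fun x => (block_apply hχ hf hN' x a).symm
  simp_rw [e]
  set I := (∫ x, ‖block χ p f x a‖ ^ r ∂(torusMeasure n)) ^ (1 / r) with hI
  have hcont : Continuous fun x => block χ p f x a := by
    rw [funext fun x => (e x).symm]
    exact continuous_trigPoly _ _
  have hI0 : 0 ≤ I := Real.rpow_nonneg (integral_nonneg fun x => by positivity) _
  have h1 : ENNReal.ofReal I ≤ eLpNorm (block χ p f) (ENNReal.ofReal r) (torusMeasure n) := by
    have hm := memLp_of_continuous hcont (ENNReal.ofReal r)
    have := hm.eLpNorm_eq_integral_rpow_norm (by simpa using hr0) (by simp)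
    rw [ENNReal.toReal_ofReal hr0.le] at this
    rw [hI, one_div, ← this]
    exact eLpNorm_mono fun x => PiLp.norm_apply_le (block χ p f x) a
  have hA : 1 ≤ lam ((p : ℤ) - q) ^ δ := by
    refine Real.one_le_rpow ?_ hδ
    exact one_le_zpow₀ (by norm_num) (by lia)
  have hL : 0 < lam p ^ ((n : ℝ) / r) := Real.rpow_pos_of_pos (lam_pos _) _
  have h2 : ENNReal.ofReal (lam p ^ ((n : ℝ) / r) * I) ≤ ENNReal.ofReal (c * μ) := by
    refine le_trans ?_ (h.1 p hp).le
    rw [ENNReal.ofReal_mul hL.le]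
    refine mul_le_mul' (ENNReal.ofReal_le_ofReal ?_) h1
    exact le_mul_of_one_le_left hL.le hA
  rw [ENNReal.ofReal_le_ofReal_iff hcμ.le] at h2
  have e2 : ((2 : ℝ) ^ (-(n / r) : ℝ)) ^ p = (lam p ^ ((n : ℝ) / r))⁻¹ := by
    rw [lam_natCast, ← Real.rpow_natCast, ← Real.rpow_natCast, ← Real.rpow_mul (by norm_num),
      ← Real.rpow_mul (by norm_num), ← Real.rpow_neg (by norm_num)]
    congr 1
    ring
  rw [e2, ← div_eq_mul_inv, le_div_iff₀ hL]
  linarith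

theorem Admissible.eLpNorm_fieldGradient_le {f : Torus n → V3} {q : ℕ}
    (h : Admissible χ r δ c μ f q) :
    eLpNorm (fieldGradient (lowPass χ q f)) ∞ (torusMeasure n)
      ≤ ENNReal.ofReal (c * μ * 2 ^ q) := by
  have h2 := h.2.le
  have hl := lam_pos (q : ℤ)
  calc _ = ENNReal.ofReal (lam q) * (ENNReal.ofReal (lam q)⁻¹ *
        eLpNorm (fieldGradient (lowPass χ q f)) ∞ (torusMeasure n)) := by
        rw [← mul_assoc, ← ENNReal.ofReal_mul hl.le, mul_inv_cancel₀ hl.ne', ENNReal.ofReal_one,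
          one_mul]
    _ ≤ ENNReal.ofReal (lam q) * ENNReal.ofReal (c * μ) := by gcongr
    _ = _ := by rw [← ENNReal.ofReal_mul hl.le, lam_natCast, mul_comm]

/-- Bernstein's inequality for the blocks above an admissible level. -/
theorem Admissible.norm_deriv_block_le (hχ : IsCutoff χ) {f : Torus n → V3}
    (hf : MemLp f 2 (torusMeasure n)) (hn : n ≤ 3) (hr : 1 < r) (hnr : n < r) (hδ : 0 ≤ δ) {q : ℕ}
    (hcμ : 0 < c * μ) (h : Admissible χ r δ c μ f q) {p : ℕ} (hp : q < p) (j a : Fin 3) {N : ℕ}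
    (hN : 2 ^ (p + 1) ≤ N) (x : Torus n) :
    ‖trigPoly (box n N) (fun m => symbol χ p (freq m) * (emb m j * vcoef f m a)) x‖
      ≤ 3072 * (c * μ) * 2 ^ p := by
  by_cases hj : (j : ℕ) < n
  · have hr0 : 0 < r := by linarith
    have e : trigPoly (box n N) (fun m => symbol χ p (freq m) * (emb m j * vcoef f m a)) x
        = trigPoly (box n (2 ^ (p + 1)))
          (fun m => (m ⟨j, hj⟩ : ℂ) * (symbol χ p (freq m) * vcoef f m a)) x := by
      rw [trigPoly_box_eq hN fun m hm => ?_]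
      · simp only [trigPoly, emb, dif_pos hj]
        exact Finset.sum_congr rfl fun m _ => by ring
      · rw [symbol_freq_eq_zero hχ ?_ hm]
        · simp
        · rw [lam_natCast]
          push_cast
          rw [pow_succ]
          linarith
    rw [e]
    refine (norm_deriv_trigPoly_le _ _ hr _ x).trans ?_
    have h1 := h.integral_rpow_le hχ hf hr hδ hcμ hp a le_rfl
    set I := (∫ x, ‖trigPoly (box n (2 ^ (p + 1)))
      (fun m => symbol χ p (freq m) * vcoef f m a) x‖ ^ r ∂(torusMeasure n)) ^ (1 / r)
    -- the number of frequencies compensates the decay of the blocks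
    have h2 : ((box n (2 ^ (p + 1))).card : ℝ) ^ (1 / r) ≤ 8 * 2 ^ ((p : ℝ) * (n / r)) := by
      have hc : ((box n (2 ^ (p + 1))).card : ℝ) ≤ (8 * 2 ^ p) ^ n := by
        rw [card_box]
        push_cast
        refine pow_le_pow_left₀ (by positivity) ?_ n
        have : (1 : ℝ) ≤ 2 ^ p := one_le_pow₀ (by norm_num)
        rw [pow_succ]
        linarith
      calc ((box n (2 ^ (p + 1))).card : ℝ) ^ (1 / r) ≤ ((8 * 2 ^ p) ^ n : ℝ) ^ (1 / r) := by gcongr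
        _ = (8 * 2 ^ p) ^ ((n : ℝ) / r) := by
            rw [← Real.rpow_natCast, ← Real.rpow_mul (by positivity), mul_one_div]
        _ = 8 ^ ((n : ℝ) / r) * 2 ^ ((p : ℝ) * (n / r)) := by
            rw [Real.mul_rpow (by norm_num) (by positivity), ← Real.rpow_natCast 2 p,
              ← Real.rpow_mul (by norm_num)]
        _ ≤ 8 * 2 ^ ((p : ℝ) * (n / r)) := by
            gcongr
            refine Real.rpow_le_self_of_one_le (by norm_num) ?_
            rw [div_le_one hr0]
            exact hnr.le
    have h3 : (2 : ℝ) ^ ((p : ℝ) * (n / r)) * (2 ^ (-(n / r) : ℝ)) ^ p = 1 := by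
      rw [← Real.rpow_natCast, ← Real.rpow_mul (by norm_num), ← Real.rpow_add (by norm_num)]
      rw [show (p : ℝ) * (n / r) + -(n / r) * p = 0 by ring, Real.rpow_zero]
    have h4 : (4 : ℝ) ^ n ≤ 64 := by
      calc (4 : ℝ) ^ n ≤ 4 ^ 3 := pow_le_pow_right₀ (by norm_num) hn
        _ = 64 := by norm_num
    have hI0 : 0 ≤ I := Real.rpow_nonneg (integral_nonneg fun x => by positivity) _
    push_cast
    calc 3 * 2 ^ (p + 1) * 4 ^ n * ((box n (2 ^ (p + 1))).card : ℝ) ^ (1 / r) * I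
        ≤ 3 * 2 ^ (p + 1) * 64 * (8 * 2 ^ ((p : ℝ) * (n / r)))
          * (c * μ * (2 ^ (-(n / r) : ℝ)) ^ p) := by gcongr
      _ = 3072 * (c * μ) * 2 ^ p
          * (2 ^ ((p : ℝ) * (n / r)) * (2 ^ (-(n / r) : ℝ)) ^ p) := by ring
      _ = _ := by rw [h3, mul_one]
  · have : 0 ≤ 3072 * (c * μ) * 2 ^ p := by positivity
    simpa [trigPoly, emb, hj] using this

/-- At an admissible level, a field is controlled by a multiple of `c μ`. The bound for the gradient
of a low-pass part above that level comes from Bernstein's inequality for the blocks in between. -/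
theorem Admissible.controlled (hχ : IsCutoff χ) {f : Torus n → V3}
    (hf : MemLp f 2 (torusMeasure n)) (hn : n ≤ 3) (hr : 1 < r) (hnr : n < r) (hδ : 0 ≤ δ) {q : ℕ}
    (hcμ : 0 < c * μ) (h : Admissible χ r δ c μ f q) :
    Controlled (fun p m => (symbol χ p (freq m) : ℂ)) (fun P m => (lowSymbol χ P (freq m) : ℂ)) r
      (2 ^ (-(n / r) : ℝ)) (6144 * (c * μ)) q (vcoef f) := by
  constructor
  · suffices H : ∀ P, q ≤ P → ∀ j a N, 2 ^ (P + 1) ≤ N → ∀ x : Torus n,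
        ‖trigPoly (box n N) (fun m => lowSymbol χ P (freq m) * (emb m j * vcoef f m a)) x‖
          ≤ 6144 * (c * μ) * 2 ^ P by exact_mod_cast H
    intro P hP j a
    induction P, hP using Nat.le_induction with
    | base =>
      intro N hN x
      refine (norm_trigPoly_lowSymbol_le hχ hf (by positivity) h.eLpNorm_fieldGradient_le j a hN
        x).trans ?_
      have : 0 < c * μ * 2 ^ q := by positivity
      linarith
    | succ P hP ih =>
      intro N hN x
      have e : trigPoly (box n N) (fun m => lowSymbol χ (P + 1 : ℕ) (freq m) *
            (emb m j * vcoef f m a)) x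
          = trigPoly (box n N) (fun m => lowSymbol χ P (freq m) * (emb m j * vcoef f m a)) x
            + trigPoly (box n N) (fun m => symbol χ (P + 1 : ℕ) (freq m) *
              (emb m j * vcoef f m a)) x := by
        simp only [trigPoly, ← Finset.sum_add_distrib]
        refine Finset.sum_congr rfl fun m _ => ?_
        rw [symbol_succ]
        push_cast
        ring
      rw [e]
      refine (norm_add_le _ _).trans ?_
      have h1 := ih N (le_trans (Nat.pow_le_pow_right (by norm_num) (by lia)) hN) x
      have h2 := h.norm_deriv_block_le hχ hf hn hr hnr hδ hcμ (Nat.lt_succ_of_le hP) j a hN x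
      rw [pow_succ] at h2 ⊢
      linarith
  · intro p hp a N hN
    refine (h.integral_rpow_le hχ hf hr hδ hcμ hp a hN).trans ?_
    have : 0 ≤ c * μ * (2 ^ (-(n / r) : ℝ)) ^ p := by positivity
    linarith

/-! ### Vanishing below the determining wavenumber -/

theorem vcoef_sub {f g : Torus n → V3} (hf : MemLp f 2 (torusMeasure n))
    (hg : MemLp g 2 (torusMeasure n)) : vcoef (f - g) = vcoef f - vcoef g := by
  funext k a
  exact fcoef_sub (memLp_apply hf a) (memLp_apply hg a) k

theorem vcoef_eq_zero_of_vanishesUpTo_top (hχ : IsCutoff χ) {f : Torus n → V3}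
    (hf : MemLp f 2 (torusMeasure n)) (h : VanishesUpTo χ ∞ f) : vcoef f = 0 := by
  funext k
  obtain ⟨Q, hQ⟩ := pow_unbounded_of_one_lt ‖freq k‖ (one_lt_two (α := ℝ))
  refine vcoef_eq_zero_of_block_eq_zero hχ hf (Q := Q) (fun q hq _ => h q hq le_top) ?_
  have : (0 : ℝ) < 2 ^ Q := by positivity
  linarith

/-- If `f` vanishes up to the determining wavenumber of `g`, then either `f = 0`, or there is a
level `q` which is admissible for `g` and such that `f` lives at frequencies above `3/2 · 2^q`. -/
theorem exists_admissible_of_vanishesUpTo (hχ : IsCutoff χ) {f g : Torus n → V3}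
    (hf : MemLp f 2 (torusMeasure n)) {Λ : ℝ≥0∞} (hΛ : wavenumber χ r δ c μ g ≤ Λ)
    (h : VanishesUpTo χ Λ f) :
    vcoef f = 0 ∨ ∃ q : ℕ, Admissible χ r δ c μ g q ∧
      ∀ k, ‖freq k‖ ≤ 3 / 2 * 2 ^ q → vcoef f k = 0 := by
  classical
  by_cases hex : ∃ q : ℕ, Admissible χ r δ c μ g q
  · right
    refine ⟨Nat.find hex, Nat.find_spec hex, fun k hk =>
      vcoef_eq_zero_of_block_eq_zero hχ hf (fun q hq hqQ => h q hq ?_) hk⟩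
    refine le_trans (le_iInf₂ fun p hp => ENNReal.ofReal_le_ofReal ?_) hΛ
    have : Nat.find hex ≤ p := Nat.find_min' hex hp
    exact zpow_le_zpow_right₀ (by norm_num) (hqQ.trans (by exact_mod_cast this))
  · left
    push Not at hex
    have : wavenumber χ r δ c μ g = ∞ := by
      simp [wavenumber, hex]
    rw [this, top_le_iff] at hΛ
    rw [hΛ] at h
    exact vcoef_eq_zero_of_vanishesUpTo_top hχ hf h

/-- The trilinear estimate for a field `f` which vanishes up to the determining wavenumber of `g`. -/
theorem norm_sum_triad_le_of_vanishesUpTo (hn : n = 2 ∨ n = 3) (hχ : IsCutoff χ) (hnr : n < r)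
    (hδ : 0 ≤ δ) (hcμ : 0 < c * μ) {f g : Torus n → V3} (hf : MemLp f 2 (torusMeasure n))
    (hfd : ∀ k, emb k ⬝ᵥ vcoef f k = 0) (hg : MemLp g 2 (torusMeasure n)) (hgd : DivFree g) {Λ : ℝ≥0∞}
    (hΛ : wavenumber χ r δ c μ g ≤ Λ) (h : VanishesUpTo χ Λ f) (N : ℕ) :
    ‖∑ k ∈ box n N, ∑ l ∈ box n N, triad (vcoef f) (vcoef g) k l‖
      ≤ 160000 / (1 - 2 ^ (-(n / r) : ℝ)) * (6144 * (c * μ))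
        * ∑ k ∈ box n N, vsq (vcoef f k) := by
  have hn3 : n ≤ 3 := by lia
  have hr2 : 2 < r := by
    have : (2 : ℝ) ≤ n := by
      have : 2 ≤ n := by lia
      exact_mod_cast this
    linarith
  rcases exists_admissible_of_vanishesUpTo hχ hf hΛ h with h0 | ⟨q, hq, hv⟩
  · simp [h0, triad, potential, vsq]
  · refine norm_sum_triad_le hn (fun q m h1 h2 => ?_) (fun P m hm => ?_) hr2 hnr
      (hq.controlled hχ hg hn3 (by linarith) hnr hδ hcμ) (by positivity) hfd
      (emb_dot_vcoef hg hgd) (fun k hk => ?_) _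
    · exact_mod_cast symbol_add_symbol_add_symbol hχ q (freq m) h1 h2
    · have : lowSymbol χ P (freq m) = 1 := by
        refine lowSymbol_eq_one hχ ?_
        rw [lam_natCast]
        have : (0 : ℝ) < 2 ^ P := by positivity
        linarith
      exact_mod_cast this
    · by_contra hlt
      refine hk (hv k ?_)
      have : (0 : ℝ) < 2 ^ q := by positivity
      linarith

/-- For a small constant `c` the interactions of the two solutions with their difference are
absorbed by the dissipation. -/
theorem dominated_of_vanishesUpTo (hn : n = 2 ∨ n = 3) (hχ : IsCutoff χ) (hnr : n < r)
    (hδ : 0 ≤ δ) (hc : 0 < c) (hμ : 0 < μ)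
    (hc₀ : c ≤ (1 - 2 ^ (-(n / r) : ℝ)) / (2 * (160000 * 6144)))
    (h₁ : IsWeakSolution μ b₁) (h₂ : IsWeakSolution μ b₂) {t : ℝ} (ht : 0 ≤ t)
    (h : VanishesUpTo χ (max (wavenumber χ r δ c μ (b₁ t)) (wavenumber χ r δ c μ (b₂ t)))
      (b₁ t - b₂ t)) :
    Dominated μ (vcoef (b₁ t)) (vcoef (b₂ t)) := by
  have m₁ := h₁.memL2 t ht
  have m₂ := h₂.memL2 t ht
  have hm : MemLp (b₁ t - b₂ t) 2 (torusMeasure n) := m₁.sub m₂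
  have hw := vcoef_sub m₁ m₂
  have hdiv : ∀ k, emb k ⬝ᵥ vcoef (b₁ t - b₂ t) k = 0 := fun k => by
    rw [hw, Pi.sub_apply, dotProduct_sub, emb_dot_vcoef m₁ (h₁.divFree t ht),
      emb_dot_vcoef m₂ (h₂.divFree t ht), sub_zero]
  have hn0 : 0 < (n : ℝ) := by rcases hn with rfl | rfl <;> norm_num
  have hθ : (2 : ℝ) ^ (-(n / r) : ℝ) < 1 :=
    Real.rpow_lt_one_of_one_lt_of_neg (by norm_num)
      (neg_lt_zero.mpr (div_pos hn0 (hn0.trans hnr)))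
  set θ : ℝ := 2 ^ (-(n / r) : ℝ)
  have hK : 160000 / (1 - θ) * (6144 * (c * μ)) ≤ μ / 2 := by
    have hp : 0 < 1 - θ := by linarith
    rw [le_div_iff₀ (by norm_num)] at hc₀
    rw [div_mul_eq_mul_div, div_le_iff₀ hp]
    have := mul_le_mul_of_nonneg_left hc₀ hμ.le
    linarith
  have key : ∀ {g : Torus n → V3}, MemLp g 2 (torusMeasure n) → DivFree g →
      wavenumber χ r δ c μ g ≤ max (wavenumber χ r δ c μ (b₁ t)) (wavenumber χ r δ c μ (b₂ t)) →
      ∀ N, ‖∑ k ∈ box n N, ∑ l ∈ box n N, triad (vcoef (b₁ t - b₂ t)) (vcoef g) k l‖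
        ≤ μ / 2 * ∑ k ∈ box n N, vsq (vcoef (b₁ t - b₂ t) k) := fun hg hgd hΛ N =>
    (norm_sum_triad_le_of_vanishesUpTo hn hχ hnr hδ (mul_pos hc hμ) hm hdiv hg hgd hΛ h N).trans
      (mul_le_mul_of_nonneg_right hK (Finset.sum_nonneg fun _ _ => vsq_nonneg _))
  have hz : vcoef (b₁ t - b₂ t) 0 = 0 := by
    refine vcoef_eq_zero_of_block_eq_zero hχ hm (Q := 0) ?_ (k := 0) ?_
    · -- the wavenumber is at least one, so that the blocks with `q ≤ 0` vanish
      intro q hq hq0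
      refine h q hq (le_max_of_le_left (le_iInf₂ fun p _ => ENNReal.ofReal_le_ofReal ?_))
      exact zpow_le_zpow_right₀ (by norm_num) (hq0.trans (by positivity))
    · rw [← sqrt_ksq_eq, ksq_zero]
      norm_num
  exact ⟨hw ▸ hz, hw ▸ key m₁ (h₁.divFree t ht) (le_max_left _ _),
    hw ▸ key m₂ (h₂.divFree t ht) (le_max_right _ _)⟩

/-! ### Convergence in Sobolev spaces of negative order -/

theorem integral_norm_block_sq (hχ : IsCutoff χ) {f : Torus n → V3}
    (hf : MemLp f 2 (torusMeasure n)) {q : ℤ} {N : ℕ} (hN : 2 * lam q ≤ N) :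
    ∫ x, ‖block χ q f x‖ ^ 2 ∂(torusMeasure n)
      = ∑ k ∈ box n N, symbol χ q (freq k) ^ 2 * vsq (vcoef f k) := by
  have e : ∀ x, ‖block χ q f x‖ ^ 2 = ∑ c, ‖trigPoly (box n N)
      (fun m => symbol χ q (freq m) * vcoef f m c) x‖ ^ 2 := fun x => by
    rw [EuclideanSpace.norm_sq_eq]
    exact Finset.sum_congr rfl fun c _ => by rw [block_apply hχ hf hN]
  simp_rw [e]
  have hi : ∀ c, Integrable (fun x => ‖trigPoly (box n N)
      (fun m => symbol χ q (freq m) * vcoef f m c) x‖ ^ 2) (torusMeasure n) := fun c =>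
    integrable_of_continuous ((continuous_trigPoly _ _).norm.pow 2)
  rw [integral_finsetSum _ fun c _ => hi c]
  simp_rw [integral_norm_trigPoly_sq]
  rw [Finset.sum_comm]
  refine Finset.sum_congr rfl fun k _ => ?_
  rw [vsq, Finset.mul_sum]
  refine Finset.sum_congr rfl fun c _ => ?_
  rw [norm_mul, mul_pow, Complex.norm_real, Real.norm_eq_abs, sq_abs]

theorem ksq_le_of_mem_box {N : ℕ} {k : Fin n → ℤ} (hk : k ∈ box n N) :
    (ksq k : ℝ) ≤ n * (N : ℝ) ^ 2 := by
  rw [ksq_cast]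
  calc ∑ i, (k i : ℝ) ^ 2 ≤ ∑ _i : Fin n, (N : ℝ) ^ 2 := by
        refine Finset.sum_le_sum fun i _ => ?_
        rw [← sq_abs]
        refine pow_le_pow_left₀ (abs_nonneg _) ?_ 2
        exact_mod_cast mem_box.mp hk i
    _ = n * (N : ℝ) ^ 2 := by simp

/-- On a bounded set of frequencies the `L²` norm is controlled by the norm in `H⁻¹`. -/
theorem sum_box_vsq_le_energy {u : (Fin n → ℤ) → Fin 3 → ℂ} (hu : Summable fun k => vsq (u k))
    (h0 : u 0 = 0) (N : ℕ) :
    ∑ k ∈ box n N, vsq (u k) ≤ 4 * Real.pi ^ 2 * (n * (N : ℝ) ^ 2) * energy u := by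
  calc ∑ k ∈ box n N, vsq (u k)
      ≤ ∑ k ∈ box n N, 4 * Real.pi ^ 2 * (n * (N : ℝ) ^ 2) *
          ((4 * Real.pi ^ 2 * (ksq k : ℝ))⁻¹ * vsq (u k)) := by
        refine Finset.sum_le_sum fun k hk => ?_
        by_cases hk0 : k = 0
        · simp [hk0, h0, vsq]
        · have h1 := one_le_ksq hk0
          rw [← mul_assoc]
          refine le_mul_of_one_le_left (vsq_nonneg _) ?_
          rw [← div_eq_mul_inv, one_le_div (by positivity)]
          exact mul_le_mul_of_nonneg_left (ksq_le_of_mem_box hk) (by positivity)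
    _ ≤ _ := by
        rw [← Finset.mul_sum]
        refine mul_le_mul_of_nonneg_left ?_ (by positivity)
        exact (summable_energy hu).sum_le_tsum _ fun k _ =>
          mul_nonneg (by positivity) (vsq_nonneg _)

theorem sobolevNorm_eq (hχ : IsCutoff χ) (s : ℝ) (f : Torus n → V3)
    (hs : Summable fun m : ℕ => lam ((m : ℤ) - 1) ^ (2 * s) *
      ∫ x, ‖block χ ((m : ℤ) - 1) f x‖ ^ 2 ∂(torusMeasure n)) :
    sobolevNorm χ s f = ENNReal.ofReal (∑' m : ℕ, lam ((m : ℤ) - 1) ^ (2 * s) *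
      ∫ x, ‖block χ ((m : ℤ) - 1) f x‖ ^ 2 ∂(torusMeasure n)) ^ (1 / 2 : ℝ) := by
  have hl : ∀ m : ℕ, 0 ≤ lam ((m : ℤ) - 1) ^ (2 * s) := fun m =>
    Real.rpow_nonneg (lam_pos _).le _
  rw [sobolevNorm, ENNReal.ofReal_tsum_of_nonneg (fun m => mul_nonneg (hl m)
    (integral_nonneg fun x => by positivity)) hs]
  congr 2
  funext m
  rw [ENNReal.ofReal_mul (hl m), eLpNorm_two_sq (memLp_of_continuous (continuous_block hχ f _) 2)]

/-- A family which is bounded in `L²` and tends to zero in `H⁻¹` tends to zero in every Sobolev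
space of negative order. -/
theorem tendsto_sobolevNorm (hχ : IsCutoff χ) {s : ℝ} (hs : s < 0) {f : ℝ → Torus n → V3}
    (hf : ∀ t, 0 ≤ t → MemLp (f t) 2 (torusMeasure n)) {M : ℝ}
    (hM : ∀ t, 0 ≤ t → s0 (vcoef (f t)) ≤ M) (h0 : ∀ t, 0 ≤ t → vcoef (f t) 0 = 0)
    (hE : Tendsto (fun t => energy (vcoef (f t))) atTop (𝓝 0)) :
    Tendsto (fun t => sobolevNorm χ s (f t)) atTop (𝓝 0) := by
  obtain ⟨B, hB0, hB⟩ := exists_abs_symbol_le hχ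
  have hl : ∀ m : ℕ, 0 ≤ lam ((m : ℤ) - 1) ^ (2 * s) := fun m =>
    Real.rpow_nonneg (lam_pos _).le _
  set e : ℝ → ℕ → ℝ := fun t m => lam ((m : ℤ) - 1) ^ (2 * s) *
      ∫ x, ‖block χ ((m : ℤ) - 1) (f t) x‖ ^ 2 ∂(torusMeasure n) with he
  have he0 : ∀ t m, 0 ≤ e t m := fun t m =>
    mul_nonneg (hl m) (integral_nonneg fun x => by positivity)
  have hsum : ∀ t, 0 ≤ t → Summable fun k => vsq (vcoef (f t) k) := fun t ht =>
    (hasSum_vsq_vcoef (hf t ht)).summable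
  have hblock : ∀ t, 0 ≤ t → ∀ (q : ℤ) (N : ℕ), 2 * lam q ≤ N →
      ∫ x, ‖block χ q (f t) x‖ ^ 2 ∂(torusMeasure n)
        ≤ B ^ 2 * ∑ k ∈ box n N, vsq (vcoef (f t) k) := fun t ht q N hN => by
    rw [integral_norm_block_sq hχ (hf t ht) hN, Finset.mul_sum]
    refine Finset.sum_le_sum fun k _ => mul_le_mul_of_nonneg_right ?_ (vsq_nonneg _)
    rw [← sq_abs]
    exact pow_le_pow_left₀ (abs_nonneg _) (hB _ _) 2
  have hdom : ∀ t, 0 ≤ t → ∀ m, e t m ≤ lam ((m : ℤ) - 1) ^ (2 * s) * (B ^ 2 * M) :=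
    fun t ht m => by
      obtain ⟨N, hN⟩ := exists_nat_ge (2 * lam ((m : ℤ) - 1))
      refine mul_le_mul_of_nonneg_left ((hblock t ht _ N hN).trans ?_) (hl m)
      gcongr
      exact ((hsum t ht).sum_le_tsum _ fun _ _ => vsq_nonneg _).trans (hM t ht)
  have hgeom : Summable fun m : ℕ => lam ((m : ℤ) - 1) ^ (2 * s) * (B ^ 2 * M) := by
    refine Summable.mul_right _ ?_
    have e1 : ∀ m : ℕ, lam ((m : ℤ) - 1) ^ (2 * s)
        = (2 : ℝ) ^ (-(2 * s)) * ((2 : ℝ) ^ (2 * s)) ^ m := fun m => by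
      rw [lam, ← Real.rpow_intCast, ← Real.rpow_mul (by norm_num), ← Real.rpow_natCast,
        ← Real.rpow_mul (by norm_num), ← Real.rpow_add (by norm_num)]
      congr 1
      push_cast
      ring
    simp_rw [e1]
    refine (summable_geometric_of_lt_one (by positivity) ?_).mul_left _
    exact Real.rpow_lt_one_of_one_lt_of_neg (by norm_num) (by linarith)
  have hterm : ∀ m, Tendsto (fun t => e t m) atTop (𝓝 0) := fun m => by
    obtain ⟨N, hN⟩ := exists_nat_ge (2 * lam ((m : ℤ) - 1))
    have hz := hE.const_mul (lam ((m : ℤ) - 1) ^ (2 * s) *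
      (B ^ 2 * (4 * Real.pi ^ 2 * (n * (N : ℝ) ^ 2))))
    rw [mul_zero] at hz
    refine squeeze_zero' (Eventually.of_forall fun t => he0 t m) ?_ hz
    filter_upwards [eventually_ge_atTop 0] with t ht
    rw [mul_assoc]
    refine mul_le_mul_of_nonneg_left ((hblock t ht _ N hN).trans ?_) (hl m)
    rw [mul_assoc]
    exact mul_le_mul_of_nonneg_left (sum_box_vsq_le_energy (hsum t ht) (h0 t ht) N) (by positivity)
  have hlim := tendsto_tsum_of_dominated_convergence (f := e) (g := fun _ => (0 : ℝ)) hgeom hterm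
    ((eventually_ge_atTop 0).mono fun t ht m => by
      rw [Real.norm_eq_abs, abs_of_nonneg (he0 t m)]
      exact hdom t ht m)
  rw [tsum_zero] at hlim
  have hc : Tendsto (fun t => ENNReal.ofReal (∑' m, e t m) ^ (1 / 2 : ℝ)) atTop (𝓝 0) := by
    have := ((ENNReal.continuous_rpow_const (y := 1 / 2)).tendsto _).comp
      (ENNReal.tendsto_ofReal hlim)
    rwa [ENNReal.ofReal_zero, ENNReal.zero_rpow_of_pos (by norm_num)] at this
  refine hc.congr' ?_
  filter_upwards [eventually_ge_atTop 0] with t ht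
  exact (sobolevNorm_eq hχ s (f t)
    (Summable.of_nonneg_of_le (he0 t) (hdom t ht) hgeom)).symm

end EMHD

end

theorem theorem3p1 (n : ℕ) (hn : n = 2 ∨ n = 3)
    (χ : EuclideanSpace ℝ (Fin n) → ℝ) (hχ : EMHD.IsCutoff χ)
    (r : ℝ) (hr : (n : ℝ) < r) (hr' : r < 2 * n) :
    ∃ c₀ : ℝ, 0 < c₀ ∧
      ∀ c : ℝ, 0 < c → c ≤ c₀ →
      ∀ μ : ℝ, 0 < μ →
      ∀ δ : ℝ, 0 ≤ δ →
      ∀ b₁ b₂ : ℝ → EMHD.Torus n → EMHD.V3,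
        EMHD.IsWeakSolution μ b₁ → EMHD.IsWeakSolution μ b₂ →
        (∀ᵐ t ∂(volume.restrict (Ioi (0 : ℝ))),
          EMHD.VanishesUpTo χ
            (max (EMHD.wavenumber χ r δ c μ (b₁ t)) (EMHD.wavenumber χ r δ c μ (b₂ t)))
            (b₁ t - b₂ t)) →
      ∀ s : ℝ, -((n : ℝ) / r) < s → s < (n : ℝ) / r - 1 →
        Tendsto (fun t => EMHD.sobolevNorm χ s (b₁ t - b₂ t)) atTop (𝓝 0) := by
  have hn0 : 0 < (n : ℝ) := by rcases hn with rfl | rfl <;> norm_num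
  have hr0 : 0 < r := hn0.trans hr
  have hθ : (2 : ℝ) ^ (-(n / r) : ℝ) < 1 :=
    Real.rpow_lt_one_of_one_lt_of_neg (by norm_num) (neg_lt_zero.mpr (div_pos hn0 hr0))
  refine ⟨(1 - 2 ^ (-(n / r) : ℝ)) / (2 * (160000 * 6144)), by
    have : 0 < 1 - (2 : ℝ) ^ (-(n / r) : ℝ) := by linarith
    positivity, ?_⟩
  intro c hc hc₀ μ hμ δ hδ b₁ b₂ h₁ h₂ hvan s _ hs
  have hn3 : n ≤ 3 := by lia
  have hs0 : s < 0 := by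
    have : (n : ℝ) / r < 1 := (div_lt_one hr0).mpr hr
    linarith
  have hd : ∀ᵐ t ∂(volume.restrict (Ioi (0 : ℝ))),
      EMHD.Dominated μ (EMHD.vcoef (b₁ t)) (EMHD.vcoef (b₂ t)) := by
    filter_upwards [hvan, ae_restrict_mem measurableSet_Ioi] with t ht ht0
    exact EMHD.dominated_of_vanishesUpTo hn hχ hr hδ hc hμ hc₀ h₁ h₂ (le_of_lt ht0) ht
  have hw : ∀ t, 0 ≤ t → EMHD.vcoef (b₁ t - b₂ t) = EMHD.vcoef (b₁ t) - EMHD.vcoef (b₂ t) :=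
    fun t ht => EMHD.vcoef_sub (h₁.memL2 t ht) (h₂.memL2 t ht)
  obtain ⟨M₁, -, hM₁⟩ := h₁.exists_s0_le
  obtain ⟨M₂, -, hM₂⟩ := h₂.exists_s0_le
  refine EMHD.tendsto_sobolevNorm hχ hs0 (M := 2 * M₁ ^ 2 + 2 * M₂ ^ 2)
    (fun t ht => (h₁.memL2 t ht).sub (h₂.memL2 t ht)) (fun t ht => ?_) (fun t ht => ?_) ?_
  · rw [hw t ht]
    have := EMHD.s0_sub_le (EMHD.hasSum_vsq_vcoef (h₁.memL2 t ht)).summable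
      (EMHD.hasSum_vsq_vcoef (h₂.memL2 t ht)).summable
    linarith [hM₁ t ht, hM₂ t ht]
  · rw [hw t ht]
    exact EMHD.zero_mode_eq_zero h₁ h₂ (hd.mono fun _ h => h.zero) ht
  · refine (EMHD.energy_decay hn3 hμ h₁ h₂ hd).congr' ?_
    filter_upwards [eventually_ge_atTop 0] with t ht
    rw [hw t ht]
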